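/- Let $d\in\mathbb N$, $\alpha>0$, $L^2=L^2(\mathbb R^d;\mathbb C)$, let $\mathfrak F=\bigoplus_{n\ge 0}(L^2)^{\otimes_{\mathrm{sym}}n}$ be the bosonic Fock space over $L^2$, and let $\mathfrak H=L^2\otimes\mathfrak F$ be the state space of one particle and a quantized field. Let $a(f)$, $f\in L^2$, be the annihilation operators on $\mathfrak F$, $(a(f)\Psi)_{n}=\alpha^{-1}\sqrt{n+1}\,\langle f|\Psi_{n+1}$ ($\langle f|$ contracts the first tensor factor with $f$, antilinearly in $f$), let $a^\dagger(f)=a(f)^*$, and let $\mathcal N$ be the number operator, equal to $\alpha^{-2}n$ on the $n$-particle sector. The same letters denote the operators $\mathds 1\otimes a(f)$, etc., on $\mathfrak H$. For a positive trace-class operator $\Gamma$ on $\mathfrak H$ let $\gamma=\mathrm{Tr}_{\mathfrak F}\Gamma$ (an operator on $L^2$). For a positive trace-class operator $G$ on $\mathfrak F$ with $\mathrm{Tr}(\mathcal N G)<\infty$ let $G^{(1,1)}$ be the bounded operator on $L^2$ with $$\langle g,G^{(1,1)}f\rangle=\mathrm{Tr}_{\mathfrak F}\big(G\,a^\dagger(f)a(g)\big)\qquad\forall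 f,g\in L^2 .$$ If $\mathrm{Tr}_{\mathfrak H}\big((\mathds 1\otimes\mathcal N)\Gamma\big)<\infty$, let $\Gamma^{(1,1)}=[\mathrm{Tr}_{\mathrm{part}}\Gamma]^{(1,1)}$, where $\mathrm{Tr}_{\mathrm{part}}$ is the partial trace over the particle factor $L^2$, and for $f\in L^2$ let $\sigma(f)$ be the bounded operator on $L^2$ with $$\langle u,\sigma(f)v\rangle=\mathrm{Tr}_{\mathfrak H}\big(|v\rangle\langle u|\otimes(a^\dagger(f)+a(f))\,\Gamma\big)\qquad\forall u,v\in L^2 .$$ Traces involving unbounded operators are understood in the sense of quadratic forms: $\mathrm{Tr}(\Gamma A^*B)=\mathrm{Tr}\big((A\Gamma^{1/2})^*B\Gamma^{1/2}\big)$. **Proposition (Construction of localized states).** Let $\Gamma$ be a positive trace-class operator on $\mathfrak H$. There is a family of positive trace-class operators $\Gamma_q$ on $\mathfrak H$, indexed by the bounded operators $q$ on $L^2$ with $0\le q\le\mathds 1$, such that for every such $q$: 1. the particle reduced density matrix of $\Gamma_q$ is $\gamma_q=q\,\gamma\,q$; 2. $\mathrm{Tr}_{\mathfrak H}\Gamma=\mathrm{Tr}_{\mathfrak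 H}\Gamma_q+\mathrm{Tr}_{\mathfrak H}\Gamma_{(1-q^2)^{1/2}}$; 3. if moreover $\mathrm{Tr}_{\mathfrak H}\big((\mathds 1\otimes\mathcal N)\Gamma\big)<\infty$, then $\mathrm{Tr}_{\mathfrak H}\big((\mathds 1\otimes\mathcal N)\Gamma_q\big)<\infty$, the densities below exist, and $$\Gamma_q^{(1,1)}=q\,\big[\mathrm{Tr}_{\mathrm{part}}(q\,\Gamma\,q)\big]^{(1,1)}q ,\qquad \sigma_q(f)=q\,\sigma(qf)\,q\quad\forall f\in L^2 ,$$ where $q\,\Gamma\,q$ means $(q\otimes\mathds 1)\Gamma(q\otimes\mathds 1)$ and $\Gamma_q^{(1,1)},\sigma_q$ are the densities of $\Gamma_q$. -/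

import Mathlib

open scoped TensorProduct InnerProductSpace ComplexConjugate

noncomputable section

namespace Polaron

universe u v

/-! ### Algebraic tensor powers of a Hilbert space and their inner product -/

section TensorPower

/-- The algebraic `n`-fold tensor power of `E`.  A type synonym of Mathlib's `PiTensorProduct`, so
that it can carry the inner product `⟪⨂ xᵢ, ⨂ yᵢ⟫ = ∏ ⟪xᵢ, yᵢ⟫` in place of the projective
seminorm. -/
def TensorPow (n : ℕ) (E : Type u) [NormedAddCommGroup E] [InnerProductSpace ℂ E] : Type u :=
  PiTensorProduct ℂ (fun _ : Fin n => E)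

variable {E : Type u} [NormedAddCommGroup E] [InnerProductSpace ℂ E] {n : ℕ}

instance : AddCommGroup (TensorPow n E) :=
  inferInstanceAs (AddCommGroup (PiTensorProduct ℂ (fun _ : Fin n => E)))

instance : Module ℂ (TensorPow n E) :=
  inferInstanceAs (Module ℂ (PiTensorProduct ℂ (fun _ : Fin n => E)))

/-- The elementary tensor `x₁ ⊗ ⋯ ⊗ xₙ`, as a multilinear map of `(x₁, …, xₙ)`. -/
def pureTensor (n : ℕ) (E : Type u) [NormedAddCommGroup E] [InnerProductSpace ℂ E] :
    MultilinearMap ℂ (fun _ : Fin n => E) (TensorPow n E) :=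
  PiTensorProduct.tprod ℂ

/-- The linear map on the tensor power induced by a multilinear map. -/
def liftPow {F : Type v} [AddCommGroup F] [Module ℂ F]
    (φ : MultilinearMap ℂ (fun _ : Fin n => E) F) : TensorPow n E →ₗ[ℂ] F :=
  PiTensorProduct.lift φ

@[simp] theorem liftPow_pureTensor {F : Type v} [AddCommGroup F] [Module ℂ F]
    (φ : MultilinearMap ℂ (fun _ : Fin n => E) F) (x : Fin n → E) :
    liftPow φ (pureTensor n E x) = φ x :=
  PiTensorProduct.lift.tprod x

theorem TensorPow.induction {p : TensorPow n E → Prop}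
    (h1 : ∀ (c : ℂ) (x : Fin n → E), p (c • pureTensor n E x))
    (h2 : ∀ s t, p s → p t → p (s + t)) (t : TensorPow n E) : p t :=
  PiTensorProduct.induction_on (motive := p) t h1 h2

theorem TensorPow.exists_sum (t : TensorPow n E) :
    ∃ (m : ℕ) (c : Fin m → ℂ) (x : Fin m → Fin n → E),
      t = ∑ k, c k • pureTensor n E (x k) := by
  induction t using TensorPow.induction with
  | h1 c x => exact ⟨1, fun _ => c, fun _ => x, by simp⟩
  | h2 s t hs ht =>
    obtain ⟨m, c, x, rfl⟩ := hs
    obtain ⟨m', c', x', rfl⟩ := ht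
    exact ⟨m + m', Fin.append c c', Fin.append x x', by simp [Fin.sum_univ_add]⟩

/-- The functional `x₁ ⊗ ⋯ ⊗ xₙ ↦ ∏ ⟪yᵢ, xᵢ⟫`. -/
def pairing (y : Fin n → E) : TensorPow n E →ₗ[ℂ] ℂ :=
  liftPow ((MultilinearMap.mkPiAlgebra ℂ (Fin n) ℂ).compLinearMap (fun i => innerₛₗ ℂ (y i)))

@[simp] theorem pairing_pureTensor (y x : Fin n → E) :
    pairing y (pureTensor n E x) = ∏ i, ⟪y i, x i⟫_ℂ := by
  simp [pairing]

theorem pairing_update_add [DecidableEq (Fin n)] (y : Fin n → E) (i : Fin n) (a b : E) :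
    pairing (Function.update y i (a + b)) =
      pairing (Function.update y i a) + pairing (Function.update y i b) := by
  refine LinearMap.ext fun t => ?_
  induction t using TensorPow.induction with
  | h1 c x =>
    simp only [map_smul, pairing_pureTensor, LinearMap.add_apply, smul_eq_mul]
    rw [Fintype.prod_eq_mul_prod_compl i, Fintype.prod_eq_mul_prod_compl i,
      Fintype.prod_eq_mul_prod_compl i]
    have h : ∀ z : E, ∏ j ∈ {i}ᶜ, ⟪Function.update y i z j, x j⟫_ℂ = ∏ j ∈ {i}ᶜ, ⟪y j, x j⟫_ℂ :=
      fun z => Finset.prod_congr rfl fun j hj => by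
        rw [Function.update_of_ne (by simpa using hj)]
    simp only [h, Function.update_self, inner_add_left]
    ring
  | h2 s t hs ht => simp only [map_add, hs, ht]

theorem pairing_update_smul [DecidableEq (Fin n)] (y : Fin n → E) (i : Fin n) (c : ℂ) (a : E) :
    pairing (Function.update y i (c • a)) = conj c • pairing (Function.update y i a) := by
  refine LinearMap.ext fun t => ?_
  induction t using TensorPow.induction with
  | h1 d x =>
    simp only [map_smul, pairing_pureTensor, LinearMap.smul_apply, smul_eq_mul]
    rw [Fintype.prod_eq_mul_prod_compl i, Fintype.prod_eq_mul_prod_compl i]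
    have h : ∀ z : E, ∏ j ∈ {i}ᶜ, ⟪Function.update y i z j, x j⟫_ℂ = ∏ j ∈ {i}ᶜ, ⟪y j, x j⟫_ℂ :=
      fun z => Finset.prod_congr rfl fun j hj => by
        rw [Function.update_of_ne (by simpa using hj)]
    simp only [h, Function.update_self, inner_smul_left]
    ring
  | h2 s t hs ht => simp only [map_add, hs, ht]

/-- The sesquilinear form `(y, x) ↦ ⟪x, y⟫`, linear in `y` and conjugate-linear in `x`. -/
def innerForm : TensorPow n E →ₗ[ℂ] (TensorPow n E →ₗ⋆[ℂ] ℂ) :=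
  liftPow
    { toFun := fun y => (starLinearEquiv ℂ (A := ℂ)).toLinearMap.comp (pairing y)
      map_update_add' := fun y i a b => by
        rw [pairing_update_add]; ext t; simp
      map_update_smul' := fun y i c a => by
        rw [pairing_update_smul]; ext t; simp }

theorem innerForm_pureTensor (y : Fin n → E) (t : TensorPow n E) :
    innerForm (pureTensor n E y) t = conj (pairing y t) := by
  simp [innerForm]

theorem innerForm_pureTensor_pureTensor (y x : Fin n → E) :
    innerForm (pureTensor n E y) (pureTensor n E x) = ∏ i, ⟪x i, y i⟫_ℂ := by
  simp [innerForm_pureTensor, map_prod]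

theorem innerForm_conj (s t : TensorPow n E) : conj (innerForm s t) = innerForm t s := by
  induction s using TensorPow.induction with
  | h1 c x =>
    induction t using TensorPow.induction with
    | h1 d y => simp [innerForm_pureTensor_pureTensor, map_prod]; ring
    | h2 a b ha hb => simp only [map_add, LinearMap.add_apply, ha, hb]
  | h2 a b ha hb => simp only [map_add, LinearMap.add_apply, ha, hb]

section
open scoped ComplexOrder

theorem posSemidef_prod_gram {m : ℕ} (x : Fin m → Fin n → E) :
    (Matrix.of fun k l => ∏ i, ⟪x k i, x l i⟫_ℂ).PosSemidef := by
  induction n with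
  | zero =>
    have h := Matrix.posSemidef_gram ℂ (fun _ : Fin m => (1 : ℂ))
    have e : (Matrix.of fun k l => ∏ i, ⟪x k i, x l i⟫_ℂ) =
        Matrix.gram ℂ (fun _ : Fin m => (1 : ℂ)) := by
      ext k l
      simp [Matrix.gram]
    rw [e]
    exact h
  | succ n ih =>
    have h := (Matrix.posSemidef_gram ℂ (fun k => x k 0)).hadamard (ih (fun k i => x k i.succ))
    have e : (Matrix.of fun k l => ∏ i, ⟪x k i, x l i⟫_ℂ) =
        (Matrix.gram ℂ fun k => x k 0).hadamard
          (Matrix.of fun k l => ∏ i : Fin n, ⟪x k i.succ, x l i.succ⟫_ℂ) := by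
      ext k l
      simp [Matrix.gram, Fin.prod_univ_succ]
    rw [e]
    exact h

theorem innerForm_self_nonneg (t : TensorPow n E) : 0 ≤ RCLike.re (innerForm t t) := by
  obtain ⟨m, c, x, rfl⟩ := t.exists_sum
  have h := (posSemidef_prod_gram x).dotProduct_mulVec_nonneg c
  have e : innerForm (∑ k, c k • pureTensor n E (x k)) (∑ k, c k • pureTensor n E (x k)) =
      dotProduct (star c) ((Matrix.of fun k l => ∏ i, ⟪x k i, x l i⟫_ℂ).mulVec c) := by
    simp only [map_sum, map_smul, LinearMap.map_smulₛₗ, LinearMap.sum_apply, LinearMap.smul_apply,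
      innerForm_pureTensor_pureTensor, dotProduct, Matrix.mulVec, Finset.mul_sum, smul_eq_mul,
      Matrix.of_apply, Pi.star_apply]
    refine Finset.sum_congr rfl fun k _ => Finset.sum_congr rfl fun l _ => ?_
    simp only [RCLike.star_def]
    ring
  rw [e]
  simpa using (RCLike.le_iff_re_im.mp h).1

end

/-- The inner product on the algebraic tensor power. -/
abbrev innerCore : PreInnerProductSpace.Core ℂ (TensorPow n E) where
  inner s t := innerForm t s
  conj_inner_symm s t := innerForm_conj s t
  re_inner_nonneg t := innerForm_self_nonneg t
  add_left s t r := by simp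
  smul_left s t c := by simp

instance : SeminormedAddCommGroup (TensorPow n E) :=
  letI := innerCore (E := E) (n := n)
  InnerProductSpace.Core.toSeminormedAddCommGroup (𝕜 := ℂ)

instance : InnerProductSpace ℂ (TensorPow n E) :=
  InnerProductSpace.ofCore innerCore

theorem inner_pureTensor (x y : Fin n → E) :
    ⟪pureTensor n E x, pureTensor n E y⟫_ℂ = ∏ i, ⟪x i, y i⟫_ℂ :=
  innerForm_pureTensor_pureTensor y x

/-- Creation of a tensor factor in front, `t ↦ f ⊗ t`. -/
def consMap (f : E) : TensorPow n E →ₗ[ℂ] TensorPow (n + 1) E :=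
  liftPow ((pureTensor (n + 1) E).curryLeft f)

@[simp] theorem consMap_pureTensor (f : E) (x : Fin n → E) :
    consMap f (pureTensor n E x) = pureTensor (n + 1) E (Fin.cons f x) := by
  simp [consMap]

theorem inner_consMap (f g : E) (s t : TensorPow n E) :
    ⟪consMap f s, consMap g t⟫_ℂ = ⟪f, g⟫_ℂ * ⟪s, t⟫_ℂ := by
  induction s using TensorPow.induction with
  | h1 c x =>
    induction t using TensorPow.induction with
    | h1 d y =>
      simp only [map_smul, inner_smul_left, inner_smul_right, consMap_pureTensor,
        inner_pureTensor, Fin.prod_univ_succ, Fin.cons_zero, Fin.cons_succ]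
      ring
    | h2 a b ha hb => simp only [map_add, inner_add_right, ha, hb, mul_add]
  | h2 a b ha hb => simp only [map_add, inner_add_left, ha, hb, mul_add]

theorem norm_consMap (f : E) (t : TensorPow n E) : ‖consMap f t‖ = ‖f‖ * ‖t‖ := by
  have h := inner_consMap f f t t
  rw [inner_self_eq_norm_sq_to_K, inner_self_eq_norm_sq_to_K, inner_self_eq_norm_sq_to_K,
    ← mul_pow] at h
  have h' : ‖consMap f t‖ ^ 2 = (‖f‖ * ‖t‖) ^ 2 := by exact_mod_cast h
  exact (sq_eq_sq₀ (norm_nonneg _) (by positivity)).mp h'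

/-- Permutation of the tensor factors. -/
def permMap (τ : Equiv.Perm (Fin n)) : TensorPow n E →ₗ[ℂ] TensorPow n E :=
  liftPow ((pureTensor n E).domDomCongr τ)

@[simp] theorem permMap_pureTensor (τ : Equiv.Perm (Fin n)) (x : Fin n → E) :
    permMap τ (pureTensor n E x) = pureTensor n E (fun i => x (τ i)) := by
  simp [permMap]

theorem inner_permMap (τ : Equiv.Perm (Fin n)) (s t : TensorPow n E) :
    ⟪permMap τ s, permMap τ t⟫_ℂ = ⟪s, t⟫_ℂ := by
  induction s using TensorPow.induction with
  | h1 c x =>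
    induction t using TensorPow.induction with
    | h1 d y =>
      simp only [map_smul, inner_smul_left, inner_smul_right, permMap_pureTensor,
        inner_pureTensor]
      rw [Equiv.prod_comp τ (fun i => ⟪x i, y i⟫_ℂ)]
    | h2 a b ha hb => simp only [map_add, inner_add_right, ha, hb]
  | h2 a b ha hb => simp only [map_add, inner_add_left, ha, hb]

theorem norm_permMap (τ : Equiv.Perm (Fin n)) (t : TensorPow n E) : ‖permMap τ t‖ = ‖t‖ := by
  rw [@norm_eq_sqrt_re_inner ℂ, @norm_eq_sqrt_re_inner ℂ, inner_permMap]

end TensorPower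

/-! ### Symmetric Hilbert tensor powers and the bosonic Fock space -/

section FockSpace

variable (E : Type u) [NormedAddCommGroup E] [InnerProductSpace ℂ E]

/-- The `n`-fold Hilbert space tensor power `E^{⊗ n}`. -/
abbrev HTensorPow (n : ℕ) : Type u := UniformSpace.Completion (TensorPow n E)

variable {E} {n : ℕ}

/-- The bounded operator `t ↦ f ⊗ t` on Hilbert tensor powers. -/
def consL (f : E) : HTensorPow E n →L[ℂ] HTensorPow E (n + 1) :=
  ((consMap f).mkContinuous ‖f‖ fun t => (norm_consMap f t).le).completion

/-- The unitary permuting the tensor factors of `E^{⊗ n}`. -/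
def permL (τ : Equiv.Perm (Fin n)) : HTensorPow E n →L[ℂ] HTensorPow E n :=
  ((permMap τ).mkContinuous 1 fun t => by rw [norm_permMap, one_mul]).completion

variable (E)

/-- The symmetric tensor power `E^{⊗_sym n}`: tensors invariant under all permutations. -/
def SymPow (n : ℕ) : Submodule ℂ (HTensorPow E n) where
  carrier := {t | ∀ τ : Equiv.Perm (Fin n), permL τ t = t}
  add_mem' hs ht τ := by rw [map_add, hs τ, ht τ]
  zero_mem' τ := map_zero _
  smul_mem' c t ht τ := by rw [map_smul, ht τ]

theorem isClosed_symPow (n : ℕ) : IsClosed (SymPow E n : Set (HTensorPow E n)) := by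
  have h : (SymPow E n : Set (HTensorPow E n)) =
      ⋂ τ : Equiv.Perm (Fin n), {t | permL τ t = t} := by
    ext t; simp [SymPow]
  rw [h]
  exact isClosed_iInter fun τ => isClosed_eq (permL τ).continuous continuous_id

instance (n : ℕ) : CompleteSpace (SymPow E n) := (isClosed_symPow E n).completeSpace_coe

/-- The bosonic Fock space `⨁ₙ E^{⊗_sym n}` (Hilbert space direct sum). -/
abbrev Fock : Type u := lp (fun n : ℕ => SymPow E n) 2

variable {E}

/-- The orthogonal projection of the Fock space onto the `n`-particle sector. -/
def sectorProj (n : ℕ) : Fock E →L[ℂ] Fock E :=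
  lp.singleContinuousLinearMap ℂ (fun n : ℕ => SymPow E n) 2 n ∘L
    lp.evalCLM ℂ (fun n : ℕ => SymPow E n) 2 n

/-- The graph of the annihilation operator: the component of `a(f) Ψ` in the `n`-particle sector is
`α⁻¹ √(n+1) ⟨f| Ψₙ₊₁`, where `⟨f|`, the adjoint of `t ↦ f ⊗ t`, contracts the first factor with `f`
(conjugate-linearly in `f`). -/
def annihilationGraph (α : ℝ) (f : E) : Submodule ℂ (Fock E × Fock E) where
  carrier := {p | ∀ n : ℕ, ((p.2 n : SymPow E n) : HTensorPow E n) =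
    ((α⁻¹ * √((n : ℝ) + 1) : ℝ) : ℂ) • (consL f).adjoint (p.1 (n + 1) : HTensorPow E (n + 1))}
  add_mem' {p q} hp hq n := by
    simp only [Prod.snd_add, Prod.fst_add, lp.coeFn_add, Pi.add_apply, Submodule.coe_add, map_add,
      smul_add, hp n, hq n]
  zero_mem' n := by simp
  smul_mem' c p hp n := by
    simp only [Prod.smul_snd, Prod.smul_fst, lp.coeFn_smul, Pi.smul_apply, Submodule.coe_smul,
      map_smul, hp n, smul_comm c]

/-- The annihilation operator `a(f)` on the Fock space, with its maximal domain. -/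
def annihilation (α : ℝ) (f : E) : Fock E →ₗ.[ℂ] Fock E := (annihilationGraph α f).toLinearPMap

theorem annihilation_graph (α : ℝ) (f : E) :
    (annihilation α f).graph = annihilationGraph α f := by
  refine Submodule.toLinearPMap_graph_eq _ fun p hp h0 => ?_
  ext n
  rw [hp n, h0]
  simp

/-- The creation operator `a†(f)`, the adjoint of `a(f)`. -/
def creation (α : ℝ) (f : E) : Fock E →ₗ.[ℂ] Fock E := (annihilation α f).adjoint

end FockSpace

/-! ### Hilbert space tensor products -/

section HilbertTensor

variable {E : Type u} [NormedAddCommGroup E] [InnerProductSpace ℂ E]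
variable {F : Type v} [NormedAddCommGroup F] [InnerProductSpace ℂ F]

/-- The Hilbert space tensor product of two complex Hilbert spaces. -/
abbrev HTensor (E : Type u) [NormedAddCommGroup E] [InnerProductSpace ℂ E]
    (F : Type v) [NormedAddCommGroup F] [InnerProductSpace ℂ F] : Type (max u v) :=
  UniformSpace.Completion (E ⊗[ℂ] F)

/-- The elementary tensor `x ⊗ y` in the Hilbert space tensor product. -/
def htmul (x : E) (y : F) : HTensor E F := ((x ⊗ₜ[ℂ] y : E ⊗[ℂ] F) : HTensor E F)

theorem norm_htmul (x : E) (y : F) : ‖htmul x y‖ = ‖x‖ * ‖y‖ := by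
  simp [htmul]

/-- The bounded operator `F → E ⊗ F`, `y ↦ x ⊗ y`. -/
def tmulLeft (x : E) : F →L[ℂ] HTensor E F :=
  LinearMap.mkContinuous
    { toFun := fun y => htmul x y
      map_add' := fun y z => by simp [htmul, TensorProduct.tmul_add, UniformSpace.Completion.coe_add]
      map_smul' := fun c y => by simp [htmul] }
    ‖x‖ fun y => (norm_htmul x y).le

/-- The bounded operator `E → E ⊗ F`, `x ↦ x ⊗ y`. -/
def tmulRight (y : F) : E →L[ℂ] HTensor E F :=
  LinearMap.mkContinuous
    { toFun := fun x => htmul x y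
      map_add' := fun x z => by simp [htmul, TensorProduct.add_tmul, UniformSpace.Completion.coe_add]
      map_smul' := fun c x => by
        simp [htmul, ← TensorProduct.smul_tmul', UniformSpace.Completion.coe_smul] }
    ‖y‖ fun x => by rw [mul_comm]; exact (norm_htmul x y).le

/-- The bounded operator `A ⊗ B` on `E ⊗ F`. -/
def opTensor (A : E →L[ℂ] E) (B : F →L[ℂ] F) : HTensor E F →L[ℂ] HTensor E F :=
  (TensorProduct.mapL A B).completion

variable [CompleteSpace F]

/-- The graph of `1 ⊗ A` for a (possibly unbounded) closed operator `A` on `F`: the pairs `(Ψ, Φ)`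
such that `A` maps each partial inner product `⟨x| Ψ ∈ F`, `x ∈ E`, to `⟨x| Φ`. -/
def idTensorGraph (A : F →ₗ.[ℂ] F) : Submodule ℂ (HTensor E F × HTensor E F) where
  carrier := {p | ∀ x : E, ((tmulLeft x).adjoint p.1, (tmulLeft x).adjoint p.2) ∈ A.graph}
  add_mem' {p q} hp hq x := by
    have h := A.graph.add_mem (hp x) (hq x)
    simpa only [Prod.mk_add_mk, Prod.fst_add, Prod.snd_add, map_add] using h
  zero_mem' x := by
    simp only [Prod.fst_zero, Prod.snd_zero, map_zero]
    exact A.graph.zero_mem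
  smul_mem' c p hp x := by
    have h := A.graph.smul_mem c (hp x)
    simpa only [Prod.smul_mk, Prod.smul_fst, Prod.smul_snd, map_smul] using h

/-- The (possibly unbounded) operator `1 ⊗ A` on `E ⊗ F`. -/
def idTensor (A : F →ₗ.[ℂ] F) : HTensor E F →ₗ.[ℂ] HTensor E F :=
  (idTensorGraph A).toLinearPMap

theorem eq_zero_of_tmulLeft_adjoint {Ψ : HTensor E F}
    (h : ∀ x : E, (tmulLeft (F := F) x).adjoint Ψ = 0) : Ψ = 0 := by
  have h1 : ∀ t : E ⊗[ℂ] F, ⟪(t : HTensor E F), Ψ⟫_ℂ = 0 := by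
    intro t
    induction t using TensorProduct.induction_on with
    | zero => rw [UniformSpace.Completion.coe_zero, inner_zero_left]
    | tmul x y =>
      have h2 : ⟪y, (tmulLeft (F := F) x).adjoint Ψ⟫_ℂ = 0 := by rw [h x, inner_zero_right]
      rwa [ContinuousLinearMap.adjoint_inner_right] at h2
    | add s t hs ht => rw [UniformSpace.Completion.coe_add, inner_add_left, hs, ht, add_zero]
  have h3 : ∀ Φ : HTensor E F, ⟪Φ, Ψ⟫_ℂ = 0 := fun Φ =>
    UniformSpace.Completion.induction_on Φ
      (isClosed_eq (continuous_id.inner continuous_const) continuous_const) h1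
  exact inner_self_eq_zero.mp (h3 Ψ)

theorem idTensor_graph (A : F →ₗ.[ℂ] F) :
    (idTensor A : HTensor E F →ₗ.[ℂ] HTensor E F).graph = idTensorGraph A := by
  refine Submodule.toLinearPMap_graph_eq _ fun p hp h0 => ?_
  refine eq_zero_of_tmulLeft_adjoint fun x => ?_
  have h := hp x
  rw [h0, map_zero] at h
  exact A.graph_fst_eq_zero_snd h rfl

end HilbertTensor

/-! ### Traces, partial traces and expectation values -/

section Trace

variable {H : Type u} [NormedAddCommGroup H] [InnerProductSpace ℂ H] [CompleteSpace H]

/-- The index set of a Hilbert basis, fixed once and for all, of a Hilbert space. -/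
def stdIndex (H : Type u) [NormedAddCommGroup H] [InnerProductSpace ℂ H] [CompleteSpace H] :
    Set H :=
  (exists_hilbertBasis ℂ H).choose

/-- A Hilbert basis, fixed once and for all, of a Hilbert space. -/
def stdBasis (H : Type u) [NormedAddCommGroup H] [InnerProductSpace ℂ H] [CompleteSpace H] :
    HilbertBasis (stdIndex H) ℂ H :=
  (exists_hilbertBasis ℂ H).choose_spec.choose

/-- Positive trace-class operators: `Γ ≥ 0` and `∑ ⟪eᵢ, Γ eᵢ⟫ < ∞` for every Hilbert basis. -/
def IsPosTraceClass (Γ : H →L[ℂ] H) : Prop :=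
  Γ.IsPositive ∧
    ∀ (w : Set H) (b : HilbertBasis w ℂ H), Summable fun i => ⟪b i, Γ (b i)⟫_ℂ

/-- The trace of a trace-class operator. -/
def trace (T : H →L[ℂ] H) : ℂ := ∑' i, ⟪stdBasis H i, T (stdBasis H i)⟫_ℂ

/-- The square root of a positive bounded operator. -/
def opSqrt (T : H →L[ℂ] H) : H →L[ℂ] H := CFC.sqrt T

/-- `HasFormTrace Γ A B t` states that `t = Tr (Γ A* B)` for a positive trace-class operator `Γ` and
possibly unbounded operators `A`, `B`, in the sense of quadratic forms:  `A Γ^{1/2}` and `B Γ^{1/2}`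
are defined on every Hilbert basis `(bᵢ)` and `∑ ⟪A Γ^{1/2} bᵢ, B Γ^{1/2} bᵢ⟫ = t`. -/
def HasFormTrace (Γ : H →L[ℂ] H) (A B : H →ₗ.[ℂ] H) (t : ℂ) : Prop :=
  ∀ (w : Set H) (b : HilbertBasis w ℂ H),
    ∃ (hA : ∀ i, opSqrt Γ (b i) ∈ A.domain) (hB : ∀ i, opSqrt Γ (b i) ∈ B.domain),
      HasSum (fun i => ⟪A ⟨opSqrt Γ (b i), hA i⟩, B ⟨opSqrt Γ (b i), hB i⟩⟫_ℂ) t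

variable {E : Type u} [NormedAddCommGroup E] [InnerProductSpace ℂ E] [CompleteSpace E]
variable {F : Type v} [NormedAddCommGroup F] [InnerProductSpace ℂ F] [CompleteSpace F]

/-- The partial trace over the first factor: the operator `∑ᵢ ⟨eᵢ| T |eᵢ⟩` on `F`, `(eᵢ)` a Hilbert
basis of `E`. -/
def partialTraceLeft (T : HTensor E F →L[ℂ] HTensor E F) : F →L[ℂ] F :=
  ∑' i, (tmulLeft (stdBasis E i)).adjoint ∘L T ∘L tmulLeft (stdBasis E i)

/-- The partial trace over the second factor: the operator `∑ᵢ ⟨eᵢ| T |eᵢ⟩` on `E`, `(eᵢ)` a Hilbert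
basis of `F`. -/
def partialTraceRight (T : HTensor E F →L[ℂ] HTensor E F) : E →L[ℂ] E :=
  ∑' i, (tmulRight (stdBasis F i)).adjoint ∘L T ∘L tmulRight (stdBasis F i)

end Trace

/-! ### The particle-field system and its reduced densities -/

section Model

/-- The one-body space `L²(ℝᵈ)`, of the particle and of the field. -/
abbrev L2 (d : ℕ) : Type :=
  MeasureTheory.Lp ℂ 2 (MeasureTheory.volume : MeasureTheory.Measure (EuclideanSpace ℝ (Fin d)))

/-- The state space `L²(ℝᵈ) ⊗ 𝔉(L²(ℝᵈ))` of the particle and the field. -/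
abbrev StateSpace (d : ℕ) : Type := HTensor (L2 d) (Fock (L2 d))

variable {d : ℕ}

/-- The particle reduced density matrix `γ = Tr_𝔉 Γ`. -/
def particleDensity (Γ : StateSpace d →L[ℂ] StateSpace d) : L2 d →L[ℂ] L2 d :=
  partialTraceRight Γ

/-- `Tr ((1 ⊗ 𝒩) Γ)` for a positive trace-class `Γ`, where `𝒩 = ∫ a†ₓ aₓ dx` is the number operator
with the scaled creation and annihilation operators, equal to `α⁻² n` on the `n`-particle sector. -/
def numberExpectation (α : ℝ) (Γ : StateSpace d →L[ℂ] StateSpace d) : ENNReal :=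
  ∑' n : ℕ, ENNReal.ofReal ((n : ℝ) / α ^ 2 * (trace (opTensor 1 (sectorProj n) ∘L Γ)).re)

/-- `R` is the one-body reduced density matrix `G^{(1,1)}` of the positive trace-class operator `G`
on the Fock space: `⟪g, R f⟫ = Tr (G a†(f) a(g))` for all `f`, `g`. -/
def IsOneBodyDensity (α : ℝ) (G : Fock (L2 d) →L[ℂ] Fock (L2 d)) (R : L2 d →L[ℂ] L2 d) : Prop :=
  ∀ f g : L2 d, HasFormTrace G (annihilation α f) (annihilation α g) ⟪g, R f⟫_ℂ

/-- The operator `|v⟩⟨u| ⊗ (a†(f) + a(f))` on the state space. -/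
def fieldParticleOp (α : ℝ) (f u v : L2 d) : StateSpace d →ₗ.[ℂ] StateSpace d :=
  (opTensor (InnerProductSpace.rankOne ℂ v u) 1).toLinearMap.compPMap
    (idTensor (creation α f) + idTensor (annihilation α f))

/-- `σ` is the field-particle reduced density matrix of the positive trace-class operator `Γ`:
`⟪u, σ(f) v⟫ = Tr ((|v⟩⟨u| ⊗ (a†(f) + a(f))) Γ)` for all `f`, `u`, `v`. -/
def IsFieldParticleDensity (α : ℝ) (Γ : StateSpace d →L[ℂ] StateSpace d)
    (σ : L2 d → (L2 d →L[ℂ] L2 d)) : Prop :=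
  ∀ f u v : L2 d, HasFormTrace Γ (LinearMap.id.toPMap ⊤) (fieldParticleOp α f u v) ⟪u, σ f v⟫_ℂ

end Model

end Polaron

end

open scoped TensorProduct InnerProductSpace ComplexConjugate ENNReal

set_option linter.unusedSectionVars false

noncomputable section

namespace Polaron

/-! ### Square-summable families -/

section SquareSums

variable {ι κ : Type*} {H : Type*} [NormedAddCommGroup H] [InnerProductSpace ℂ H]

/-! Put `p = (1 - q²)^{1/2}`. The map `f ↦ (q f, p f)` is an isometry of the one-body space into two
copies of itself. Its second quantization embeds the Fock space into a product of two Fock spaces,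
and tracing out the second one restricts the field to the part seen by `q`. Expanding that trace in
a basis gives Kraus operators `K_k`, with `k = (m, g)`: contract `m` factors with the vectors `p
b_{g i}`, apply `q ⊗ ⋯ ⊗ q` to the remaining `n`, and multiply by the square root of `m + n` choose
`m`. The localized state is `Γ_q = ∑ (q ⊗ K_k) Γ (q ⊗ K_k)*`.

Two facts about `K_k` carry everything. The first is `∑ K_k* K_k = 1` (`tsum_enorm_sq_kraus`), a
binomial theorem for `(q² + p²)^{⊗N}` proved by Pascal's rule in `sum_antidiagonal_splitWeight`. The
field is thus changed without loss of trace, so the particle density becomes `q γ q`, and the traces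
add up because `‖q x‖² + ‖p x‖² = ‖x‖²`. The same sum weighted by particle number shows that the
expectation of `𝒩` does not increase. The second is the intertwining relation `a(f) K_k = K_k a(q
f)` on the domain of `a(q f)` (`kraus_mem_annihilation`). With the first fact it turns the one-body
density of the localized field into the old one evaluated at `q f`, `q g`. It also handles the
field-particle density, once `a†(f)` has been moved to the other side of the inner product as
`a(f)`.

States are handled as ensembles `G = ∑ |xᵢ⟩⟨xᵢ|` with `∑ ‖xᵢ‖² < ∞`, starting from `xᵢ = Γ^{1/2}
eᵢ`; compressions, partial traces and Kraus maps merely transform the vectors. The form trace `Tr (G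
A* B)`, however, is defined through `G^{1/2}` and every Hilbert basis. `IsEnsemble.hasFormTrace`
bridges the gap: by polar decomposition, the map sending coefficients to `∑ vᵢ xᵢ` differs from
`G^{1/2}` by a partial isometry, so the trace may be computed as `∑ ⟪A xᵢ, B xᵢ⟫` as soon as `A`,
`B` act on all square-summable combinations of the `xᵢ`. -/

theorem enorm_sq_eq_ofReal {V : Type*} [SeminormedAddGroup V] (x : V) :
    ‖x‖ₑ ^ 2 = ENNReal.ofReal (‖x‖ ^ 2) := by
  rw [ENNReal.ofReal_pow (norm_nonneg _), ofReal_norm]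

theorem summable_norm_sq {x : ι → H} (hx : ∑' i, ‖x i‖ₑ ^ 2 ≠ ⊤) :
    Summable fun i => ‖x i‖ ^ 2 := by
  simp only [enorm_sq_eq_ofReal] at hx
  have h := ENNReal.summable_toReal hx
  simpa [ENNReal.toReal_ofReal, sq_nonneg] using h

theorem tsum_enorm_sq_of_hasSum {x : ι → H} {r : ℝ} (h : HasSum (fun i => ‖x i‖ ^ 2) r) :
    ∑' i, ‖x i‖ₑ ^ 2 = ENNReal.ofReal r := by
  simp only [enorm_sq_eq_ofReal]
  rw [← h.tsum_eq, ENNReal.ofReal_tsum_of_nonneg (fun _ => sq_nonneg _) h.summable]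

theorem tsum_enorm_sq_ne_top {x : ι → H} (h : Summable fun i => ‖x i‖ ^ 2) :
    ∑' i, ‖x i‖ₑ ^ 2 ≠ ⊤ := by
  rw [tsum_enorm_sq_of_hasSum h.hasSum]
  exact ENNReal.ofReal_ne_top

theorem hasSum_norm_sq {x : ι → H} (hx : ∑' i, ‖x i‖ₑ ^ 2 ≠ ⊤) :
    HasSum (fun i => ‖x i‖ ^ 2) (∑' i, ‖x i‖ₑ ^ 2).toReal := by
  rw [tsum_enorm_sq_of_hasSum (summable_norm_sq hx).hasSum,
    ENNReal.toReal_ofReal (tsum_nonneg fun _ => sq_nonneg _)]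
  exact (summable_norm_sq hx).hasSum

theorem tsum_enorm_sq_map_ne_top {H' : Type*} [NormedAddCommGroup H'] [InnerProductSpace ℂ H']
    (K : H →L[ℂ] H') {x : ι → H} (hx : ∑' i, ‖x i‖ₑ ^ 2 ≠ ⊤) :
    ∑' i, ‖K (x i)‖ₑ ^ 2 ≠ ⊤ := by
  refine tsum_enorm_sq_ne_top (.of_nonneg_of_le (fun _ => sq_nonneg _) (fun i => ?_)
    ((summable_norm_sq hx).mul_left (‖K‖ ^ 2)))
  rw [← mul_pow]
  gcongr
  exact K.le_opNorm _

theorem norm_inner_le_half (x y : H) : ‖⟪x, y⟫_ℂ‖ ≤ (‖x‖ ^ 2 + ‖y‖ ^ 2) / 2 := by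
  have := norm_inner_le_norm (𝕜 := ℂ) x y
  nlinarith [sq_nonneg (‖x‖ - ‖y‖)]

theorem summable_norm_inner {x y : ι → H} (hx : ∑' i, ‖x i‖ₑ ^ 2 ≠ ⊤)
    (hy : ∑' i, ‖y i‖ₑ ^ 2 ≠ ⊤) : Summable fun i => ‖⟪x i, y i⟫_ℂ‖ :=
  .of_nonneg_of_le (fun _ => norm_nonneg _) (fun _ => norm_inner_le_half _ _)
    (((summable_norm_sq hx).add (summable_norm_sq hy)).div_const 2)

theorem summable_inner {x y : ι → H} (hx : ∑' i, ‖x i‖ₑ ^ 2 ≠ ⊤)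
    (hy : ∑' i, ‖y i‖ₑ ^ 2 ≠ ⊤) : Summable fun i => ⟪x i, y i⟫_ℂ :=
  (summable_norm_inner hx hy).of_norm

theorem tsum_enorm_sq_add_ne_top {x y : ι → H} (hx : ∑' i, ‖x i‖ₑ ^ 2 ≠ ⊤)
    (hy : ∑' i, ‖y i‖ₑ ^ 2 ≠ ⊤) : ∑' i, ‖x i + y i‖ₑ ^ 2 ≠ ⊤ := by
  refine tsum_enorm_sq_ne_top (.of_nonneg_of_le (fun _ => sq_nonneg _) (fun i => ?_)
    (((summable_norm_sq hx).add (summable_norm_sq hy)).mul_left 2))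
  have := norm_add_le (x i) (y i)
  nlinarith [sq_nonneg (‖x i‖ - ‖y i‖), norm_nonneg (x i + y i)]

theorem tsum_enorm_sq_inner (b : HilbertBasis ι ℂ H) (y : H) :
    ∑' i, ‖⟪b i, y⟫_ℂ‖ₑ ^ 2 = ‖y‖ₑ ^ 2 := by
  have h := b.hasSum_inner_mul_inner y y
  have h2 : HasSum (fun i => ‖⟪b i, y⟫_ℂ‖ ^ 2) (‖y‖ ^ 2) := by
    have h3 := (Complex.hasSum_re h)
    convert h3 using 1
    · ext i
      rw [← inner_conj_symm y (b i), ← Complex.normSq_eq_conj_mul_self, Complex.ofReal_re,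
        Complex.normSq_eq_norm_sq]
    · rw [inner_self_eq_norm_sq_to_K]
      norm_cast
  rw [tsum_enorm_sq_of_hasSum h2, enorm_sq_eq_ofReal]

theorem tsum_enorm_sq_inner' (b : HilbertBasis ι ℂ H) (y : H) :
    ∑' i, ‖⟪y, b i⟫_ℂ‖ₑ ^ 2 = ‖y‖ₑ ^ 2 := by
  rw [← tsum_enorm_sq_inner b y]
  congr! 3 with i
  rw [← ofReal_norm, ← ofReal_norm, norm_inner_symm]

/-- Polarization of a Parseval-type identity. -/
theorem hasSum_inner_of_parseval {H' : Type*} [NormedAddCommGroup H'] [InnerProductSpace ℂ H']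
    (C : κ → H →ₗ[ℂ] H') (hC : ∀ y, ∑' k, ‖C k y‖ₑ ^ 2 = ‖y‖ₑ ^ 2) (x y : H) :
    HasSum (fun k => ⟪C k x, C k y⟫_ℂ) ⟪x, y⟫_ℂ := by
  have h : ∀ z, HasSum (fun k => ((‖C k z‖ : ℂ)) ^ 2) ((‖z‖ : ℂ) ^ 2) := fun z => by
    have h1 := hasSum_norm_sq (x := fun k => C k z) (by simp [hC])
    rw [hC, enorm_sq_eq_ofReal, ENNReal.toReal_ofReal (sq_nonneg _)] at h1
    exact_mod_cast Complex.hasSum_ofReal.mpr h1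
  simp only [inner_eq_sum_norm_sq_div_four (𝕜 := ℂ), ← map_add, ← map_sub, ← map_smul]
  exact (((h _).sub (h _)).add (((h _).sub (h _)).mul_right _)).div_const _

/-- Interchanging the two sums in `∑ᵢ ∑ₖ ⟪bᵢ, yₖ⟫ ⟪xₖ, bᵢ⟫`. -/
theorem hasSum_basis_of_hasSum_family (b : HilbertBasis ι ℂ H) {x y : κ → H}
    (hx : ∑' k, ‖x k‖ₑ ^ 2 ≠ ⊤) (hy : ∑' k, ‖y k‖ₑ ^ 2 ≠ ⊤) {g : ι → ℂ}
    (hg : ∀ i, HasSum (fun k => ⟪x k, b i⟫_ℂ * ⟪b i, y k⟫_ℂ) (g i)) :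
    HasSum g (∑' k, ⟪x k, y k⟫_ℂ) := by
  have key : ∀ z : κ → H, ∑' k, ‖z k‖ₑ ^ 2 ≠ ⊤ →
      Summable fun p : κ × ι => ‖⟪b p.2, z p.1⟫_ℂ‖ ^ 2 := fun z hz => by
    refine summable_norm_sq (x := fun p : κ × ι => ⟪b p.2, z p.1⟫_ℂ) ?_
    rw [ENNReal.tsum_prod (f := fun k i => ‖⟪b i, z k⟫_ℂ‖ₑ ^ 2)]
    simpa only [tsum_enorm_sq_inner] using hz
  -- By `2st ≤ s² + t²` the double family is dominated by two Parseval families, so it converges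
  -- absolutely and may be summed in either order.
  have hs : Summable fun p : κ × ι => ⟪x p.1, b p.2⟫_ℂ * ⟪b p.2, y p.1⟫_ℂ := by
    refine Summable.of_norm_bounded ((key x hx).add (key y hy)) fun p => ?_
    rw [norm_mul, norm_inner_symm]
    nlinarith [sq_nonneg (‖⟪b p.2, x p.1⟫_ℂ‖ - ‖⟪b p.2, y p.1⟫_ℂ‖),
      sq_nonneg (‖⟪b p.2, x p.1⟫_ℂ‖ + ‖⟪b p.2, y p.1⟫_ℂ‖)]
  have h1 := hs.hasSum.prod_fiberwise fun k => b.hasSum_inner_mul_inner (x k) (y k)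
  rw [h1.tsum_eq]
  exact ((Equiv.prodComm ι κ).hasSum_iff.mpr hs.hasSum).prod_fiberwise hg

end SquareSums

/-! ### Positive trace-class operators as sums of rank one operators -/

section Ensemble

variable {ι κ : Type*}
variable {H : Type*} [NormedAddCommGroup H] [InnerProductSpace ℂ H] [CompleteSpace H]
variable {H' : Type*} [NormedAddCommGroup H'] [InnerProductSpace ℂ H'] [CompleteSpace H']

/-- `G = ∑ |xᵢ⟩⟨xᵢ|` with a square-summable family of vectors. -/
structure IsEnsemble (x : ι → H) (G : H →L[ℂ] H) : Prop where
  ne_top : ∑' i, ‖x i‖ₑ ^ 2 ≠ ⊤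
  hasSum : HasSum (fun i => InnerProductSpace.rankOne ℂ (x i) (x i)) G

/-- The operator `∑ |xᵢ⟩⟨xᵢ|`. -/
def ensemble (x : ι → H) : H →L[ℂ] H := ∑' i, InnerProductSpace.rankOne ℂ (x i) (x i)

theorem summable_rankOne {x : ι → H} (hx : ∑' i, ‖x i‖ₑ ^ 2 ≠ ⊤) :
    Summable fun i => InnerProductSpace.rankOne ℂ (x i) (x i) := by
  refine Summable.of_norm ?_
  simpa only [InnerProductSpace.norm_rankOne, ← sq] using summable_norm_sq hx

theorem isEnsemble_ensemble {x : ι → H} (hx : ∑' i, ‖x i‖ₑ ^ 2 ≠ ⊤) :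
    IsEnsemble x (ensemble x) :=
  ⟨hx, (summable_rankOne hx).hasSum⟩

namespace IsEnsemble

variable {x : ι → H} {G : H →L[ℂ] H}

theorem hasSum_apply (h : IsEnsemble x G) (v : H) : HasSum (fun i => ⟪x i, v⟫_ℂ • x i) (G v) := by
  simpa using h.hasSum.mapL (ContinuousLinearMap.apply ℂ H v)

theorem hasSum_inner (h : IsEnsemble x G) (u v : H) :
    HasSum (fun i => ⟪x i, v⟫_ℂ * ⟪u, x i⟫_ℂ) ⟪u, G v⟫_ℂ := by
  simpa [inner_smul_right] using (h.hasSum_apply v).mapL (innerSL ℂ u)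

theorem tsum_inner_ne_top (h : IsEnsemble x G) (u : H) : ∑' i, ‖⟪u, x i⟫_ℂ‖ₑ ^ 2 ≠ ⊤ := by
  simpa using tsum_enorm_sq_map_ne_top (innerSL ℂ u) h.ne_top

theorem inner_self (h : IsEnsemble x G) (u : H) :
    ⟪u, G u⟫_ℂ = ((∑' i, ‖⟪u, x i⟫_ℂ‖ₑ ^ 2).toReal : ℂ) := by
  have h1 := h.hasSum_inner u u
  have h2 := Complex.hasSum_ofReal.mpr (hasSum_norm_sq (h.tsum_inner_ne_top u))
  refine h1.unique ?_
  convert h2 using 2 with i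
  rw [← inner_conj_symm, ← Complex.normSq_eq_conj_mul_self, Complex.normSq_eq_norm_sq]

/-- Over `ℂ` an operator is determined by its quadratic form. This compares ensembles with unrelated
index sets, which partial traces produce. -/
theorem eq_of_quadratic (h : IsEnsemble x G) {y : κ → H} {G' : H →L[ℂ] H} (h' : IsEnsemble y G')
    (e : ∀ u, ∑' i, ‖⟪u, x i⟫_ℂ‖ₑ ^ 2 = ∑' i, ‖⟪u, y i⟫_ℂ‖ₑ ^ 2) : G = G' := by
  refine ContinuousLinearMap.coe_injective ((ext_inner_map _ _).mp fun u => ?_)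
  rw [← inner_conj_symm, ← inner_conj_symm (G'.toLinearMap u)]
  exact congrArg conj (by rw [ContinuousLinearMap.coe_coe, ContinuousLinearMap.coe_coe,
    h.inner_self, h'.inner_self, e])

theorem compress (h : IsEnsemble x G) (K : H →L[ℂ] H') :
    IsEnsemble (fun i => K (x i)) (K ∘L G ∘L K.adjoint) := by
  refine ⟨tsum_enorm_sq_map_ne_top K h.ne_top, ?_⟩
  have h1 : HasSum (fun i => K ∘L InnerProductSpace.rankOne ℂ (x i) (x i) ∘L K.adjoint)
      (K ∘L G ∘L K.adjoint) :=
    h.hasSum.mapL ((ContinuousLinearMap.compL ℂ H' H H').flip K.adjoint ∘L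
      (ContinuousLinearMap.compL ℂ H H H') K)
  simpa [InnerProductSpace.comp_rankOne, InnerProductSpace.rankOne_comp] using h1

theorem isPositive (h : IsEnsemble x G) : G.IsPositive := by
  rw [ContinuousLinearMap.isPositive_iff_complex]
  intro u
  rw [← inner_conj_symm, h.inner_self]
  simp

/-- The trace of `B G`, in any Hilbert basis. -/
theorem hasSum_basis (h : IsEnsemble x G) (B : H →L[ℂ] H) (b : HilbertBasis κ ℂ H) :
    HasSum (fun k => ⟪b k, B (G (b k))⟫_ℂ) (∑' i, ⟪x i, B (x i)⟫_ℂ) := by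
  refine hasSum_basis_of_hasSum_family b h.ne_top (tsum_enorm_sq_map_ne_top B h.ne_top)
    fun k => ?_
  simpa [inner_smul_right] using ((h.hasSum_apply (b k)).mapL B).mapL (innerSL ℂ (b k))

theorem isPosTraceClass (h : IsEnsemble x G) : IsPosTraceClass G :=
  ⟨h.isPositive, fun _ b => by simpa using (h.hasSum_basis 1 b).summable⟩

theorem trace_comp (h : IsEnsemble x G) (B : H →L[ℂ] H) :
    trace (B ∘L G) = ∑' i, ⟪x i, B (x i)⟫_ℂ :=
  (h.hasSum_basis B (stdBasis H)).tsum_eq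

theorem trace_eq (h : IsEnsemble x G) : trace G = ((∑' i, ‖x i‖ₑ ^ 2).toReal : ℂ) := by
  have h1 := h.trace_comp 1
  have h2 : (1 : H →L[ℂ] H) ∘L G = G := by ext; simp
  rw [h2] at h1
  rw [h1, ← (Complex.hasSum_ofReal.mpr (hasSum_norm_sq h.ne_top)).tsum_eq]
  simp [inner_self_eq_norm_sq_to_K]

/-- Summing ensembles. -/
theorem hasSum_prod {z : κ × ι → H} (hz : ∑' p, ‖z p‖ₑ ^ 2 ≠ ⊤) {T : κ → H →L[ℂ] H}
    (hT : ∀ k, IsEnsemble (fun i => z (k, i)) (T k)) : IsEnsemble z (∑' k, T k) := by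
  have h := isEnsemble_ensemble hz
  rw [(h.hasSum.prod_fiberwise fun k => (hT k).hasSum).tsum_eq]
  exact h

end IsEnsemble

/-! ### Square roots and the canonical ensemble of a positive trace-class operator -/

theorem opSqrt_comp_self {T : H →L[ℂ] H} (hT : 0 ≤ T) : opSqrt T ∘L opSqrt T = T :=
  CFC.sqrt_mul_sqrt_self T hT

theorem opSqrt_nonneg (T : H →L[ℂ] H) : 0 ≤ opSqrt T := CFC.sqrt_nonneg T

theorem isSelfAdjoint_opSqrt (T : H →L[ℂ] H) : IsSelfAdjoint (opSqrt T) :=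
  (opSqrt_nonneg T).isSelfAdjoint

theorem norm_opSqrt_apply_sq {T : H →L[ℂ] H} (hT : T.IsPositive) (u : H) :
    ((‖opSqrt T u‖ ^ 2 : ℝ) : ℂ) = ⟪u, T u⟫_ℂ := by
  have h := opSqrt_comp_self ((ContinuousLinearMap.nonneg_iff_isPositive T).mpr hT)
  have h2 : T u = opSqrt T (opSqrt T u) := by
    conv_lhs => rw [← h]
    rfl
  rw [h2, ← ContinuousLinearMap.adjoint_inner_left, (isSelfAdjoint_opSqrt T).adjoint_eq,
    inner_self_eq_norm_sq_to_K]
  norm_cast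

/-- Insert `1 = ∑ |eᵢ⟩⟨eᵢ|` between the two factors of `Γ = Γ^{1/2} Γ^{1/2}`; finiteness of the
trace is square-summability of the vectors `Γ^{1/2} eᵢ`. -/
theorem IsPosTraceClass.isEnsemble {Γ : H →L[ℂ] H} (hΓ : IsPosTraceClass Γ) :
    IsEnsemble (fun i => opSqrt Γ (stdBasis H i)) Γ := by
  have hsq := opSqrt_comp_self ((ContinuousLinearMap.nonneg_iff_isPositive Γ).mpr hΓ.1)
  have hx : ∑' i, ‖opSqrt Γ (stdBasis H i)‖ₑ ^ 2 ≠ ⊤ := by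
    refine tsum_enorm_sq_ne_top ?_
    have h1 := hΓ.2 _ (stdBasis H)
    simp only [← norm_opSqrt_apply_sq hΓ.1] at h1
    exact Complex.summable_ofReal.mp h1
  have h := isEnsemble_ensemble hx
  convert h using 1
  refine ContinuousLinearMap.ext fun v => ext_inner_left ℂ fun u => ?_
  refine HasSum.unique ?_ (h.hasSum_inner u v)
  have h2 : Γ v = opSqrt Γ (opSqrt Γ v) := by
    conv_lhs => rw [← hsq]
    rfl
  have ha := (isSelfAdjoint_opSqrt Γ).adjoint_eq
  have h3 := (stdBasis H).hasSum_inner_mul_inner (opSqrt Γ u) (opSqrt Γ v)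
  rw [← ContinuousLinearMap.adjoint_inner_right, ha, ← h2] at h3
  have hs : ∀ a c, ⟪opSqrt Γ a, c⟫_ℂ = ⟪a, opSqrt Γ c⟫_ℂ := fun a c => by
    rw [← ContinuousLinearMap.adjoint_inner_right, ha]
  have e : ∀ i, ⟪opSqrt Γ u, stdBasis H i⟫_ℂ * ⟪stdBasis H i, opSqrt Γ v⟫_ℂ =
      ⟪opSqrt Γ (stdBasis H i), v⟫_ℂ * ⟪u, opSqrt Γ (stdBasis H i)⟫_ℂ := fun i => by
    rw [mul_comm, hs u, hs (stdBasis H i)]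
  simpa only [e] using h3

end Ensemble

/-! ### Synthesis operators and traces of quadratic forms -/

section FormTrace

variable {ι κ : Type*}
variable {H : Type*} [NormedAddCommGroup H] [InnerProductSpace ℂ H] [CompleteSpace H]
variable {L : Type*} [NormedAddCommGroup L] [InnerProductSpace ℂ L] [CompleteSpace L]

/-- Both sides are the double sum of the squared matrix entries of `P`, that is, its squared
Hilbert-Schmidt norm. -/
theorem tsum_enorm_sq_adjoint (P : L →L[ℂ] H) (b : HilbertBasis ι ℂ L) (c : HilbertBasis κ ℂ H) :
    ∑' l, ‖P.adjoint (c l)‖ₑ ^ 2 = ∑' i, ‖P (b i)‖ₑ ^ 2 := by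
  simp only [← tsum_enorm_sq_inner b (P.adjoint _), ← tsum_enorm_sq_inner' c (P _)]
  rw [ENNReal.tsum_comm]
  simp only [ContinuousLinearMap.adjoint_inner_right]

/-- The Hilbert-Schmidt inner product of `P` and `Q` as that of `Q†` and `P†`. -/
theorem hasSum_inner_apply (P Q : L →L[ℂ] H) (b : HilbertBasis ι ℂ L) (c : HilbertBasis κ ℂ H)
    (hP : ∑' l, ‖P.adjoint (c l)‖ₑ ^ 2 ≠ ⊤) (hQ : ∑' l, ‖Q.adjoint (c l)‖ₑ ^ 2 ≠ ⊤) :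
    HasSum (fun i => ⟪P (b i), Q (b i)⟫_ℂ) (∑' l, ⟪Q.adjoint (c l), P.adjoint (c l)⟫_ℂ) := by
  refine hasSum_basis_of_hasSum_family b hQ hP fun i => ?_
  simp only [ContinuousLinearMap.adjoint_inner_left, ContinuousLinearMap.adjoint_inner_right]
  simpa only [mul_comm] using c.hasSum_inner_mul_inner (P (b i)) (Q (b i))

/-- If `T† T = S²` with `S` self-adjoint, then `T` and `S` have the same polar decomposition. -/
theorem exists_polar (S : H →L[ℂ] H) (hS : IsSelfAdjoint S) (T : H →L[ℂ] L)
    (hT : T.adjoint ∘L T = S ∘L S) :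
    ∃ W : H →L[ℂ] L, W ∘L S = T ∧ T.adjoint ∘L W = S := by
  have hSi : ∀ a c, ⟪S a, c⟫_ℂ = ⟪a, S c⟫_ℂ := fun a c => by
    rw [← ContinuousLinearMap.adjoint_inner_right, hS.adjoint_eq]
  have hTS : ∀ h, T.adjoint (T h) = S (S h) := fun h => DFunLike.congr_fun hT h
  have hn : ∀ h, ‖T h‖ = ‖S h‖ := fun h => by
    rw [@norm_eq_sqrt_re_inner ℂ, @norm_eq_sqrt_re_inner ℂ,
      ← ContinuousLinearMap.adjoint_inner_right, hTS, ← hSi]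
  let M := S.range.topologicalClosure
  let e : H →ₗ[ℂ] M := S.toLinearMap.codRestrict M fun h =>
    S.range.le_topologicalClosure ⟨h, rfl⟩
  have hd : DenseRange e := by
    intro m
    have h1 : Subtype.val '' Set.range e = (S.range : Set H) := by
      ext z
      constructor
      · rintro ⟨_, ⟨h, rfl⟩, rfl⟩
        exact ⟨h, rfl⟩
      · rintro ⟨h, rfl⟩
        exact ⟨e h, ⟨h, rfl⟩, rfl⟩
    rw [Topology.IsEmbedding.subtypeVal.closure_eq_preimage_closure_image, Set.mem_preimage, h1]
    exact m.2
  have hb : ∃ C, ∀ x, ‖T.toLinearMap x‖ ≤ C * ‖e x‖ :=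
    ⟨1, fun x => by rw [one_mul]; exact (hn x).le⟩
  -- Since `‖T h‖ = ‖S h‖`, the assignment `S h ↦ T h` is well defined and isometric on the range of
  -- `S`, hence extends to its closure `M`. The operator `W` is this extension on `M` and zero on
  -- the orthogonal complement.
  let V : M →L[ℂ] L := T.toLinearMap.extendOfNorm e
  have hV : ∀ h, V (e h) = T h := LinearMap.extendOfNorm_eq hd hb
  have hTV : ∀ m : M, T.adjoint (V m) = S m := by
    refine fun m => hd.induction_on (p := fun m => T.adjoint (V m) = S m) m ?_ ?_
    · exact isClosed_eq (by fun_prop) (by fun_prop)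
    · intro h
      rw [hV, hTS]
      rfl
  have : CompleteSpace M := S.range.isClosed_topologicalClosure.completeSpace_coe
  refine ⟨V ∘L M.orthogonalProjectionOnto, ?_, ?_⟩
  · ext h
    have : M.orthogonalProjectionOnto (S h) = e h :=
      Submodule.orthogonalProjectionOnto_mem_subspace_eq_self (e h)
    simp [this, hV]
  · ext v
    -- The self-adjoint `S` vanishes on the orthogonal complement of its range, so `T† W = S` only
    -- has to be known on `M`.
    have h0 : S (v - M.orthogonalProjectionOnto v) = 0 := by
      refine ext_inner_left ℂ fun h => ?_
      rw [← hSi, inner_zero_right]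
      exact Submodule.inner_right_of_mem_orthogonal (K := M) (e h).2
        (Submodule.sub_starProjection_mem_orthogonal v)
    rw [map_sub, sub_eq_zero] at h0
    simp [hTV, h0]

/-- The space of square-summable coefficients. -/
abbrev Coeff (κ : Type*) : Type _ := lp (fun _ : κ => ℂ) 2

/-- The standard basis of the coefficient space. -/
def coeffBasis (κ : Type*) : HilbertBasis κ ℂ (Coeff κ) :=
  HilbertBasis.ofRepr (LinearIsometryEquiv.refl ℂ _)

theorem inner_coeffBasis (k : κ) (v : Coeff κ) : ⟪coeffBasis κ k, v⟫_ℂ = v k := by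
  rw [← HilbertBasis.repr_apply_apply]
  rfl

theorem norm_sq_lp {J : Type*} {V : J → Type*} [∀ j, NormedAddCommGroup (V j)] (v : lp V 2) :
    HasSum (fun k => ‖v k‖ ^ 2) (‖v‖ ^ 2) := by
  simpa using lp.hasSum_norm (by simp) v

theorem tsum_enorm_sq_lp {J : Type*} {V : J → Type*} [∀ j, NormedAddCommGroup (V j)]
    (v : lp V 2) : ∑' k, ‖v k‖ₑ ^ 2 = ‖v‖ₑ ^ 2 := by
  simp only [enorm_sq_eq_ofReal]
  rw [← (norm_sq_lp v).tsum_eq,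
    ENNReal.ofReal_tsum_of_nonneg (fun _ => sq_nonneg _) (norm_sq_lp v).summable]

theorem memℓp_two_of_ne_top {J : Type*} {V : J → Type*} [∀ j, NormedAddCommGroup (V j)]
    {v : ∀ j, V j} (h : ∑' k, ‖v k‖ₑ ^ 2 ≠ ⊤) : Memℓp v 2 := by
  rw [memℓp_gen_iff (by simp)]
  simp only [enorm_sq_eq_ofReal] at h
  have h := ENNReal.summable_toReal h
  simpa [ENNReal.toReal_ofReal, sq_nonneg] using h

/-- The map `h ↦ (⟪xₖ, h⟫)ₖ`. -/
def analysisMap (x : κ → H) (hx : ∑' k, ‖x k‖ₑ ^ 2 ≠ ⊤) : H →L[ℂ] Coeff κ :=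
  LinearMap.mkContinuous
    { toFun := fun h => ⟨fun k => ⟪x k, h⟫_ℂ, memℓp_two_of_ne_top (by
        refine tsum_enorm_sq_ne_top (.of_nonneg_of_le (fun _ => sq_nonneg _) (fun k => ?_)
          ((summable_norm_sq hx).mul_right (‖h‖ ^ 2)))
        rw [← mul_pow]
        gcongr
        exact norm_inner_le_norm _ _)⟩
      map_add' := fun a b => by ext k; exact inner_add_right _ _ _
      map_smul' := fun c a => by ext k; exact inner_smul_right _ _ _ }
    (√(∑' k, ‖x k‖ ^ 2)) fun h => by
      refine (sq_le_sq₀ (norm_nonneg _) (by positivity)).mp ?_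
      rw [mul_pow, Real.sq_sqrt (tsum_nonneg fun _ => sq_nonneg _), ← tsum_mul_right]
      refine hasSum_le (fun k => ?_) (norm_sq_lp _)
        ((summable_norm_sq hx).mul_right (‖h‖ ^ 2)).hasSum
      rw [← mul_pow]
      gcongr
      exact norm_inner_le_norm _ _

/-- The map `v ↦ ∑ vₖ xₖ`. -/
def synthesis (x : κ → H) (hx : ∑' k, ‖x k‖ₑ ^ 2 ≠ ⊤) : Coeff κ →L[ℂ] H :=
  (analysisMap x hx).adjoint

theorem synthesis_coeffBasis (x : κ → H) (hx : ∑' k, ‖x k‖ₑ ^ 2 ≠ ⊤) (k : κ) :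
    synthesis x hx (coeffBasis κ k) = x k := by
  refine ext_inner_left ℂ fun h => ?_
  rw [synthesis, ContinuousLinearMap.adjoint_inner_right, ← inner_conj_symm, inner_coeffBasis,
    ← inner_conj_symm h]
  rfl

theorem hilbertBasis_induction (b : HilbertBasis κ ℂ L) {p : L → Prop} (hs : ∀ k, p (b k))
    (h0 : p 0) (ha : ∀ v w, p v → p w → p (v + w)) (hc : ∀ (c : ℂ) v, p v → p (c • v))
    (hcl : IsClosed {v | p v}) (v : L) : p v := by
  let M : Submodule ℂ L :=
    { carrier := {v | p v}, add_mem' := fun h h' => ha _ _ h h', zero_mem' := h0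
      smul_mem' := fun c v h => hc c v h }
  have h1 : (Submodule.span ℂ (Set.range b)).topologicalClosure ≤ M :=
    Submodule.topologicalClosure_minimal _
      (Submodule.span_le.mpr (by rintro _ ⟨k, rfl⟩; exact hs k)) hcl
  rw [HilbertBasis.dense_span] at h1
  exact h1 trivial

/-- `A` maps the family `x` to the family `a`, also on square-summable combinations. -/
structure MapsFamily (A : H →ₗ.[ℂ] L) (x : κ → H) (a : κ → L) : Prop where
  left : ∑' k, ‖x k‖ₑ ^ 2 ≠ ⊤
  right : ∑' k, ‖a k‖ₑ ^ 2 ≠ ⊤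
  mem : ∀ v, (synthesis x left v, synthesis a right v) ∈ A.graph

/-- The coefficient sequences whose syntheses lie in the graph form a closed subspace, so it is
enough to test the standard basis. -/
theorem mapsFamily_of_isClosed {A : H →ₗ.[ℂ] L} (hA : IsClosed (A.graph : Set (H × L)))
    {x : κ → H} {a : κ → L} (hx : ∑' k, ‖x k‖ₑ ^ 2 ≠ ⊤) (ha : ∑' k, ‖a k‖ₑ ^ 2 ≠ ⊤)
    (hxa : ∀ k, (x k, a k) ∈ A.graph) : MapsFamily A x a := by
  refine ⟨hx, ha, hilbertBasis_induction (coeffBasis κ) (fun k => ?_) ?_ (fun v w hv hw => ?_) (fun c v hv => ?_) ?_⟩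
  · simpa only [synthesis_coeffBasis] using hxa k
  · simp only [map_zero]
    exact A.graph.zero_mem
  · simpa only [map_add] using! A.graph.add_mem hv hw
  · simpa only [map_smul] using! A.graph.smul_mem c hv
  · exact hA.preimage (by fun_prop : Continuous fun v => (synthesis x hx v, synthesis a ha v))

/-- A sum of closed operators need not be closed, so closedness cannot be invoked for `a†(f) +
a(f)`. The graph condition on all square-summable combinations, by contrast, is stable under sums
and under composition with bounded operators. -/
theorem MapsFamily.add {A B : H →ₗ.[ℂ] L} {x : κ → H} {a b : κ → L} (hA : MapsFamily A x a)
    (hB : MapsFamily B x b) : MapsFamily (A + B) x (fun k => a k + b k) := by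
  refine ⟨hA.left, tsum_enorm_sq_add_ne_top hA.right hB.right, fun v => ?_⟩
  have h1 : synthesis (fun k => a k + b k) (tsum_enorm_sq_add_ne_top hA.right hB.right) v =
      synthesis a hA.right v + synthesis b hB.right v := by
    refine hilbertBasis_induction (coeffBasis κ) (p := fun v => synthesis (fun k => a k + b k)
      (tsum_enorm_sq_add_ne_top hA.right hB.right) v = synthesis a hA.right v +
      synthesis b hB.right v) (fun k => ?_) ?_ (fun v w hv hw => ?_) (fun c v hv => ?_) ?_ v
    · simp only [synthesis_coeffBasis]
    · simp
    · simp only [map_add, hv, hw]; abel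
    · simp only [map_smul, hv, smul_add]
    · exact isClosed_eq (by fun_prop) (by fun_prop)
  obtain ⟨y, hy1, hy2⟩ := (LinearPMap.mem_graph_iff _).mp (hA.mem v)
  obtain ⟨z, hz1, hz2⟩ := (LinearPMap.mem_graph_iff _).mp (hB.mem v)
  dsimp only at hy1 hy2 hz1 hz2
  rw [LinearPMap.mem_graph_iff]
  have hyB : (y : H) ∈ B.domain := by rw [hy1, ← hz1]; exact z.2
  have hz : z = ⟨y, hyB⟩ := Subtype.ext (hz1.trans hy1.symm)
  exact ⟨⟨y, y.2, hyB⟩, hy1, by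
    rw [LinearPMap.add_apply, h1, ← hy2, ← hz2, hz]⟩

theorem MapsFamily.compPMap {L' : Type*} [NormedAddCommGroup L'] [InnerProductSpace ℂ L']
    [CompleteSpace L'] {A : H →ₗ.[ℂ] L} {x : κ → H} {a : κ → L} (hA : MapsFamily A x a)
    (K : L →L[ℂ] L') : MapsFamily (K.toLinearMap.compPMap A) x (fun k => K (a k)) := by
  refine ⟨hA.left, tsum_enorm_sq_map_ne_top K hA.right, fun v => ?_⟩
  have h1 : synthesis (fun k => K (a k)) (tsum_enorm_sq_map_ne_top K hA.right) v =
      K (synthesis a hA.right v) := by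
    refine hilbertBasis_induction (coeffBasis κ) (p := fun v => synthesis (fun k => K (a k))
      (tsum_enorm_sq_map_ne_top K hA.right) v = K (synthesis a hA.right v))
      (fun k => ?_) ?_ (fun v w hv hw => ?_) (fun c v hv => ?_) ?_ v
    · simp only [synthesis_coeffBasis]
    · simp
    · simp only [map_add, hv, hw]
    · simp only [map_smul, hv]
    · exact isClosed_eq (by fun_prop) (by fun_prop)
  obtain ⟨y, hy1, hy2⟩ := (LinearPMap.mem_graph_iff _).mp (hA.mem v)
  rw [LinearPMap.mem_graph_iff]
  exact ⟨y, hy1, (congrArg K hy2).trans h1.symm⟩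

theorem mapsFamily_id {x : κ → H} (hx : ∑' k, ‖x k‖ₑ ^ 2 ≠ ⊤) :
    MapsFamily (LinearMap.id.toPMap ⊤ : H →ₗ.[ℂ] H) x x :=
  ⟨hx, hx, fun v => (LinearPMap.mem_graph_iff _).mpr ⟨⟨synthesis x hx v, trivial⟩, rfl, rfl⟩⟩

/-- The trace `Tr (G A† B)` in the sense of quadratic forms, from a decomposition of `G`. -/
theorem IsEnsemble.hasFormTrace {x a b : κ → H} {G : H →L[ℂ] H} (hG : IsEnsemble x G)
    {A B : H →ₗ.[ℂ] H} (hA : MapsFamily A x a) (hB : MapsFamily B x b) :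
    HasFormTrace G A B (∑' k, ⟪a k, b k⟫_ℂ) := by
  intro w c
  set S := opSqrt G
  have hS : IsSelfAdjoint S := isSelfAdjoint_opSqrt G
  -- The adjoint of `T` is the synthesis map, and `T† T = G = S²`; this is the input for the polar
  -- decomposition.
  set T := analysisMap x hG.ne_top
  have hX : T.adjoint = synthesis x hG.ne_top := rfl
  have hTT : T.adjoint ∘L T = S ∘L S := by
    rw [opSqrt_comp_self ((ContinuousLinearMap.nonneg_iff_isPositive G).mpr hG.isPositive)]
    refine ContinuousLinearMap.ext fun v => ext_inner_left ℂ fun u => ?_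
    rw [ContinuousLinearMap.comp_apply, ContinuousLinearMap.adjoint_inner_right,
      lp.inner_eq_tsum, ← (hG.hasSum_inner u v).tsum_eq]
    refine tsum_congr fun k => ?_
    simp [T, analysisMap]
  obtain ⟨W, hWS, hTW⟩ := exists_polar S hS T hTT
  have hXW : synthesis x hG.ne_top ∘L W = S := by rw [← hX, hTW]
  -- Taking adjoints in `T = W S` gives `synthesis x = S W†`, while `synthesis x ∘ W = S`; hence `W
  -- W†` may be inserted to the right of the synthesis of `x`.
  have hXWW : ∀ v, synthesis x hG.ne_top (W (W.adjoint v)) = synthesis x hG.ne_top v := by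
    intro v
    have h1 : synthesis x hG.ne_top = S ∘L W.adjoint := by
      rw [← hX, ← hWS, ContinuousLinearMap.adjoint_comp, hS.adjoint_eq]
    have h2 := DFunLike.congr_fun hXW (W.adjoint v)
    rw [ContinuousLinearMap.comp_apply] at h2
    rw [h2, h1]
    rfl
  -- Because `A` is single-valued, inserting `W W†` is also harmless for the synthesis of the image
  -- family `a`. Moreover `A S h` equals the synthesis of `a` at `W h`, which puts the range of `S`
  -- in the domain.
  have key : ∀ {A : H →ₗ.[ℂ] H} {a : κ → H} (hA : MapsFamily A x a),
      (∀ h, (S h, synthesis a hA.right (W h)) ∈ A.graph) ∧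
      synthesis a hA.right ∘L W ∘L W.adjoint = synthesis a hA.right := by
    intro A a hA
    refine ⟨fun h => ?_, ContinuousLinearMap.ext fun v => ?_⟩
    · rw [← hXW]
      exact hA.mem (W h)
    · have h1 := A.graph.sub_mem (hA.mem (W (W.adjoint v))) (hA.mem v)
      have h2 := A.graph_fst_eq_zero_snd h1 (by simp [hXWW])
      simpa [sub_eq_zero] using h2
  obtain ⟨hA1, hA2⟩ := key hA
  obtain ⟨hB1, hB2⟩ := key hB
  have hdom : ∀ {A : H →ₗ.[ℂ] H} {p : H × H}, p ∈ A.graph →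
      ∃ h : p.1 ∈ A.domain, A ⟨p.1, h⟩ = p.2 := by
    intro A p hp
    obtain ⟨y, hy1, hy2⟩ := (LinearPMap.mem_graph_iff _).mp hp
    refine ⟨hy1 ▸ y.2, ?_⟩
    rw [← hy2]
    congr 1
    exact Subtype.ext hy1.symm
  refine ⟨fun i => (hdom (hA1 (c i))).1, fun i => (hdom (hB1 (c i))).1, ?_⟩
  have e : ∀ i, ⟪A ⟨S (c i), (hdom (hA1 (c i))).1⟩, B ⟨S (c i), (hdom (hB1 (c i))).1⟩⟫_ℂ =
      ⟪(synthesis a hA.right ∘L W) (c i), (synthesis b hB.right ∘L W) (c i)⟫_ℂ := fun i => by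
    rw [(hdom (hA1 (c i))).2, (hdom (hB1 (c i))).2]
    rfl
  simp only [e]
  have fin : ∀ {a : κ → H} (ha : ∑' k, ‖a k‖ₑ ^ 2 ≠ ⊤),
      ∑' l, ‖(synthesis a ha).adjoint (c l)‖ₑ ^ 2 ≠ ⊤ := fun {a} ha => by
    rw [tsum_enorm_sq_adjoint _ (coeffBasis κ)]
    simpa only [synthesis_coeffBasis] using ha
  have fin2 : ∀ {a : κ → H} (ha : ∑' k, ‖a k‖ₑ ^ 2 ≠ ⊤),
      ∑' l, ‖(synthesis a ha ∘L W).adjoint (c l)‖ₑ ^ 2 ≠ ⊤ := fun {a} ha => by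
    rw [ContinuousLinearMap.adjoint_comp]
    exact tsum_enorm_sq_map_ne_top W.adjoint (fin ha)
  -- The trace over `c` and the sum over the ensemble are Hilbert-Schmidt inner products on
  -- different spaces. Passing to adjoints writes both over the basis `c`, where they differ only by
  -- the factor `W W†`, removed with the adjoint of `hA2`.
  have h1 := hasSum_inner_apply (synthesis a hA.right ∘L W) (synthesis b hB.right ∘L W) c c
    (fin2 hA.right) (fin2 hB.right)
  have h2 := hasSum_inner_apply (synthesis a hA.right) (synthesis b hB.right) (coeffBasis κ) c
    (fin hA.right) (fin hB.right)
  simp only [synthesis_coeffBasis] at h2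
  rw [h2.tsum_eq]
  convert h1 using 1
  refine tsum_congr fun l => ?_
  simp only [ContinuousLinearMap.adjoint_comp, ContinuousLinearMap.comp_apply]
  conv_rhs => rw [ContinuousLinearMap.adjoint_inner_left]
  have h3 := congrArg ContinuousLinearMap.adjoint hA2
  simp only [ContinuousLinearMap.adjoint_comp, ContinuousLinearMap.adjoint_adjoint] at h3
  have h4 := DFunLike.congr_fun h3 (c l)
  simp only [ContinuousLinearMap.comp_apply] at h4
  rw [h4]

/-- A bounded sesquilinear form is represented by a bounded operator. -/
theorem exists_operator_of_form (B : H → H → ℂ)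
    (h1 : ∀ u u' v, B (u + u') v = B u v + B u' v) (h2 : ∀ (c : ℂ) u v, B (c • u) v = conj c * B u v)
    (h3 : ∀ u v v', B u (v + v') = B u v + B u v') (h4 : ∀ (c : ℂ) u v, B u (c • v) = c * B u v)
    (C : ℝ) (hC : ∀ u v, ‖B u v‖ ≤ C * ‖u‖ * ‖v‖) :
    ∃ R : H →L[ℂ] H, ∀ u v, ⟪u, R v⟫_ℂ = B u v := by
  let b : H →L⋆[ℂ] H →L[ℂ] ℂ :=
    LinearMap.mkContinuous₂ (LinearMap.mk₂'ₛₗ (starRingEnd ℂ) (RingHom.id ℂ) B h1 h2 h3 h4) C hC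
  refine ⟨(InnerProductSpace.continuousLinearMapOfBilin b).adjoint, fun u v => ?_⟩
  rw [ContinuousLinearMap.adjoint_inner_right,
    InnerProductSpace.continuousLinearMapOfBilin_apply]
  rfl

end FormTrace

/-! ### Bilinear models of Hilbert space tensor products -/

section TensorPair

variable {ι κ : Type*}
variable {E : Type*} [NormedAddCommGroup E] [InnerProductSpace ℂ E] [CompleteSpace E]
variable {F : Type*} [NormedAddCommGroup F] [InnerProductSpace ℂ F] [CompleteSpace F]
variable {G : Type*} [NormedAddCommGroup G] [InnerProductSpace ℂ G] [CompleteSpace G]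

/-- `T x y = T' y x` is a bilinear map that turns `G` into a Hilbert space tensor product of `E`
and `F`. -/
structure IsTensorPair (T : E → F →L[ℂ] G) (T' : F → E →L[ℂ] G) : Prop where
  flip : ∀ x y, T x y = T' y x
  inner : ∀ x s y t, ⟪T x s, T y t⟫_ℂ = ⟪x, y⟫_ℂ * ⟪s, t⟫_ℂ
  total : ∀ Ψ, (∀ x s, ⟪T x s, Ψ⟫_ℂ = 0) → Ψ = 0

/-- Self-adjoint `q`, `p` with `q² + p² = 1`. -/
structure IsQuadraticPartition (q p : E →L[ℂ] E) : Prop where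
  left : IsSelfAdjoint q
  right : IsSelfAdjoint p
  add_eq : q ∘L q + p ∘L p = 1

theorem IsQuadraticPartition.inner_add {q p : E →L[ℂ] E} (h : IsQuadraticPartition q p) (r s : E) :
    ⟪q r, q s⟫_ℂ + ⟪p r, p s⟫_ℂ = ⟪r, s⟫_ℂ := by
  rw [← ContinuousLinearMap.adjoint_inner_right, ← ContinuousLinearMap.adjoint_inner_right p,
    h.left.adjoint_eq, h.right.adjoint_eq, ← inner_add_right]
  congr 1
  exact DFunLike.congr_fun h.add_eq s

theorem IsQuadraticPartition.enorm_sq_add {q p : E →L[ℂ] E} (h : IsQuadraticPartition q p)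
    (r : E) : ‖q r‖ₑ ^ 2 + ‖p r‖ₑ ^ 2 = ‖r‖ₑ ^ 2 := by
  have h1 := h.inner_add r r
  simp only [inner_self_eq_norm_sq_to_K] at h1
  simp only [enorm_sq_eq_ofReal]
  rw [← ENNReal.ofReal_add (sq_nonneg _) (sq_nonneg _)]
  congr 1
  exact_mod_cast h1

namespace IsTensorPair

variable {T : E → F →L[ℂ] G} {T' : F → E →L[ℂ] G}

theorem symm (h : IsTensorPair T T') : IsTensorPair T' T where
  flip y x := (h.flip x y).symm
  inner s x t y := by rw [← h.flip, ← h.flip, h.inner, mul_comm]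
  total Ψ hΨ := h.total Ψ fun x s => by rw [h.flip, hΨ]

theorem norm_apply (h : IsTensorPair T T') (x : E) (s : F) : ‖T x s‖ = ‖x‖ * ‖s‖ := by
  have h1 := h.inner x s x s
  simp only [inner_self_eq_norm_sq_to_K, ← mul_pow] at h1
  refine (sq_eq_sq₀ (norm_nonneg _) (by positivity)).mp ?_
  exact_mod_cast h1

/-- The first map as a continuous linear map. -/
def toCLM (h : IsTensorPair T T') : E →L[ℂ] F →L[ℂ] G :=
  LinearMap.mkContinuous
    { toFun := T
      map_add' := fun x y => by ext s; simp [h.flip]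
      map_smul' := fun c x => by ext s; simp [h.flip] } 1 fun x => by
    rw [one_mul]
    exact (T x).opNorm_le_bound (norm_nonneg _) fun s => (h.norm_apply x s).le

@[simp] theorem toCLM_apply (h : IsTensorPair T T') (x : E) : h.toCLM x = T x := rfl

theorem adjoint_flip (h : IsTensorPair T T') (x : E) (s : F) (Ψ : G) :
    ⟪s, (T x).adjoint Ψ⟫_ℂ = ⟪x, (T' s).adjoint Ψ⟫_ℂ := by
  rw [ContinuousLinearMap.adjoint_inner_right, ContinuousLinearMap.adjoint_inner_right, h.flip]

theorem adjoint_add (h : IsTensorPair T T') (x y : E) (Ψ : G) :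
    (T (x + y)).adjoint Ψ = (T x).adjoint Ψ + (T y).adjoint Ψ := by
  rw [← h.toCLM_apply, map_add, map_add]
  rfl

theorem adjoint_smul (h : IsTensorPair T T') (c : ℂ) (x : E) (Ψ : G) :
    (T (c • x)).adjoint Ψ = conj c • (T x).adjoint Ψ := by
  rw [← h.toCLM_apply, map_smul, map_smulₛₗ]
  rfl

theorem continuous_adjoint (h : IsTensorPair T T') (Ψ : G) :
    Continuous fun x => (T x).adjoint Ψ :=
  ((ContinuousLinearMap.apply ℂ F Ψ).continuous.comp
    ContinuousLinearMap.adjoint.continuous).comp h.toCLM.continuous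

theorem norm_adjoint_le (h : IsTensorPair T T') (x : E) (Ψ : G) :
    ‖(T x).adjoint Ψ‖ ≤ ‖x‖ * ‖Ψ‖ := by
  refine ((T x).adjoint.le_opNorm Ψ).trans ?_
  rw [LinearIsometryEquiv.norm_map]
  gcongr
  exact (T x).opNorm_le_bound (norm_nonneg _) fun s => (h.norm_apply x s).le

/-- Vanishing of all contractions with a basis. -/
theorem eq_zero_of_basis (h : IsTensorPair T T') (b : HilbertBasis ι ℂ E) {Ψ : G}
    (hΨ : ∀ j, (T (b j)).adjoint Ψ = 0) : Ψ = 0 := by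
  refine h.total Ψ fun x s => ?_
  have h1 : (T x).adjoint Ψ = 0 :=
    hilbertBasis_induction b (p := fun x => (T x).adjoint Ψ = 0) hΨ
      (by simpa using h.adjoint_smul 0 0 Ψ)
      (fun v w hv hw => by rw [h.adjoint_add, hv, hw, add_zero])
      (fun c v hv => by rw [h.adjoint_smul, hv, smul_zero])
      (isClosed_eq (h.continuous_adjoint Ψ) continuous_const) x
  rw [← ContinuousLinearMap.adjoint_inner_right, h1, inner_zero_right]

/-- The product basis. -/
def basis (h : IsTensorPair T T') (b : HilbertBasis ι ℂ E) (c : HilbertBasis κ ℂ F) :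
    HilbertBasis (ι × κ) ℂ G :=
  HilbertBasis.mkOfOrthogonalEqBot (v := fun p : ι × κ => T (b p.1) (c p.2))
    (by
      classical
      rw [orthonormal_iff_ite]
      rintro ⟨i, k⟩ ⟨j, l⟩
      rw [h.inner, orthonormal_iff_ite.mp b.orthonormal, orthonormal_iff_ite.mp c.orthonormal]
      by_cases hij : i = j <;> by_cases hkl : k = l <;> simp [hij, hkl])
    (by
      rw [Submodule.eq_bot_iff]
      intro Ψ hΨ
      refine h.eq_zero_of_basis b fun j => ?_
      have h1 : ∀ l, ⟪c l, (T (b j)).adjoint Ψ⟫_ℂ = 0 := fun l => by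
        rw [ContinuousLinearMap.adjoint_inner_right]
        exact (Submodule.mem_orthogonal _ _).mp hΨ _ (Submodule.subset_span ⟨(j, l), rfl⟩)
      have h2 := tsum_enorm_sq_inner c ((T (b j)).adjoint Ψ)
      simpa [h1] using h2.symm)

theorem basis_apply (h : IsTensorPair T T') (b : HilbertBasis ι ℂ E) (c : HilbertBasis κ ℂ F)
    (p : ι × κ) : h.basis b c p = T (b p.1) (c p.2) := by
  rw [basis, HilbertBasis.coe_mkOfOrthogonalEqBot]

theorem tsum_enorm_sq_adjoint (h : IsTensorPair T T') (b : HilbertBasis ι ℂ E) (Ψ : G) :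
    ∑' j, ‖(T (b j)).adjoint Ψ‖ₑ ^ 2 = ‖Ψ‖ₑ ^ 2 := by
  let c := stdBasis F
  rw [← tsum_enorm_sq_inner (h.basis b c) Ψ,
    ENNReal.tsum_prod (f := fun j l => ‖⟪h.basis b c (j, l), Ψ⟫_ℂ‖ₑ ^ 2)]
  refine tsum_congr fun j => ?_
  rw [← tsum_enorm_sq_inner c]
  simp only [h.basis_apply, ContinuousLinearMap.adjoint_inner_right]

/-- Expanding in a basis of the other factor gives the same double sum of squared matrix entries;
the operator `A` moves from the contracting vectors onto the contracted ones. -/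
theorem tsum_enorm_sq_adjoint_apply (h : IsTensorPair T T') (b : HilbertBasis ι ℂ E)
    (c : HilbertBasis κ ℂ F) (A : E →L[ℂ] E) (Ψ : G) :
    ∑' j, ‖(T (A (b j))).adjoint Ψ‖ₑ ^ 2 = ∑' l, ‖A.adjoint ((T' (c l)).adjoint Ψ)‖ₑ ^ 2 := by
  simp only [← tsum_enorm_sq_inner b (A.adjoint _), ← tsum_enorm_sq_inner c ((T _).adjoint Ψ)]
  rw [ENNReal.tsum_comm]
  simp only [h.adjoint_flip, ContinuousLinearMap.adjoint_inner_right (A := A)]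

/-- With `q` and `p` moved onto vectors of `E`, the identity `‖q r‖² + ‖p r‖² = ‖r‖²` applies
termwise and Parseval finishes. -/
theorem tsum_enorm_sq_partition (h : IsTensorPair T T') (b : HilbertBasis ι ℂ E)
    {q p : E →L[ℂ] E} (hqp : IsQuadraticPartition q p) (Ψ : G) :
    ∑' j, ‖(T (q (b j))).adjoint Ψ‖ₑ ^ 2 + ∑' j, ‖(T (p (b j))).adjoint Ψ‖ₑ ^ 2 = ‖Ψ‖ₑ ^ 2 := by
  rw [h.tsum_enorm_sq_adjoint_apply b (stdBasis F), h.tsum_enorm_sq_adjoint_apply b (stdBasis F),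
    ← ENNReal.tsum_add, hqp.left.adjoint_eq, hqp.right.adjoint_eq,
    ← h.symm.tsum_enorm_sq_adjoint (stdBasis F)]
  simp only [hqp.enorm_sq_add]

theorem hasSum_inner_adjoint (h : IsTensorPair T T') (b : HilbertBasis ι ℂ E) (Φ Ψ : G) :
    HasSum (fun j => ⟪(T (b j)).adjoint Φ, (T (b j)).adjoint Ψ⟫_ℂ) ⟪Φ, Ψ⟫_ℂ :=
  hasSum_inner_of_parseval (fun j => (T (b j)).adjoint.toLinearMap)
    (h.tsum_enorm_sq_adjoint b) Φ Ψ

/-- A vector with prescribed contractions. -/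
theorem exists_of_contractions (h : IsTensorPair T T') (b : HilbertBasis ι ℂ E) (z : ι → F)
    (hz : ∑' j, ‖z j‖ₑ ^ 2 ≠ ⊤) : ∃ Φ : G, ∀ j, (T (b j)).adjoint Φ = z j := by
  let c := stdBasis F
  have hm : ∑' p : ι × stdIndex F, ‖⟪c p.2, z p.1⟫_ℂ‖ₑ ^ 2 ≠ ⊤ := by
    rw [ENNReal.tsum_prod (f := fun j l => ‖⟪c l, z j⟫_ℂ‖ₑ ^ 2)]
    simpa only [tsum_enorm_sq_inner] using hz
  refine ⟨(h.basis b c).repr.symm ⟨_, memℓp_two_of_ne_top hm⟩, fun j => ?_⟩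
  rw [← sub_eq_zero]
  have h1 : ∀ l, ⟪c l, (T (b j)).adjoint ((h.basis b c).repr.symm ⟨_, memℓp_two_of_ne_top hm⟩) -
      z j⟫_ℂ = 0 := fun l => by
    rw [inner_sub_right, ContinuousLinearMap.adjoint_inner_right, ← h.basis_apply b c (j, l),
      ← HilbertBasis.repr_apply_apply, LinearIsometryEquiv.apply_symm_apply]
    exact sub_self _
  have h2 := tsum_enorm_sq_inner c ((T (b j)).adjoint
    ((h.basis b c).repr.symm ⟨_, memℓp_two_of_ne_top hm⟩) - z j)
  simpa [h1] using h2.symm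

end IsTensorPair

end TensorPair

/-! ### The Hilbert space tensor product -/

section HilbertTensorProduct

variable {ι : Type*}
variable {E : Type*} [NormedAddCommGroup E] [InnerProductSpace ℂ E] [CompleteSpace E]
variable {F : Type*} [NormedAddCommGroup F] [InnerProductSpace ℂ F] [CompleteSpace F]
variable {G : Type*} [NormedAddCommGroup G] [InnerProductSpace ℂ G] [CompleteSpace G]

theorem inner_htmul (x y : E) (s t : F) : ⟪htmul x s, htmul y t⟫_ℂ = ⟪x, y⟫_ℂ * ⟪s, t⟫_ℂ := by
  simp [htmul]

theorem tmulLeft_apply (x : E) (s : F) : tmulLeft x s = htmul x s := rfl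

theorem tmulRight_apply (x : E) (s : F) : tmulRight s x = htmul x s := rfl

/-- First instance of the bilinear model: particle times field. The second is the splitting-off of
one factor of a tensor power, `isTensorPair_cons`. -/
theorem isTensorPair_tmul : IsTensorPair (E := E) (F := F) tmulLeft tmulRight where
  flip _ _ := rfl
  inner x s y t := inner_htmul x y s t
  total Ψ hΨ := eq_zero_of_tmulLeft_adjoint fun x => ext_inner_left ℂ fun s => by
    rw [ContinuousLinearMap.adjoint_inner_right, hΨ, inner_zero_right]

theorem HTensor.ext_clm {A B : HTensor E F →L[ℂ] G}
    (h : ∀ x s, A (htmul x s) = B (htmul x s)) : A = B := by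
  refine ContinuousLinearMap.ext fun Ψ => ?_
  induction Ψ using UniformSpace.Completion.induction_on with
  | hp => exact isClosed_eq A.continuous B.continuous
  | ih t =>
    induction t using TensorProduct.induction_on with
    | zero => rw [UniformSpace.Completion.coe_zero, map_zero, map_zero]
    | tmul x s => exact h x s
    | add s t hs ht => rw [UniformSpace.Completion.coe_add, map_add, map_add, hs, ht]

theorem opTensor_htmul (A : E →L[ℂ] E) (B : F →L[ℂ] F) (x : E) (s : F) :
    opTensor A B (htmul x s) = htmul (A x) (B s) := by
  simp [opTensor, htmul, ContinuousLinearMap.completion_apply_coe]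

theorem tmulLeft_adjoint_htmul (u x : E) (s : F) :
    (tmulLeft u).adjoint (htmul x s) = ⟪u, x⟫_ℂ • s :=
  ext_inner_left ℂ fun t => by
    rw [ContinuousLinearMap.adjoint_inner_right, tmulLeft_apply, inner_htmul, inner_smul_right]

theorem tmulLeft_adjoint_opTensor (A : E →L[ℂ] E) (B : F →L[ℂ] F) (u : E) (Ψ : HTensor E F) :
    (tmulLeft u).adjoint (opTensor A B Ψ) = B ((tmulLeft (A.adjoint u)).adjoint Ψ) := by
  have h : (tmulLeft (F := F) u).adjoint ∘L opTensor A B =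
      B ∘L (tmulLeft (A.adjoint u)).adjoint := HTensor.ext_clm fun x s => by
    simp [opTensor_htmul, tmulLeft_adjoint_htmul, ContinuousLinearMap.adjoint_inner_left]
  exact DFunLike.congr_fun h Ψ

theorem opTensor_comp (A A' : E →L[ℂ] E) (B B' : F →L[ℂ] F) :
    opTensor A B ∘L opTensor A' B' = opTensor (A ∘L A') (B ∘L B') :=
  HTensor.ext_clm fun x s => by simp [opTensor_htmul]

theorem opTensor_adjoint (A : E →L[ℂ] E) (B : F →L[ℂ] F) :
    (opTensor A B).adjoint = opTensor A.adjoint B.adjoint := by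
  refine HTensor.ext_clm fun x s => ?_
  rw [← sub_eq_zero]
  refine isTensorPair_tmul.total _ fun y t => ?_
  rw [inner_sub_right, ContinuousLinearMap.adjoint_inner_right, tmulLeft_apply, opTensor_htmul,
    opTensor_htmul, inner_htmul, inner_htmul, ContinuousLinearMap.adjoint_inner_right,
    ContinuousLinearMap.adjoint_inner_right, sub_self]

theorem IsEnsemble.partialTraceLeft {x : ι → HTensor E F} {Γ : HTensor E F →L[ℂ] HTensor E F}
    (h : IsEnsemble x Γ) :
    IsEnsemble (fun k : stdIndex E × ι => (tmulLeft (stdBasis E k.1)).adjoint (x k.2))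
      (partialTraceLeft Γ) := by
  refine IsEnsemble.hasSum_prod ?_ fun j => ?_
  · rw [ENNReal.tsum_prod (f := fun j i => ‖(tmulLeft (stdBasis E j)).adjoint (x i)‖ₑ ^ 2),
      ENNReal.tsum_comm]
    simpa only [isTensorPair_tmul.tsum_enorm_sq_adjoint] using h.ne_top
  · simpa only [ContinuousLinearMap.adjoint_adjoint] using
      h.compress (tmulLeft (stdBasis E j)).adjoint

theorem IsEnsemble.partialTraceRight {x : ι → HTensor E F} {Γ : HTensor E F →L[ℂ] HTensor E F}
    (h : IsEnsemble x Γ) :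
    IsEnsemble (fun k : stdIndex F × ι => (tmulRight (stdBasis F k.1)).adjoint (x k.2))
      (partialTraceRight Γ) := by
  refine IsEnsemble.hasSum_prod ?_ fun j => ?_
  · rw [ENNReal.tsum_prod (f := fun j i => ‖(tmulRight (stdBasis F j)).adjoint (x i)‖ₑ ^ 2),
      ENNReal.tsum_comm]
    simpa only [isTensorPair_tmul.symm.tsum_enorm_sq_adjoint] using h.ne_top
  · simpa only [ContinuousLinearMap.adjoint_adjoint] using
      h.compress (tmulRight (stdBasis F j)).adjoint

/-- This evaluates the quadratic form of the particle density at `u`: Parseval in the field factor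
leaves the contractions of the `xᵢ` with `u`. -/
theorem tsum_enorm_sq_inner_tmulRight_adjoint (x : ι → HTensor E F) (u : E) :
    ∑' k : stdIndex F × ι, ‖⟪u, (tmulRight (stdBasis F k.1)).adjoint (x k.2)⟫_ℂ‖ₑ ^ 2 =
      ∑' i, ‖(tmulLeft u).adjoint (x i)‖ₑ ^ 2 := by
  rw [ENNReal.tsum_prod
    (f := fun l i => ‖⟪u, (tmulRight (stdBasis F l)).adjoint (x i)⟫_ℂ‖ₑ ^ 2), ENNReal.tsum_comm]
  simp only [← isTensorPair_tmul.adjoint_flip, tsum_enorm_sq_inner]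

theorem opTensor_rankOne (u v : E) (Φ : HTensor E F) :
    opTensor (InnerProductSpace.rankOne ℂ v u) 1 Φ = tmulLeft v ((tmulLeft u).adjoint Φ) := by
  have h : opTensor (InnerProductSpace.rankOne ℂ v u) (1 : F →L[ℂ] F) =
      tmulLeft v ∘L (tmulLeft u).adjoint := HTensor.ext_clm fun x s => by
    rw [opTensor_htmul, ContinuousLinearMap.comp_apply, tmulLeft_adjoint_htmul, map_smul,
      InnerProductSpace.rankOne_apply, ← tmulRight_apply, map_smul]
    rfl
  exact DFunLike.congr_fun h Φ

theorem inner_opTensor_rankOne (u v : E) (Ψ Φ : HTensor E F) :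
    ⟪Ψ, opTensor (InnerProductSpace.rankOne ℂ v u) 1 Φ⟫_ℂ =
      ⟪(tmulLeft v).adjoint Ψ, (tmulLeft u).adjoint Φ⟫_ℂ := by
  rw [opTensor_rankOne, ← ContinuousLinearMap.adjoint_inner_left]

/-- The right side is a bounded sesquilinear form: Cauchy-Schwarz and `2‖xᵢ‖‖Φᵢ‖ ≤ ‖xᵢ‖² + ‖Φᵢ‖²`
give the constant. With `Φᵢ = (1 ⊗ a(f)) xᵢ` the operator is the field-particle density `σ(f)`. -/
theorem exists_operator_of_pairing {x Φ : ι → HTensor E F} (hx : ∑' i, ‖x i‖ₑ ^ 2 ≠ ⊤)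
    (hΦ : ∑' i, ‖Φ i‖ₑ ^ 2 ≠ ⊤) :
    ∃ σ : E →L[ℂ] E, ∀ u v, ⟪u, σ v⟫_ℂ =
      ∑' i, (⟪(tmulLeft v).adjoint (Φ i), (tmulLeft u).adjoint (x i)⟫_ℂ +
        ⟪(tmulLeft v).adjoint (x i), (tmulLeft u).adjoint (Φ i)⟫_ℂ) := by
  have T := isTensorPair_tmul (E := E) (F := F)
  have hs : ∀ u v, Summable fun i =>
      ⟪(tmulLeft v).adjoint (Φ i), (tmulLeft u).adjoint (x i)⟫_ℂ +
        ⟪(tmulLeft v).adjoint (x i), (tmulLeft u).adjoint (Φ i)⟫_ℂ := fun u v =>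
    (summable_inner (tsum_enorm_sq_map_ne_top _ hΦ) (tsum_enorm_sq_map_ne_top _ hx)).add
      (summable_inner (tsum_enorm_sq_map_ne_top _ hx) (tsum_enorm_sq_map_ne_top _ hΦ))
  refine exists_operator_of_form
    (fun u v => ∑' i, (⟪(tmulLeft v).adjoint (Φ i), (tmulLeft u).adjoint (x i)⟫_ℂ +
        ⟪(tmulLeft v).adjoint (x i), (tmulLeft u).adjoint (Φ i)⟫_ℂ))
    (fun u u' v => ?_) (fun c u v => ?_) (fun u v v' => ?_) (fun c u v => ?_)
    (∑' i, (‖x i‖ ^ 2 + ‖Φ i‖ ^ 2)) (fun u v => ?_)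
  · rw [← (hs u v).tsum_add (hs u' v)]
    refine tsum_congr fun i => ?_
    rw [T.adjoint_add, T.adjoint_add, inner_add_right, inner_add_right]
    ring
  · rw [← tsum_mul_left]
    refine tsum_congr fun i => ?_
    rw [T.adjoint_smul, T.adjoint_smul, inner_smul_right, inner_smul_right]
    ring
  · rw [← (hs u v).tsum_add (hs u v')]
    refine tsum_congr fun i => ?_
    rw [T.adjoint_add, T.adjoint_add, inner_add_left, inner_add_left]
    ring
  · rw [← tsum_mul_left]
    refine tsum_congr fun i => ?_
    rw [T.adjoint_smul, T.adjoint_smul, inner_smul_left, inner_smul_left, Complex.conj_conj]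
    ring
  · have hb : Summable fun i => ‖x i‖ ^ 2 + ‖Φ i‖ ^ 2 :=
      (summable_norm_sq hx).add (summable_norm_sq hΦ)
    have h1 : ∀ i, ‖⟪(tmulLeft v).adjoint (Φ i), (tmulLeft u).adjoint (x i)⟫_ℂ +
        ⟪(tmulLeft v).adjoint (x i), (tmulLeft u).adjoint (Φ i)⟫_ℂ‖ ≤
        (‖x i‖ ^ 2 + ‖Φ i‖ ^ 2) * (‖u‖ * ‖v‖) := fun i => by
      have a1 : ‖⟪(tmulLeft v).adjoint (Φ i), (tmulLeft u).adjoint (x i)⟫_ℂ‖ ≤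
          (‖v‖ * ‖Φ i‖) * (‖u‖ * ‖x i‖) := (norm_inner_le_norm _ _).trans
        (mul_le_mul (T.norm_adjoint_le v _) (T.norm_adjoint_le u _) (norm_nonneg _)
          (by positivity))
      have a2 : ‖⟪(tmulLeft v).adjoint (x i), (tmulLeft u).adjoint (Φ i)⟫_ℂ‖ ≤
          (‖v‖ * ‖x i‖) * (‖u‖ * ‖Φ i‖) := (norm_inner_le_norm _ _).trans
        (mul_le_mul (T.norm_adjoint_le v _) (T.norm_adjoint_le u _) (norm_nonneg _)
          (by positivity))
      have a3 : 2 * ‖x i‖ * ‖Φ i‖ * (‖u‖ * ‖v‖) ≤ (‖x i‖ ^ 2 + ‖Φ i‖ ^ 2) * (‖u‖ * ‖v‖) :=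
        mul_le_mul_of_nonneg_right (two_mul_le_add_sq _ _) (by positivity)
      refine (norm_add_le _ _).trans ((add_le_add a1 a2).trans (le_trans (le_of_eq ?_) a3))
      ring
    refine (tsum_of_norm_bounded (hb.mul_right (‖u‖ * ‖v‖)).hasSum h1).trans (le_of_eq ?_)
    rw [tsum_mul_right, mul_assoc]

/-- A criterion for membership in the graph of `1 ⊗ A`. -/
theorem exists_mem_idTensor_graph {A : F →ₗ.[ℂ] F} (hA : IsClosed (A.graph : Set (F × F)))
    (b : HilbertBasis ι ℂ E) (Ψ : HTensor E F) (z : ι → F) (hz : ∑' j, ‖z j‖ₑ ^ 2 ≠ ⊤)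
    (hAz : ∀ j, ((tmulLeft (b j)).adjoint Ψ, z j) ∈ A.graph) :
    ∃ Φ, (Ψ, Φ) ∈ (idTensor A : HTensor E F →ₗ.[ℂ] HTensor E F).graph ∧
      ‖Φ‖ₑ ^ 2 = ∑' j, ‖z j‖ₑ ^ 2 := by
  obtain ⟨Φ, hΦ⟩ := isTensorPair_tmul.exists_of_contractions b z hz
  refine ⟨Φ, ?_, by simp only [← isTensorPair_tmul.tsum_enorm_sq_adjoint b Φ, hΦ]⟩
  rw [idTensor_graph]
  have T := isTensorPair_tmul (E := E) (F := F)
  intro x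
  -- For fixed `Ψ`, `Φ` the admissible `x` form a closed subspace, because the graph of `A` is
  -- closed and contraction depends continuously on `x`; basis vectors therefore suffice.
  refine hilbertBasis_induction b
    (p := fun x => ((tmulLeft x).adjoint Ψ, (tmulLeft x).adjoint Φ) ∈ A.graph)
    (fun j => ?_) ?_ (fun v w hv hw => ?_) (fun c v hv => ?_) ?_ x
  · rw [hΦ]
    exact hAz j
  · have h0 : ∀ Ψ : HTensor E F, (tmulLeft (F := F) (0 : E)).adjoint Ψ = 0 := fun Ψ => by
      simpa using T.adjoint_smul 0 0 Ψ
    rw [h0, h0]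
    exact A.graph.zero_mem
  · rw [T.adjoint_add, T.adjoint_add]
    exact A.graph.add_mem hv hw
  · rw [T.adjoint_smul, T.adjoint_smul]
    exact A.graph.smul_mem _ hv
  · exact hA.preimage ((T.continuous_adjoint Ψ).prodMk (T.continuous_adjoint Φ))

theorem isClosed_idTensor_graph {A : F →ₗ.[ℂ] F} (hA : IsClosed (A.graph : Set (F × F))) :
    IsClosed ((idTensor A : HTensor E F →ₗ.[ℂ] HTensor E F).graph :
      Set (HTensor E F × HTensor E F)) := by
  rw [idTensor_graph]
  have h : (idTensorGraph (E := E) A : Set (HTensor E F × HTensor E F)) =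
      ⋂ x : E, (fun p => ((tmulLeft x).adjoint p.1, (tmulLeft x).adjoint p.2)) ⁻¹'
        (A.graph : Set (F × F)) := by
    ext p
    simp [idTensorGraph]
  rw [h]
  exact isClosed_iInter fun x => hA.preimage (by fun_prop)

end HilbertTensorProduct

/-! ### Operators on tensor powers -/

section TensorPowerOperators

variable {E : Type*} [NormedAddCommGroup E] [InnerProductSpace ℂ E] [CompleteSpace E] {n : ℕ}

/-- The elementary tensor `x₁ ⊗ ⋯ ⊗ xₙ` in the Hilbert tensor power. -/
def elemTensor (x : Fin n → E) : HTensorPow E n := (pureTensor n E x : HTensorPow E n)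

theorem HTensorPow.ext_clm {G : Type*} [NormedAddCommGroup G] [InnerProductSpace ℂ G]
    {A B : HTensorPow E n →L[ℂ] G} (h : ∀ x, A (elemTensor x) = B (elemTensor x)) : A = B := by
  refine ContinuousLinearMap.ext fun Ψ => ?_
  induction Ψ using UniformSpace.Completion.induction_on with
  | hp => exact isClosed_eq A.continuous B.continuous
  | ih t =>
    induction t using TensorPow.induction with
    | h1 c x =>
      rw [UniformSpace.Completion.coe_smul, map_smul, map_smul]
      exact congrArg (c • ·) (h x)
    | h2 s t hs ht => rw [UniformSpace.Completion.coe_add, map_add, map_add, hs, ht]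

theorem inner_elemTensor (x y : Fin n → E) :
    ⟪elemTensor x, elemTensor y⟫_ℂ = ∏ i, ⟪x i, y i⟫_ℂ := by
  rw [elemTensor, elemTensor, UniformSpace.Completion.inner_coe, inner_pureTensor]

theorem consL_coe (f : E) (t : TensorPow n E) :
    consL f (t : HTensorPow E n) = (consMap f t : HTensorPow E (n + 1)) := by
  simp [consL, ContinuousLinearMap.completion_apply_coe]

theorem consL_elemTensor (f : E) (x : Fin n → E) :
    consL f (elemTensor x) = elemTensor (Fin.cons f x : Fin (n + 1) → E) := by
  rw [elemTensor, consL_coe, consMap_pureTensor, elemTensor]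

theorem permL_elemTensor (τ : Equiv.Perm (Fin n)) (x : Fin n → E) :
    permL τ (elemTensor x) = elemTensor fun i => x (τ i) := by
  simp [permL, elemTensor, ContinuousLinearMap.completion_apply_coe]

theorem inner_consL (f g : E) (s t : HTensorPow E n) :
    ⟪consL f s, consL g t⟫_ℂ = ⟪f, g⟫_ℂ * ⟪s, t⟫_ℂ := by
  induction s, t using UniformSpace.Completion.induction_on₂ with
  | hp => exact isClosed_eq (by fun_prop) (by fun_prop)
  | ih s t =>
    rw [consL_coe, consL_coe, UniformSpace.Completion.inner_coe, inner_consMap,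
      UniformSpace.Completion.inner_coe]

theorem norm_consL_apply (f : E) (t : HTensorPow E n) : ‖consL f t‖ = ‖f‖ * ‖t‖ := by
  have h1 := inner_consL f f t t
  simp only [inner_self_eq_norm_sq_to_K, ← mul_pow] at h1
  refine (sq_eq_sq₀ (norm_nonneg _) (by positivity)).mp ?_
  exact_mod_cast h1

theorem consL_add (f g : E) : (consL (f + g) : HTensorPow E n →L[ℂ] _) = consL f + consL g := by
  refine HTensorPow.ext_clm fun x => ?_
  simp only [add_apply, elemTensor, consL_coe, ← UniformSpace.Completion.coe_add, consMap,
    liftPow_pureTensor, map_add]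

theorem consL_smul (c : ℂ) (f : E) : (consL (c • f) : HTensorPow E n →L[ℂ] _) = c • consL f := by
  refine HTensorPow.ext_clm fun x => ?_
  simp only [smul_apply, elemTensor, consL_coe, ← UniformSpace.Completion.coe_smul, consMap,
    liftPow_pureTensor, map_smul]

/-- The map `f ↦ f ⊗ t`. -/
def consR (t : HTensorPow E n) : E →L[ℂ] HTensorPow E (n + 1) :=
  LinearMap.mkContinuous
    { toFun := fun f => consL f t
      map_add' := fun f g => by rw [consL_add]; rfl
      map_smul' := fun c f => by rw [consL_smul]; rfl } ‖t‖ fun f => by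
    rw [mul_comm]
    exact (norm_consL_apply f t).le

/-- Viewing the `(n+1)`-fold power as `E` tensored with the `n`-fold power makes Parseval and the
partition identity available for contraction of the first factor. -/
theorem isTensorPair_cons : IsTensorPair (E := E) (F := HTensorPow E n) consL consR where
  flip _ _ := rfl
  inner f s g t := inner_consL f g s t
  total Ψ hΨ := by
    have h : innerSL ℂ Ψ = 0 := HTensorPow.ext_clm fun x => by
      have h1 := hΨ (x 0) (elemTensor (Fin.tail x))
      rw [consL_elemTensor, Fin.cons_self_tail] at h1
      rw [innerSL_apply_apply, ← inner_conj_symm, h1]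
      simp
    have h1 := DFunLike.congr_fun h Ψ
    simpa using h1

theorem consL_adjoint_elemTensor (f : E) (y : Fin (n + 1) → E) :
    (consL f).adjoint (elemTensor y) = ⟪f, y 0⟫_ℂ • elemTensor (Fin.tail y) := by
  rw [← sub_eq_zero]
  set Ψ := (consL f).adjoint (elemTensor y) - ⟪f, y 0⟫_ℂ • elemTensor (Fin.tail y)
  have h : innerSL ℂ Ψ = 0 := HTensorPow.ext_clm fun x => by
    rw [innerSL_apply_apply, ← inner_conj_symm]
    simp [Ψ, inner_sub_right, ContinuousLinearMap.adjoint_inner_right, consL_elemTensor,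
      inner_elemTensor, Fin.prod_univ_succ, inner_smul_right, Fin.tail]
  simpa using DFunLike.congr_fun h Ψ

/-! ### Contractivity of `q ⊗ ⋯ ⊗ q` -/

section
open scoped ComplexOrder

/-- Splitting the first factor by `⟪x, y⟫ = ⟪p x, p y⟫ + ⟪q x, q y⟫` writes the difference as a Gram
matrix of `p` times a full product plus a Gram matrix of `q` times the difference for one factor
less. The Schur product theorem makes both terms positive. -/
theorem posSemidef_prod_gram_sub {m : ℕ} {q p : E →L[ℂ] E} (hqp : IsQuadraticPartition q p)
    (x : Fin m → Fin n → E) :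
    (Matrix.of fun k l => ∏ i, ⟪x k i, x l i⟫_ℂ - ∏ i, ⟪q (x k i), q (x l i)⟫_ℂ).PosSemidef := by
  induction n with
  | zero =>
    have e : (Matrix.of fun k l => ∏ i, ⟪x k i, x l i⟫_ℂ - ∏ i, ⟪q (x k i), q (x l i)⟫_ℂ) = 0 := by
      ext k l
      simp
    rw [e]
    exact Matrix.PosSemidef.zero
  | succ n ih =>
    have h1 := (Matrix.posSemidef_gram ℂ (fun k => p (x k 0))).hadamard
      (posSemidef_prod_gram (fun k (i : Fin n) => x k i.succ))
    have h2 := (Matrix.posSemidef_gram ℂ (fun k => q (x k 0))).hadamard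
      (ih (fun k i => x k i.succ))
    have e : (Matrix.of fun k l => ∏ i, ⟪x k i, x l i⟫_ℂ - ∏ i, ⟪q (x k i), q (x l i)⟫_ℂ) =
        (Matrix.gram ℂ fun k => p (x k 0)).hadamard
          (Matrix.of fun k l => ∏ i : Fin n, ⟪x k i.succ, x l i.succ⟫_ℂ) +
        (Matrix.gram ℂ fun k => q (x k 0)).hadamard
          (Matrix.of fun k l => ∏ i : Fin n, ⟪x k i.succ, x l i.succ⟫_ℂ -
            ∏ i : Fin n, ⟪q (x k i.succ), q (x l i.succ)⟫_ℂ) := by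
      ext k l
      simp only [Matrix.of_apply, Fin.prod_univ_succ, Matrix.add_apply, Matrix.hadamard_apply,
        Matrix.gram_apply]
      rw [← hqp.inner_add (x k 0) (x l 0)]
      ring
    rw [e]
    exact h1.add h2

end

/-- The algebraic operator `q ⊗ ⋯ ⊗ q`. -/
def powMap (q : E →L[ℂ] E) : TensorPow n E →ₗ[ℂ] TensorPow n E :=
  liftPow ((pureTensor n E).compLinearMap fun _ => q.toLinearMap)

theorem powMap_pureTensor (q : E →L[ℂ] E) (x : Fin n → E) :
    powMap q (pureTensor n E x) = pureTensor n E fun i => q (x i) := by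
  simp [powMap]

-- For a finite combination of elementary tensors, `‖t‖² - ‖q^{⊗n} t‖²` is the quadratic form of the
-- preceding positive matrix at the coefficients. This bound allows the extension to the completed
-- tensor power.
open scoped ComplexOrder in
theorem norm_powMap_le {q p : E →L[ℂ] E} (hqp : IsQuadraticPartition q p) (t : TensorPow n E) :
    ‖powMap q t‖ ≤ ‖t‖ := by
  rw [@norm_eq_sqrt_re_inner ℂ, @norm_eq_sqrt_re_inner ℂ]
  refine Real.sqrt_le_sqrt ?_
  rw [← sub_nonneg, ← map_sub]
  obtain ⟨m, c, x, rfl⟩ := t.exists_sum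
  have h := (posSemidef_prod_gram_sub hqp x).dotProduct_mulVec_nonneg c
  have e : ⟪∑ k, c k • pureTensor n E (x k), ∑ k, c k • pureTensor n E (x k)⟫_ℂ -
      ⟪powMap q (∑ k, c k • pureTensor n E (x k)), powMap q (∑ k, c k • pureTensor n E (x k))⟫_ℂ =
      dotProduct (star c) ((Matrix.of fun k l => ∏ i, ⟪x k i, x l i⟫_ℂ -
        ∏ i, ⟪q (x k i), q (x l i)⟫_ℂ).mulVec c) := by
    simp only [map_sum, map_smul, powMap_pureTensor, sum_inner, inner_sum, inner_smul_left,
      inner_smul_right, inner_pureTensor, dotProduct, Matrix.mulVec, Finset.mul_sum,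
      Matrix.of_apply, Pi.star_apply, RCLike.star_def, ← Finset.sum_sub_distrib]
    rw [Finset.sum_comm]
    refine Finset.sum_congr rfl fun k _ => Finset.sum_congr rfl fun l _ => ?_
    ring
  rw [e]
  simpa using (RCLike.le_iff_re_im.mp h).1

/-- The operator `q ⊗ ⋯ ⊗ q` on the Hilbert tensor power. -/
def powL {q p : E →L[ℂ] E} (hqp : IsQuadraticPartition q p) (n : ℕ) :
    HTensorPow E n →L[ℂ] HTensorPow E n :=
  ((powMap q).mkContinuous 1 fun t => by rw [one_mul]; exact norm_powMap_le hqp t).completion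

variable {q p : E →L[ℂ] E} (hqp : IsQuadraticPartition q p)

theorem powL_elemTensor (x : Fin n → E) :
    powL hqp n (elemTensor x) = elemTensor fun i => q (x i) := by
  simp [powL, elemTensor, ContinuousLinearMap.completion_apply_coe, powMap_pureTensor]

theorem powL_zero : powL hqp 0 = ContinuousLinearMap.id ℂ _ :=
  HTensorPow.ext_clm fun x => by
    rw [powL_elemTensor]
    exact congrArg elemTensor (Subsingleton.elim _ _)

theorem permL_powL (τ : Equiv.Perm (Fin n)) (t : HTensorPow E n) :
    permL τ (powL hqp n t) = powL hqp n (permL τ t) := by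
  have h : permL τ ∘L powL hqp n = powL hqp n ∘L permL τ := HTensorPow.ext_clm fun x => by
    simp [powL_elemTensor, permL_elemTensor]
  exact DFunLike.congr_fun h t

theorem consL_adjoint_powL (f : E) (t : HTensorPow E (n + 1)) :
    (consL f).adjoint (powL hqp (n + 1) t) = powL hqp n ((consL (q f)).adjoint t) := by
  have h : (consL f).adjoint ∘L powL hqp (n + 1) = powL hqp n ∘L (consL (q f)).adjoint :=
    HTensorPow.ext_clm fun x => by
      simp only [ContinuousLinearMap.comp_apply, powL_elemTensor, consL_adjoint_elemTensor,
        map_smul]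
      rw [← ContinuousLinearMap.adjoint_inner_left, hqp.left.adjoint_eq]
      rfl
  exact DFunLike.congr_fun h t

/-- `Equiv.Perm.decomposeFin.symm (0, τ)` fixes the first factor and acts as `τ` on the rest; hence
contractions preserve symmetry. -/
theorem permL_consL_adjoint (f : E) (τ : Equiv.Perm (Fin n)) (t : HTensorPow E (n + 1)) :
    permL τ ((consL f).adjoint t) =
      (consL f).adjoint (permL (Equiv.Perm.decomposeFin.symm (0, τ)) t) := by
  have h : permL τ ∘L (consL f).adjoint =
      (consL f).adjoint ∘L permL (Equiv.Perm.decomposeFin.symm (0, τ)) :=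
    HTensorPow.ext_clm fun x => by
      simp only [ContinuousLinearMap.comp_apply, permL_elemTensor, consL_adjoint_elemTensor,
        map_smul]
      congr 2
  exact DFunLike.congr_fun h t

/-- Exchanging two contractions costs a transposition of the first two factors, which is invisible
on symmetric tensors. -/
theorem consL_adjoint_comm (f g : E) (t : HTensorPow E (n + 2)) :
    (consL f).adjoint ((consL g).adjoint t) =
      (consL g).adjoint ((consL f).adjoint (permL (Equiv.swap 0 1) t)) := by
  have h : (consL f).adjoint ∘L (consL g).adjoint =
      (consL g).adjoint ∘L (consL f).adjoint ∘L permL (n := n + 2) (Equiv.swap 0 1) :=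
    HTensorPow.ext_clm fun x => by
      simp only [ContinuousLinearMap.comp_apply, permL_elemTensor, consL_adjoint_elemTensor,
        map_smul, smul_smul]
      have h1 : (fun i : Fin n => x ((Equiv.swap (0 : Fin (n + 2)) 1) i.succ.succ)) =
          fun i => x i.succ.succ := by
        ext i
        rw [Equiv.swap_apply_of_ne_of_ne (Fin.succ_ne_zero _)]
        exact fun h => Fin.succ_ne_zero _ (Fin.succ_injective _ h)
      have h2 : Fin.tail (Fin.tail fun i => x ((Equiv.swap (0 : Fin (n + 2)) 1) i)) =
          Fin.tail (Fin.tail x) := h1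
      rw [h2, mul_comm]
      simp [Fin.tail]
  exact DFunLike.congr_fun h t

end TensorPowerOperators

/-! ### Operators on sequences of symmetric tensors -/

section Sections

variable {ι : Type*}
variable {E : Type*} [NormedAddCommGroup E] [InnerProductSpace ℂ E] [CompleteSpace E]

/-- Arbitrary sequences of symmetric tensors. -/
abbrev SymSeq (E : Type*) [NormedAddCommGroup E] [InnerProductSpace ℂ E] : Type _ :=
  ∀ n, SymPow E n

/-- Contraction of the first tensor factor with `f`. -/
def contract (f : E) : SymSeq E →ₗ[ℂ] SymSeq E where
  toFun Y n := ⟨(consL f).adjoint (Y (n + 1) : HTensorPow E (n + 1)), fun τ => by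
    rw [permL_consL_adjoint, (Y (n + 1)).2]⟩
  map_add' Y Z := by ext n; simp
  map_smul' c Y := by ext n; simp

theorem coe_contract (f : E) (Y : SymSeq E) (n : ℕ) :
    (contract f Y n : HTensorPow E n) = (consL f).adjoint (Y (n + 1) : HTensorPow E (n + 1)) :=
  rfl

theorem contract_comm (f g : E) (Y : SymSeq E) :
    contract f (contract g Y) = contract g (contract f Y) := by
  ext n
  simp only [coe_contract]
  rw [consL_adjoint_comm, (Y (n + 1 + 1)).2]

theorem contract_add (f g : E) (Y : SymSeq E) :
    contract (f + g) Y = contract f Y + contract g Y := by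
  ext n
  simp only [coe_contract, Pi.add_apply, Submodule.coe_add]
  exact isTensorPair_cons.adjoint_add f g _

theorem contract_smul (c : ℂ) (f : E) (Y : SymSeq E) :
    contract (c • f) Y = conj c • contract f Y := by
  ext n
  simp only [coe_contract, Pi.smul_apply, Submodule.coe_smul]
  exact isTensorPair_cons.adjoint_smul c f _

theorem norm_contract_le (f : E) (Y : SymSeq E) (n : ℕ) :
    ‖contract f Y n‖ ≤ ‖f‖ * ‖Y (n + 1)‖ :=
  isTensorPair_cons.norm_adjoint_le f (Y (n + 1) : HTensorPow E (n + 1))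

theorem contract_weight (f : E) (c : ℕ → ℂ) (Y : SymSeq E) :
    contract f (fun n => c n • Y n) = fun n => c (n + 1) • contract f Y n := by
  ext n
  simp [coe_contract]

theorem tsum_enorm_sq_contract (b : HilbertBasis ι ℂ E) (Y : SymSeq E) (n : ℕ) :
    ∑' j, ‖contract (b j) Y n‖ₑ ^ 2 = ‖Y (n + 1)‖ₑ ^ 2 :=
  isTensorPair_cons.tsum_enorm_sq_adjoint b (Y (n + 1) : HTensorPow E (n + 1))

variable {q p : E →L[ℂ] E} (hqp : IsQuadraticPartition q p)

theorem tsum_enorm_sq_contract_partition (hqp : IsQuadraticPartition q p) (b : HilbertBasis ι ℂ E) (Y : SymSeq E) (n : ℕ) :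
    ∑' j, ‖contract (q (b j)) Y n‖ₑ ^ 2 + ∑' j, ‖contract (p (b j)) Y n‖ₑ ^ 2 =
      ‖Y (n + 1)‖ₑ ^ 2 :=
  isTensorPair_cons.tsum_enorm_sq_partition b hqp (Y (n + 1) : HTensorPow E (n + 1))

/-- The second quantization `q ⊗ ⋯ ⊗ q` in every sector. -/
def secondQuant : SymSeq E →ₗ[ℂ] SymSeq E where
  toFun Y n := ⟨powL hqp n (Y n : HTensorPow E n), fun τ => by rw [permL_powL, (Y n).2]⟩
  map_add' Y Z := by ext n; simp
  map_smul' c Y := by ext n; simp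

theorem coe_secondQuant (Y : SymSeq E) (n : ℕ) :
    (secondQuant hqp Y n : HTensorPow E n) = powL hqp n (Y n : HTensorPow E n) := rfl

theorem secondQuant_weight (c : ℕ → ℂ) (Y : SymSeq E) :
    secondQuant hqp (fun n => c n • Y n) = fun n => c n • secondQuant hqp Y n := by
  ext n
  simp [coe_secondQuant]

theorem contract_secondQuant (f : E) (Y : SymSeq E) :
    contract f (secondQuant hqp Y) = secondQuant hqp (contract (q f) Y) := by
  ext n
  exact consL_adjoint_powL hqp f _

theorem secondQuant_zero (Y : SymSeq E) : secondQuant hqp Y 0 = Y 0 := by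
  ext
  rw [coe_secondQuant, powL_zero]
  rfl

/-- Successive contraction with `g₀, g₁, …`. -/
def contractSeq : (m : ℕ) → (Fin m → E) → (SymSeq E →ₗ[ℂ] SymSeq E)
  | 0, _ => LinearMap.id
  | m + 1, g => contractSeq m (fun i => g i.succ) ∘ₗ contract (g 0)

theorem contractSeq_contract {m : ℕ} (g : Fin m → E) (f : E) (Y : SymSeq E) :
    contractSeq m g (contract f Y) = contract f (contractSeq m g Y) := by
  induction m generalizing Y with
  | zero => rfl
  | succ m ih =>
    simp only [contractSeq, LinearMap.comp_apply]
    rw [contract_comm, ih]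

/-- After `m` contractions sector `n` comes from sector `m + n`, where the weight has to be read. -/
theorem contractSeq_weight {m : ℕ} (g : Fin m → E) (c : ℕ → ℂ) (Y : SymSeq E) :
    contractSeq m g (fun n => c n • Y n) = fun n => c (m + n) • contractSeq m g Y n := by
  induction m generalizing Y c with
  | zero => ext n; simp [contractSeq]
  | succ m ih =>
    simp only [contractSeq, LinearMap.comp_apply, contract_weight, ih (c := fun n => c (n + 1))]
    ext n
    rw [show m + n + 1 = m + 1 + n by ring]

/-- The total weight of `m` contractions through `p`, in sector `n`. -/
def splitWeight (b : HilbertBasis ι ℂ E) (m n : ℕ) (Y : SymSeq E) : ℝ≥0∞ :=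
  ∑' g : Fin m → ι, ‖secondQuant hqp (contractSeq m (fun i => p (b (g i))) Y) n‖ₑ ^ 2

variable (b : HilbertBasis ι ℂ E)

/-- The split weight is the squared norm of `p^{⊗m} ⊗ q^{⊗n}` applied to the component in sector `m
+ n`; here one `p`-factor is peeled off by separating the first contraction index. -/
theorem splitWeight_succ_left (m n : ℕ) (Y : SymSeq E) :
    splitWeight hqp b (m + 1) n Y = ∑' j, splitWeight hqp b m n (contract (p (b j)) Y) := by
  simp only [splitWeight]
  rw [← ENNReal.tsum_prod (f := fun j (g : Fin m → ι) =>
    ‖secondQuant hqp (contractSeq m (fun i => p (b (g i))) (contract (p (b j)) Y)) n‖ₑ ^ 2),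
    ← (Fin.consEquiv fun _ : Fin (m + 1) => ι).tsum_eq]
  rfl

/-- One `q`-factor is peeled off by Parseval. The contraction with `b j` passes through `q ⊗ ⋯ ⊗ q`
as contraction with `q (b j)` and then, by symmetry of the tensors, past the other contractions. -/
theorem splitWeight_succ_right (m n : ℕ) (Y : SymSeq E) :
    splitWeight hqp b m (n + 1) Y = ∑' j, splitWeight hqp b m n (contract (q (b j)) Y) := by
  simp only [splitWeight]
  rw [ENNReal.tsum_comm]
  refine tsum_congr fun g => ?_
  rw [← tsum_enorm_sq_contract b]
  simp only [contract_secondQuant, contractSeq_contract]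

/-- This is the binomial expansion of `(p² + q²)^{⊗N}` on symmetric tensors. Pascal's rule splits
the sum according to the factor peeled off; the induction hypothesis applies to the contractions
with `p (b j)` and `q (b j)`, whose squared norms add up to that of the top component. -/
theorem sum_antidiagonal_splitWeight (N : ℕ) (Y : SymSeq E) :
    ∑ ij ∈ Finset.HasAntidiagonal.antidiagonal N, (N.choose ij.1 : ℝ≥0∞) * splitWeight hqp b ij.1 ij.2 Y =
      ‖Y N‖ₑ ^ 2 := by
  induction N generalizing Y with
  | zero =>
    simp [splitWeight, contractSeq, secondQuant_zero]
  | succ N ih =>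
    rw [Finset.sum_antidiagonal_choose_succ_mul (fun m n => splitWeight hqp b m n Y)]
    -- Pascal's rule yields the complementary binomial coefficient in this half; its symmetry
    -- restores the form of the induction hypothesis.
    have e : ∑ ij ∈ Finset.HasAntidiagonal.antidiagonal N,
        (N.choose ij.2 : ℝ≥0∞) * splitWeight hqp b (ij.1 + 1) ij.2 Y =
        ∑ ij ∈ Finset.HasAntidiagonal.antidiagonal N,
        (N.choose ij.1 : ℝ≥0∞) * splitWeight hqp b (ij.1 + 1) ij.2 Y :=
      Finset.sum_congr rfl fun ij hij => by
        rw [Nat.choose_symm_of_eq_add (Finset.HasAntidiagonal.mem_antidiagonal.mp hij).symm]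
    rw [e]
    simp only [splitWeight_succ_left, splitWeight_succ_right, ← ENNReal.tsum_mul_left]
    rw [← Summable.tsum_finsetSum fun _ _ => ENNReal.summable,
      ← Summable.tsum_finsetSum fun _ _ => ENNReal.summable]
    simp only [ih]
    exact tsum_enorm_sq_contract_partition hqp b Y N

/-- Regroup the pairs `(m, n)` by their total `N = m + n`. The weight sees the particle number
before localization, so constant weights give norms and `w N = N` gives the number operator. -/
theorem tsum_splitWeight (w : ℕ → ℝ≥0∞) (Y : SymSeq E) :
    ∑' m, ∑' n, w (m + n) * ((m + n).choose m * splitWeight hqp b m n Y) =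
      ∑' N, w N * ‖Y N‖ₑ ^ 2 := by
  rw [← ENNReal.tsum_prod (f := fun m n =>
    w (m + n) * ((m + n).choose m * splitWeight hqp b m n Y)),
    ← Finset.HasAntidiagonal.sigmaAntidiagonalEquivProd.tsum_eq, ENNReal.tsum_sigma']
  refine tsum_congr fun N => ?_
  rw [← sum_antidiagonal_splitWeight hqp b N Y, tsum_fintype, Finset.mul_sum]
  rw [← Finset.sum_coe_sort (Finset.HasAntidiagonal.antidiagonal N)]
  refine Finset.sum_congr rfl fun ij _ => ?_
  have h := Finset.HasAntidiagonal.mem_antidiagonal.mp ij.2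
  simp only [Finset.HasAntidiagonal.sigmaAntidiagonalEquivProd_apply, h]

end Sections

/-! ### Operators on the Fock space -/

section FockOperators

variable {ι : Type*}
variable {E : Type*} [NormedAddCommGroup E] [InnerProductSpace ℂ E] [CompleteSpace E]

/-- The expectation value `∑ n ‖yₙ‖²` of the (unscaled) number operator. -/
def numberForm (y : Fock E) : ℝ≥0∞ := ∑' n : ℕ, (n : ℝ≥0∞) * ‖y n‖ₑ ^ 2

theorem tsum_numberForm_shift (y : Fock E) :
    ∑' n : ℕ, ((n + 1 : ℕ) : ℝ≥0∞) * ‖y (n + 1)‖ₑ ^ 2 = numberForm y := by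
  have h := tsum_eq_zero_add' (f := fun n : ℕ => (n : ℝ≥0∞) * ‖y n‖ₑ ^ 2) ENNReal.summable
  rw [numberForm, h]
  simp

/-! ### Kraus operators of the field localization -/

section Kraus

variable {q p : E →L[ℂ] E} (hqp : IsQuadraticPartition q p) (b : HilbertBasis ι ℂ E)

/-- The components of the Kraus operators of the localization. -/
def krausFun (k : Σ m, Fin m → ι) : SymSeq E →ₗ[ℂ] SymSeq E where
  toFun Y n := ((√((k.1 + n).choose k.1 : ℝ) : ℝ) : ℂ) •
    secondQuant hqp (contractSeq k.1 (fun i => p (b (k.2 i))) Y) n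
  map_add' Y Z := by ext n; simp
  map_smul' c Y := by
    ext n
    simp only [map_smul, Pi.smul_apply, RingHom.id_apply, smul_comm c]

theorem krausFun_apply (k : Σ m, Fin m → ι) (Y : SymSeq E) (n : ℕ) :
    krausFun hqp b k Y n = ((√((k.1 + n).choose k.1 : ℝ) : ℝ) : ℂ) •
      secondQuant hqp (contractSeq k.1 (fun i => p (b (k.2 i))) Y) n := rfl

theorem enorm_sq_krausFun (k : Σ m, Fin m → ι) (Y : SymSeq E) (n : ℕ) :
    ‖krausFun hqp b k Y n‖ₑ ^ 2 = ((k.1 + n).choose k.1 : ℝ≥0∞) *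
      ‖secondQuant hqp (contractSeq k.1 (fun i => p (b (k.2 i))) Y) n‖ₑ ^ 2 := by
  rw [krausFun_apply, enorm_smul, mul_pow]
  congr 1
  rw [enorm_sq_eq_ofReal, Complex.norm_real, Real.norm_eq_abs, sq_abs,
    Real.sq_sqrt (Nat.cast_nonneg _), ENNReal.ofReal_natCast]

theorem tsum_enorm_sq_krausFun (w : ℕ → ℝ≥0∞) (Y : SymSeq E) :
    ∑' k : Σ m, Fin m → ι, ∑' n, w (k.1 + n) * ‖krausFun hqp b k Y n‖ₑ ^ 2 =
      ∑' N, w N * ‖Y N‖ₑ ^ 2 := by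
  rw [← tsum_splitWeight hqp b, ENNReal.tsum_sigma']
  refine tsum_congr fun m => ?_
  rw [ENNReal.tsum_comm]
  refine tsum_congr fun n => ?_
  simp only [enorm_sq_krausFun, splitWeight, ENNReal.tsum_mul_left]

theorem tsum_enorm_sq_krausFun_le (k : Σ m, Fin m → ι) (Y : SymSeq E) :
    ∑' n, ‖krausFun hqp b k Y n‖ₑ ^ 2 ≤ ∑' N, ‖Y N‖ₑ ^ 2 := by
  have h := tsum_enorm_sq_krausFun hqp b (fun _ => 1) Y
  simp only [one_mul] at h
  rw [← h]
  exact ENNReal.le_tsum (f := fun k => ∑' n, ‖krausFun hqp b k Y n‖ₑ ^ 2) k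

theorem enorm_sq_fock (y : Fock E) : ∑' n, ‖y n‖ₑ ^ 2 = ‖y‖ₑ ^ 2 := tsum_enorm_sq_lp y

theorem norm_le_of_enorm_sq_le {V W : Type*} [SeminormedAddGroup V] [SeminormedAddGroup W]
    {x : V} {y : W} (h : ‖x‖ₑ ^ 2 ≤ ‖y‖ₑ ^ 2) : ‖x‖ ≤ ‖y‖ := by
  rw [enorm_sq_eq_ofReal, enorm_sq_eq_ofReal, ENNReal.ofReal_le_ofReal_iff (sq_nonneg _)] at h
  exact (sq_le_sq₀ (norm_nonneg _) (norm_nonneg _)).mp h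

/-- The Kraus operators of the localization: contract `m` factors with basis vectors after
applying `p` to them, and apply `q` to the remaining ones. -/
def kraus (k : Σ m, Fin m → ι) : Fock E →L[ℂ] Fock E :=
  LinearMap.mkContinuous
    { toFun := fun y => ⟨krausFun hqp b k y, memℓp_two_of_ne_top
        (ne_top_of_le_ne_top (by rw [enorm_sq_fock]; simp)
          (tsum_enorm_sq_krausFun_le hqp b k y))⟩
      map_add' := fun y z => by ext1; exact map_add (krausFun hqp b k) (y : SymSeq E) z
      map_smul' := fun c y => by ext1; exact map_smul (krausFun hqp b k) c (y : SymSeq E) }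
    1 fun y => by
      rw [one_mul]
      refine norm_le_of_enorm_sq_le ?_
      rw [← enorm_sq_fock, ← enorm_sq_fock y]
      exact tsum_enorm_sq_krausFun_le hqp b k y

theorem kraus_apply (k : Σ m, Fin m → ι) (y : Fock E) (n : ℕ) :
    kraus hqp b k y n = krausFun hqp b k y n := rfl

theorem tsum_enorm_sq_kraus (y : Fock E) : ∑' k, ‖kraus hqp b k y‖ₑ ^ 2 = ‖y‖ₑ ^ 2 := by
  have h := tsum_enorm_sq_krausFun hqp b (fun _ => 1) y
  simp only [one_mul] at h
  simpa only [← enorm_sq_fock, kraus_apply] using h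

/-- Use the weight `w N = N` and the fact that a Kraus operator takes sector `m + n` to sector `n ≤
m + n`. -/
theorem tsum_numberForm_kraus_le (y : Fock E) :
    ∑' k, numberForm (kraus hqp b k y) ≤ numberForm y := by
  rw [numberForm, ← tsum_enorm_sq_krausFun hqp b (fun n => n) y]
  refine ENNReal.tsum_le_tsum fun k => ENNReal.tsum_le_tsum fun n => ?_
  rw [kraus_apply]
  gcongr
  omega

theorem hasSum_inner_kraus (x y : Fock E) :
    HasSum (fun k => ⟪kraus hqp b k x, kraus hqp b k y⟫_ℂ) ⟪x, y⟫_ℂ :=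
  hasSum_inner_of_parseval (fun k => (kraus hqp b k).toLinearMap) (tsum_enorm_sq_kraus hqp b) x y

end Kraus

/-! ### Annihilation and creation operators -/

section Annihilation

variable (α : ℝ)

/-- The prefactor `α⁻¹ √(n+1)`. -/
def ladderCoeff (n : ℕ) : ℂ := ((α⁻¹ * √((n : ℝ) + 1) : ℝ) : ℂ)

theorem mem_annihilationGraph {f : E} {r : Fock E × Fock E} :
    r ∈ annihilationGraph α f ↔
      (r.2 : SymSeq E) = fun n => ladderCoeff α n • contract f r.1 n := by
  constructor
  · intro h
    ext n
    exact h n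
  · intro h n
    exact congrArg Subtype.val (congrFun h n)

theorem isClosed_annihilation (f : E) :
    IsClosed ((annihilation α f).graph : Set (Fock E × Fock E)) := by
  rw [annihilation_graph]
  have h : (annihilationGraph α f : Set (Fock E × Fock E)) =
      ⋂ n, {r | ((r.2 n : SymPow E n) : HTensorPow E n) = ladderCoeff α n •
        (consL f).adjoint (r.1 (n + 1) : HTensorPow E (n + 1))} := by
    ext r
    simp [annihilationGraph, ladderCoeff]
  rw [h]
  refine isClosed_iInter fun n => ?_
  have hc : ∀ n, Continuous fun y : Fock E => ((y n : SymPow E n) : HTensorPow E n) := fun n =>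
    continuous_subtype_val.comp (lp.evalCLM ℂ (fun n : ℕ => SymPow E n) 2 n).continuous
  exact isClosed_eq ((hc n).comp continuous_snd)
    ((ladderCoeff α n • (consL f).adjoint).continuous.comp ((hc (n + 1)).comp continuous_fst))

/-- The intertwining relation `a(f) K_k = K_k a(q f)`: contraction with `f` becomes contraction with
`q f` on passing `q ⊗ ⋯ ⊗ q`, and it commutes with the contractions inside `K_k`. What remains is to
match the scalar prefactors. -/
theorem kraus_mem_annihilation {q p : E →L[ℂ] E} (hqp : IsQuadraticPartition q p)
    (b : HilbertBasis ι ℂ E) (k : Σ m, Fin m → ι) {f : E} {y z : Fock E}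
    (h : (y, z) ∈ (annihilation α (q f)).graph) :
    (kraus hqp b k y, kraus hqp b k z) ∈ (annihilation α f).graph := by
  rw [annihilation_graph, mem_annihilationGraph] at h ⊢
  dsimp only at h ⊢
  funext n
  have e1 : contract f (kraus hqp b k y : SymSeq E) n =
      ((√((k.1 + (n + 1)).choose k.1 : ℝ) : ℝ) : ℂ) •
      secondQuant hqp (contractSeq k.1 (fun i => p (b (k.2 i))) (contract (q f) y)) n := by
    have h1 : (kraus hqp b k y : SymSeq E) = fun n => ((√((k.1 + n).choose k.1 : ℝ) : ℝ) : ℂ) •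
      secondQuant hqp (contractSeq k.1 (fun i => p (b (k.2 i))) y) n := rfl
    rw [h1, contract_weight f (fun n => ((√((k.1 + n).choose k.1 : ℝ) : ℝ) : ℂ)),
      contract_secondQuant, contractSeq_contract]
  rw [e1, kraus_apply, krausFun_apply, h, contractSeq_weight, secondQuant_weight, smul_smul,
    smul_smul]
  congr 1
  simp only [ladderCoeff, ← Complex.ofReal_mul]
  congr 1
  -- The binomial prefactor of the Kraus operator is exactly what reconciles the ladder factors in
  -- sectors `m + n` and `n`: it is the square root of `C(m+n, m) (m+n+1) = (n+1) C(m+n+1, m)`.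
  have h2 : √((k.1 + n).choose k.1 : ℝ) * √(((k.1 + n : ℕ) : ℝ) + 1) =
      √((n : ℝ) + 1) * √((k.1 + (n + 1)).choose k.1 : ℝ) := by
    rw [← Real.sqrt_mul (by positivity), ← Real.sqrt_mul (by positivity)]
    congr 1
    have h3 := Nat.choose_mul_succ_eq (k.1 + n) k.1
    rw [show k.1 + n + 1 - k.1 = n + 1 by omega, mul_comm ((k.1 + n + 1).choose k.1)] at h3
    exact_mod_cast h3
  linear_combination α⁻¹ * h2

theorem enorm_sq_ladderCoeff (n : ℕ) :
    ‖ladderCoeff α n‖ₑ ^ 2 = ENNReal.ofReal (α⁻¹ ^ 2) * ((n + 1 : ℕ) : ℝ≥0∞) := by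
  rw [enorm_sq_eq_ofReal, ladderCoeff, Complex.norm_real, Real.norm_eq_abs, sq_abs, mul_pow,
    Real.sq_sqrt (by positivity), ENNReal.ofReal_mul (by positivity)]
  congr 1
  rw [← ENNReal.ofReal_natCast]
  norm_cast

theorem enorm_contract_le (f : E) (Y : SymSeq E) (n : ℕ) :
    ‖contract f Y n‖ₑ ≤ ‖f‖ₑ * ‖Y (n + 1)‖ₑ := by
  rw [← ofReal_norm, ← ofReal_norm, ← ofReal_norm, ← ENNReal.ofReal_mul (norm_nonneg _)]
  exact ENNReal.ofReal_le_ofReal (norm_contract_le f Y n)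

theorem tsum_enorm_sq_annihilation_le (f : E) (y : Fock E) :
    ∑' n, ‖ladderCoeff α n • contract f y n‖ₑ ^ 2 ≤
      ENNReal.ofReal (α⁻¹ ^ 2) * ‖f‖ₑ ^ 2 * numberForm y := by
  rw [← tsum_numberForm_shift, ← ENNReal.tsum_mul_left]
  refine ENNReal.tsum_le_tsum fun n => ?_
  calc ‖ladderCoeff α n • contract f y n‖ₑ ^ 2
      = ENNReal.ofReal (α⁻¹ ^ 2) * ((n + 1 : ℕ) : ℝ≥0∞) * ‖contract f y n‖ₑ ^ 2 := by
        rw [enorm_smul, mul_pow, enorm_sq_ladderCoeff]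
    _ ≤ ENNReal.ofReal (α⁻¹ ^ 2) * ((n + 1 : ℕ) : ℝ≥0∞) * (‖f‖ₑ * ‖y (n + 1)‖ₑ) ^ 2 := by
        gcongr
        exact enorm_contract_le f y n
    _ = _ := by ring

theorem annihilation_bound_ne_top {f : E} {y : Fock E} (hy : numberForm y ≠ ⊤) :
    ENNReal.ofReal (α⁻¹ ^ 2) * ‖f‖ₑ ^ 2 * numberForm y ≠ ⊤ :=
  ENNReal.mul_ne_top (ENNReal.mul_ne_top ENNReal.ofReal_ne_top (by simp)) hy

/-- The vector `a(f) y`, for `y` in the form domain of the number operator. -/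
def annihilate (f : E) (y : Fock E) (hy : numberForm y ≠ ⊤) : Fock E :=
  ⟨fun n => ladderCoeff α n • contract f y n, memℓp_two_of_ne_top
    (ne_top_of_le_ne_top (annihilation_bound_ne_top α hy) (tsum_enorm_sq_annihilation_le α f y))⟩

theorem annihilate_mem (f : E) (y : Fock E) (hy : numberForm y ≠ ⊤) :
    (y, annihilate α f y hy) ∈ (annihilation α f).graph := by
  rw [annihilation_graph, mem_annihilationGraph]
  rfl

theorem enorm_sq_annihilate_le (f : E) (y : Fock E) (hy : numberForm y ≠ ⊤) :
    ‖annihilate α f y hy‖ₑ ^ 2 ≤ ENNReal.ofReal (α⁻¹ ^ 2) * ‖f‖ₑ ^ 2 * numberForm y := by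
  rw [← enorm_sq_fock]
  exact tsum_enorm_sq_annihilation_le α f y

theorem annihilate_add (f g : E) (y : Fock E) (hy : numberForm y ≠ ⊤) :
    annihilate α (f + g) y hy = annihilate α f y hy + annihilate α g y hy := by
  ext1
  funext n
  change ladderCoeff α n • contract (f + g) (y : SymSeq E) n =
    ladderCoeff α n • contract f (y : SymSeq E) n + ladderCoeff α n • contract g (y : SymSeq E) n
  rw [contract_add, Pi.add_apply, smul_add]

theorem annihilate_smul (c : ℂ) (f : E) (y : Fock E) (hy : numberForm y ≠ ⊤) :
    annihilate α (c • f) y hy = conj c • annihilate α f y hy := by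
  ext1
  funext n
  change ladderCoeff α n • contract (c • f) (y : SymSeq E) n =
    conj c • ladderCoeff α n • contract f (y : SymSeq E) n
  rw [contract_smul, Pi.smul_apply, smul_comm]

/-! ### Creation operators as adjoints on the form domain of the number operator -/

theorem numberForm_single (n : ℕ) (v : SymPow E n) :
    numberForm (lp.single 2 n v : Fock E) ≠ ⊤ := by
  rw [numberForm, tsum_eq_single n fun k hk => by
    rw [lp.coeFn_single, Pi.single_eq_of_ne hk, enorm_sq_eq_ofReal, norm_zero]; simp]
  exact ENNReal.mul_ne_top (by simp) (by simp)

/-- Finite-particle vectors are dense and lie in the domain. Density is what identifies the graph of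
the adjoint `a†(f)` and makes it closed. -/
theorem dense_annihilation_domain (f : E) : Dense ((annihilation α f).domain : Set (Fock E)) := by
  intro y
  refine mem_closure_of_tendsto (lp.hasSum_single (by simp) y) (Filter.Eventually.of_forall
    fun s => ?_)
  exact Submodule.sum_mem _ fun n _ =>
    LinearPMap.mem_domain_of_mem_graph (annihilate_mem α f _ (numberForm_single n (y n)))

/-- The components of `a†(f) y`. -/
def createFun (f : E) (y : Fock E) : SymSeq E
  | 0 => 0
  | n + 1 => ladderCoeff α n • (SymPow E (n + 1)).orthogonalProjectionOnto (consL f (y n))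

/-- Creation out of sector `n` carries the factor `n + 1` instead of `n`, hence the extra `‖y‖²`
next to the number form. -/
theorem tsum_enorm_sq_createFun_le (f : E) (y : Fock E) :
    ∑' n, ‖createFun α f y n‖ₑ ^ 2 ≤
      ENNReal.ofReal (α⁻¹ ^ 2) * ‖f‖ₑ ^ 2 * (numberForm y + ‖y‖ₑ ^ 2) := by
  rw [tsum_eq_zero_add' ENNReal.summable, numberForm, ← enorm_sq_fock, ← ENNReal.tsum_add,
    ← ENNReal.tsum_mul_left]
  have h0 : ‖createFun α f y 0‖ₑ ^ 2 = 0 := by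
    rw [createFun, enorm_sq_eq_ofReal, norm_zero]; simp
  rw [h0, zero_add]
  refine ENNReal.tsum_le_tsum fun n => ?_
  have h1 : ‖(SymPow E (n + 1)).orthogonalProjectionOnto (consL f (y n))‖ₑ ≤ ‖f‖ₑ * ‖y n‖ₑ := by
    rw [← ofReal_norm, ← ofReal_norm, ← ofReal_norm, ← ENNReal.ofReal_mul (norm_nonneg _)]
    refine ENNReal.ofReal_le_ofReal ?_
    refine (Submodule.norm_orthogonalProjectionOnto_apply_le _ _).trans ?_
    rw [norm_consL_apply]
    rfl
  calc ‖createFun α f y (n + 1)‖ₑ ^ 2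
      = ENNReal.ofReal (α⁻¹ ^ 2) * ((n + 1 : ℕ) : ℝ≥0∞) *
        ‖(SymPow E (n + 1)).orthogonalProjectionOnto (consL f (y n))‖ₑ ^ 2 := by
        rw [createFun, enorm_smul, mul_pow, enorm_sq_ladderCoeff]
    _ ≤ ENNReal.ofReal (α⁻¹ ^ 2) * ((n + 1 : ℕ) : ℝ≥0∞) * (‖f‖ₑ * ‖y n‖ₑ) ^ 2 := by gcongr
    _ = _ := by push_cast; ring

theorem creation_bound_ne_top {f : E} {y : Fock E} (hy : numberForm y ≠ ⊤) :
    ENNReal.ofReal (α⁻¹ ^ 2) * ‖f‖ₑ ^ 2 * (numberForm y + ‖y‖ₑ ^ 2) ≠ ⊤ :=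
  ENNReal.mul_ne_top (ENNReal.mul_ne_top ENNReal.ofReal_ne_top (by simp))
    (ENNReal.add_ne_top.mpr ⟨hy, by simp⟩)

/-- The vector `a†(f) y`, for `y` in the form domain of the number operator. -/
def create (f : E) (y : Fock E) (hy : numberForm y ≠ ⊤) : Fock E :=
  ⟨createFun α f y, memℓp_two_of_ne_top
    (ne_top_of_le_ne_top (creation_bound_ne_top α hy) (tsum_enorm_sq_createFun_le α f y))⟩

theorem enorm_sq_create_le (f : E) (y : Fock E) (hy : numberForm y ≠ ⊤) :
    ‖create α f y hy‖ₑ ^ 2 ≤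
      ENNReal.ofReal (α⁻¹ ^ 2) * ‖f‖ₑ ^ 2 * (numberForm y + ‖y‖ₑ ^ 2) := by
  rw [← enorm_sq_fock]
  exact tsum_enorm_sq_createFun_le α f y

/-- Sectorwise adjointness: `f ⊗ v` is tested only against symmetric tensors, so it may be replaced
by its symmetric projection, and the prefactor is real. -/
theorem inner_contract_eq (f : E) (W : SymSeq E) (n : ℕ) (v : SymPow E n) :
    ⟪ladderCoeff α n • contract f W n, v⟫_ℂ = ⟪W (n + 1), ladderCoeff α n •
      (SymPow E (n + 1)).orthogonalProjectionOnto (consL f (v : HTensorPow E n))⟫_ℂ := by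
  have hc : conj (ladderCoeff α n) = ladderCoeff α n := Complex.conj_ofReal _
  have hp := Submodule.inner_orthogonalProjectionOnto_eq_of_mem_left (𝕜 := ℂ) (W (n + 1))
    (consL f (v : HTensorPow E n))
  rw [Submodule.coe_inner] at hp
  rw [Submodule.coe_inner, Submodule.coe_inner, Submodule.coe_smul, Submodule.coe_smul,
    inner_smul_left, inner_smul_right, hc, hp, coe_contract,
    ContinuousLinearMap.adjoint_inner_left]

theorem inner_annihilation_create {f : E} {w z : Fock E} (h : (w, z) ∈ (annihilation α f).graph)
    (y : Fock E) (hy : numberForm y ≠ ⊤) : ⟪z, y⟫_ℂ = ⟪w, create α f y hy⟫_ℂ := by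
  rw [annihilation_graph, mem_annihilationGraph] at h
  have h2 : ∀ n, ⟪z n, y n⟫_ℂ = ⟪w (n + 1), create α f y hy (n + 1)⟫_ℂ := fun n => by
    have h3 : z n = ladderCoeff α n • contract f w n := congrFun h n
    rw [h3]
    exact inner_contract_eq α f w n (y n)
  have h0 : ⟪w 0, create α f y hy 0⟫_ℂ = 0 := inner_zero_right _
  -- The vacuum component of `a†(f) y` is zero, so the sum for the right side can start at sector
  -- one, matching the shift by one sector under `a(f)`.
  have h4 := (lp.summable_inner (𝕜 := ℂ) w (create α f y hy)).tsum_eq_zero_add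
  rw [lp.inner_eq_tsum, lp.inner_eq_tsum, h4, h0, zero_add]
  exact tsum_congr h2

theorem create_mem (f : E) (y : Fock E) (hy : numberForm y ≠ ⊤) :
    (y, create α f y hy) ∈ (creation α f).graph := by
  rw [creation, LinearPMap.adjoint_graph_eq_graph_adjoint (dense_annihilation_domain α f),
    Submodule.mem_adjoint_iff]
  intro w z h
  rw [sub_eq_zero]
  exact inner_annihilation_create α h y hy

theorem isClosed_creation (f : E) :
    IsClosed ((creation α f).graph : Set (Fock E × Fock E)) :=
  LinearPMap.adjoint_isClosed (dense_annihilation_domain α f)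

end Annihilation

end FockOperators

/-! ### The number operator and localization on `E ⊗ 𝔉(E)` -/

section Localization

variable {ι κ : Type*}
variable {E : Type*} [NormedAddCommGroup E] [InnerProductSpace ℂ E] [CompleteSpace E]

theorem IsEnsemble.reindex {H : Type*} [NormedAddCommGroup H] [InnerProductSpace ℂ H]
    [CompleteSpace H] {x : ι → H} {G : H →L[ℂ] H} (h : IsEnsemble x G) (e : κ ≃ ι) :
    IsEnsemble (fun k => x (e k)) G :=
  ⟨by rw [e.tsum_eq fun i => ‖x i‖ₑ ^ 2]; exact h.ne_top, e.hasSum_iff.mpr h.hasSum⟩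

/-- Contraction of the particle factor with a basis vector. -/
abbrev particleCoeff (Ψ : HTensor E (Fock E)) (j : stdIndex E) : Fock E :=
  (tmulLeft (stdBasis E j)).adjoint Ψ

/-- The expectation value of the (unscaled) number operator `1 ⊗ N`. -/
def numberForm₂ (Ψ : HTensor E (Fock E)) : ℝ≥0∞ := ∑' j, numberForm (particleCoeff Ψ j)

theorem sectorProj_apply (n : ℕ) (y : Fock E) : sectorProj n y = lp.single 2 n (y n) := rfl

theorem inner_sectorProj (n : ℕ) (y : Fock E) :
    ⟪y, sectorProj n y⟫_ℂ = ((‖y n‖ ^ 2 : ℝ) : ℂ) := by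
  rw [sectorProj_apply, lp.inner_single_right, Submodule.coe_inner, inner_self_eq_norm_sq_to_K,
    Submodule.coe_norm]
  norm_cast

theorem enorm_sq_sectorProj (n : ℕ) (y : Fock E) : ‖sectorProj n y‖ₑ ^ 2 = ‖y n‖ₑ ^ 2 := by
  rw [sectorProj_apply, enorm_sq_eq_ofReal, enorm_sq_eq_ofReal, lp.norm_single (by simp)]

theorem tsum_enorm_sq_coeff_ne_top (Ψ : HTensor E (Fock E)) (n : ℕ) :
    ∑' j, ‖particleCoeff Ψ j n‖ₑ ^ 2 ≠ ⊤ := by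
  have h := isTensorPair_tmul.tsum_enorm_sq_adjoint (stdBasis E) (opTensor 1 (sectorProj n) Ψ)
  have h2 : (1 : E →L[ℂ] E).adjoint = 1 := ContinuousLinearMap.adjoint_id
  simp only [tmulLeft_adjoint_opTensor, enorm_sq_sectorProj, h2] at h
  have h3 : ∑' j, ‖particleCoeff Ψ j n‖ₑ ^ 2 = ‖opTensor 1 (sectorProj n) Ψ‖ₑ ^ 2 := h
  rw [h3]
  simp

theorem inner_opTensor_sectorProj (Ψ : HTensor E (Fock E)) (n : ℕ) :
    ⟪Ψ, opTensor 1 (sectorProj n) Ψ⟫_ℂ =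
      ((∑' j, ‖particleCoeff Ψ j n‖ₑ ^ 2).toReal : ℂ) := by
  refine (isTensorPair_tmul.hasSum_inner_adjoint (stdBasis E) _ _).unique ?_
  have h2 : (1 : E →L[ℂ] E).adjoint = 1 := ContinuousLinearMap.adjoint_id
  simp only [tmulLeft_adjoint_opTensor, h2, one_apply_eq_self, inner_sectorProj]
  exact Complex.hasSum_ofReal.mpr
    (hasSum_norm_sq (x := fun j => particleCoeff Ψ j n) (tsum_enorm_sq_coeff_ne_top Ψ n))

theorem tsum_enorm_sq_coeff_le (Ψ : HTensor E (Fock E)) (n : ℕ) :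
    ∑' j, ‖particleCoeff Ψ j n‖ₑ ^ 2 ≤ ‖Ψ‖ₑ ^ 2 := by
  rw [← isTensorPair_tmul.tsum_enorm_sq_adjoint (stdBasis E) Ψ]
  refine ENNReal.tsum_le_tsum fun j => ?_
  rw [← enorm_sq_fock]
  exact ENNReal.le_tsum (f := fun n => ‖particleCoeff Ψ j n‖ₑ ^ 2) n

theorem IsEnsemble.trace_sectorProj {x : ι → HTensor E (Fock E)}
    {Γ : HTensor E (Fock E) →L[ℂ] HTensor E (Fock E)} (h : IsEnsemble x Γ) (n : ℕ) :
    trace (opTensor 1 (sectorProj n) ∘L Γ) =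
      ((∑' i, ∑' j, ‖particleCoeff (x i) j n‖ₑ ^ 2).toReal : ℂ) := by
  rw [h.trace_comp, ENNReal.tsum_toReal_eq fun i => tsum_enorm_sq_coeff_ne_top (x i) n,
    Complex.ofReal_tsum]
  simp only [inner_opTensor_sectorProj]

variable {q p : E →L[ℂ] E} (hqp : IsQuadraticPartition q p)

theorem particleCoeff_opTensor (hqp : IsQuadraticPartition q p) (B : Fock E →L[ℂ] Fock E)
    (Ψ : HTensor E (Fock E)) (u : E) :
    (tmulLeft u).adjoint (opTensor q B Ψ) = B ((tmulLeft (q u)).adjoint Ψ) := by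
  rw [tmulLeft_adjoint_opTensor, hqp.left.adjoint_eq]

theorem enorm_sq_opTensor_add (hqp : IsQuadraticPartition q p) (Ψ : HTensor E (Fock E)) :
    ‖opTensor q 1 Ψ‖ₑ ^ 2 + ‖opTensor p 1 Ψ‖ₑ ^ 2 = ‖Ψ‖ₑ ^ 2 := by
  have T := isTensorPair_tmul (E := E) (F := Fock E)
  rw [← T.tsum_enorm_sq_partition (stdBasis E) hqp Ψ, ← T.tsum_enorm_sq_adjoint (stdBasis E),
    ← T.tsum_enorm_sq_adjoint (stdBasis E)]
  simp only [tmulLeft_adjoint_opTensor, hqp.left.adjoint_eq, hqp.right.adjoint_eq,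
    one_apply_eq_self]

/-- Acting on the particle alone, `q ⊗ 1` commutes with every sector projection and is a
contraction, so no sector gains weight. -/
theorem numberForm₂_opTensor_one_le (hqp : IsQuadraticPartition q p) (Ψ : HTensor E (Fock E)) :
    numberForm₂ (opTensor q 1 Ψ) ≤ numberForm₂ Ψ := by
  simp only [numberForm₂, numberForm]
  rw [ENNReal.tsum_comm, ENNReal.tsum_comm (α := stdIndex E)]
  refine ENNReal.tsum_le_tsum fun n => ?_
  rw [ENNReal.tsum_mul_left, ENNReal.tsum_mul_left]
  refine mul_le_mul' le_rfl ?_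
  have h2 : (1 : E →L[ℂ] E).adjoint = 1 := ContinuousLinearMap.adjoint_id
  have T := isTensorPair_tmul (E := E) (F := Fock E)
  have e : ∀ Φ : HTensor E (Fock E),
      ∑' j, ‖particleCoeff Φ j n‖ₑ ^ 2 = ‖opTensor 1 (sectorProj n) Φ‖ₑ ^ 2 := fun Φ => by
    rw [← T.tsum_enorm_sq_adjoint (stdBasis E)]
    simp only [tmulLeft_adjoint_opTensor, enorm_sq_sectorProj, h2, one_apply_eq_self]
  rw [e, e]
  have h3 : opTensor 1 (sectorProj n) (opTensor q 1 Ψ) =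
      opTensor q 1 (opTensor 1 (sectorProj n) Ψ) := by
    rw [← ContinuousLinearMap.comp_apply, ← ContinuousLinearMap.comp_apply, opTensor_comp,
      opTensor_comp]
    rfl
  rw [h3, ← enorm_sq_opTensor_add hqp (opTensor 1 (sectorProj n) Ψ)]
  exact le_self_add

/-- The labels of the Kraus operators. -/
abbrev KrausIndex (E : Type*) [NormedAddCommGroup E] [InnerProductSpace ℂ E] [CompleteSpace E] :
    Type _ := Σ m, Fin m → stdIndex E

/-- The Kraus operators of the localization of the particle and the field. -/
def kraus₂ (k : KrausIndex E) : HTensor E (Fock E) →L[ℂ] HTensor E (Fock E) :=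
  opTensor q (kraus hqp (stdBasis E) k)

theorem tmulLeft_adjoint_kraus₂ (k : KrausIndex E) (u : E) (Ψ : HTensor E (Fock E)) :
    (tmulLeft u).adjoint (kraus₂ hqp k Ψ) =
      kraus hqp (stdBasis E) k ((tmulLeft (q u)).adjoint Ψ) :=
  particleCoeff_opTensor hqp _ Ψ u

theorem tsum_enorm_sq_kraus₂ (Ψ : HTensor E (Fock E)) :
    ∑' k, ‖kraus₂ hqp k Ψ‖ₑ ^ 2 = ‖opTensor q 1 Ψ‖ₑ ^ 2 := by
  have T := isTensorPair_tmul (E := E) (F := Fock E)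
  simp only [← T.tsum_enorm_sq_adjoint (stdBasis E), tmulLeft_adjoint_kraus₂]
  rw [ENNReal.tsum_comm]
  simp only [tsum_enorm_sq_kraus, particleCoeff_opTensor hqp, one_apply_eq_self]

theorem tsum_numberForm₂_kraus₂_le (Ψ : HTensor E (Fock E)) :
    ∑' k, numberForm₂ (kraus₂ hqp k Ψ) ≤ numberForm₂ Ψ := by
  refine le_trans ?_ (numberForm₂_opTensor_one_le hqp Ψ)
  simp only [numberForm₂, particleCoeff, tmulLeft_adjoint_kraus₂, particleCoeff_opTensor hqp,
    one_apply_eq_self]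
  rw [ENNReal.tsum_comm]
  exact ENNReal.tsum_le_tsum fun j => tsum_numberForm_kraus_le hqp (stdBasis E) _

/-- The vectors of the localized state. -/
def locFamily (x : ι → HTensor E (Fock E)) (c : ι × KrausIndex E) : HTensor E (Fock E) :=
  kraus₂ hqp c.2 (x c.1)

theorem tsum_enorm_sq_locFamily (x : ι → HTensor E (Fock E)) :
    ∑' c, ‖locFamily hqp x c‖ₑ ^ 2 = ∑' i, ‖opTensor q 1 (x i)‖ₑ ^ 2 := by
  simp only [← tsum_enorm_sq_kraus₂ hqp]
  exact ENNReal.tsum_prod (f := fun i k => ‖kraus₂ hqp k (x i)‖ₑ ^ 2)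

theorem tsum_enorm_sq_locFamily_ne_top {x : ι → HTensor E (Fock E)}
    (hx : ∑' i, ‖x i‖ₑ ^ 2 ≠ ⊤) : ∑' c, ‖locFamily hqp x c‖ₑ ^ 2 ≠ ⊤ := by
  rw [tsum_enorm_sq_locFamily]
  exact tsum_enorm_sq_map_ne_top _ hx

theorem tsum_numberForm₂_locFamily_ne_top {x : ι → HTensor E (Fock E)}
    (hx : ∑' i, numberForm₂ (x i) ≠ ⊤) : ∑' c, numberForm₂ (locFamily hqp x c) ≠ ⊤ := by
  refine ne_top_of_le_ne_top hx ?_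
  rw [ENNReal.tsum_prod']
  exact ENNReal.tsum_le_tsum fun i => tsum_numberForm₂_kraus₂_le hqp (x i)

/-- The particle density of the localized state. -/
theorem partialTraceRight_locFamily {x : ι → HTensor E (Fock E)}
    {Γ Γ' : HTensor E (Fock E) →L[ℂ] HTensor E (Fock E)} (h : IsEnsemble x Γ)
    (h' : IsEnsemble (locFamily hqp x) Γ') :
    partialTraceRight Γ' = q ∘L partialTraceRight Γ ∘L q := by
  have h1 := h.partialTraceRight.compress q
  rw [hqp.left.adjoint_eq] at h1
  refine h'.partialTraceRight.eq_of_quadratic h1 fun u => ?_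
  -- Both quadratic forms at `u` reduce to the contractions of the `xᵢ` with `q u`; the Kraus
  -- operators on the field drop out because their squared norms sum to that of the argument.
  rw [tsum_enorm_sq_inner_tmulRight_adjoint]
  have e : ∀ z, ⟪u, q z⟫_ℂ = ⟪q u, z⟫_ℂ := fun z => by
    rw [← ContinuousLinearMap.adjoint_inner_left, hqp.left.adjoint_eq]
  simp only [e, tsum_enorm_sq_inner_tmulRight_adjoint]
  rw [ENNReal.tsum_prod']
  simp only [locFamily, tmulLeft_adjoint_kraus₂, tsum_enorm_sq_kraus]

/-- Polarized form of `∑ K_k* K_k = 1`, summed over a family; it removes the Kraus operators from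
both density formulas. -/
theorem hasSum_inner_kraus_prod {y z : κ → Fock E} (hy : ∑' c, ‖y c‖ₑ ^ 2 ≠ ⊤)
    (hz : ∑' c, ‖z c‖ₑ ^ 2 ≠ ⊤) :
    HasSum (fun c : κ × KrausIndex E => ⟪kraus hqp (stdBasis E) c.2 (y c.1),
      kraus hqp (stdBasis E) c.2 (z c.1)⟫_ℂ) (∑' c, ⟪y c, z c⟫_ℂ) := by
  have key : ∀ {y : κ → Fock E}, ∑' c, ‖y c‖ₑ ^ 2 ≠ ⊤ →
      ∑' c : κ × KrausIndex E, ‖kraus hqp (stdBasis E) c.2 (y c.1)‖ₑ ^ 2 ≠ ⊤ := fun {y} hy => by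
    rw [ENNReal.tsum_prod (f := fun c k => ‖kraus hqp (stdBasis E) k (y c)‖ₑ ^ 2)]
    simpa only [tsum_enorm_sq_kraus] using hy
  have hs := summable_inner (key hy) (key hz)
  have h1 := hs.hasSum.prod_fiberwise fun c => hasSum_inner_kraus hqp (stdBasis E) (y c) (z c)
  rw [h1.tsum_eq]
  exact hs.hasSum

theorem tsum_enorm_sq_kraus_prod_ne_top {y : κ → Fock E} (hy : ∑' c, ‖y c‖ₑ ^ 2 ≠ ⊤) :
    ∑' c : κ × KrausIndex E, ‖kraus hqp (stdBasis E) c.2 (y c.1)‖ₑ ^ 2 ≠ ⊤ := by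
  rw [ENNReal.tsum_prod (f := fun c k => ‖kraus hqp (stdBasis E) k (y c)‖ₑ ^ 2)]
  simpa only [tsum_enorm_sq_kraus] using hy

/-! ### Annihilation and creation on families -/

variable (α : ℝ)

theorem tsum_enorm_sq_annihilate_ne_top {y : κ → Fock E} (hy : ∑' c, numberForm (y c) ≠ ⊤)
    (f : E) (h : ∀ c, numberForm (y c) ≠ ⊤) :
    ∑' c, ‖annihilate α f (y c) (h c)‖ₑ ^ 2 ≠ ⊤ := by
  refine ne_top_of_le_ne_top ?_ (ENNReal.tsum_le_tsum fun c => enorm_sq_annihilate_le α f _ (h c))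
  rw [ENNReal.tsum_mul_left]
  exact ENNReal.mul_ne_top (ENNReal.mul_ne_top ENNReal.ofReal_ne_top (by simp)) hy

theorem tsum_enorm_sq_create_ne_top {y : κ → Fock E} (hy : ∑' c, numberForm (y c) ≠ ⊤)
    (hy' : ∑' c, ‖y c‖ₑ ^ 2 ≠ ⊤) (f : E) (h : ∀ c, numberForm (y c) ≠ ⊤) :
    ∑' c, ‖create α f (y c) (h c)‖ₑ ^ 2 ≠ ⊤ := by
  refine ne_top_of_le_ne_top ?_ (ENNReal.tsum_le_tsum fun c => enorm_sq_create_le α f _ (h c))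
  rw [ENNReal.tsum_mul_left, ENNReal.tsum_add]
  exact ENNReal.mul_ne_top (ENNReal.mul_ne_top ENNReal.ofReal_ne_top (by simp))
    (ENNReal.add_ne_top.mpr ⟨hy, hy'⟩)

/-- The one-body density matrix of an ensemble. -/
theorem exists_oneBody {y : κ → Fock E} (hy : ∑' c, numberForm (y c) ≠ ⊤)
    (h : ∀ c, numberForm (y c) ≠ ⊤) :
    ∃ R : E →L[ℂ] E, ∀ f g, ⟪g, R f⟫_ℂ =
      ∑' c, ⟪annihilate α f (y c) (h c), annihilate α g (y c) (h c)⟫_ℂ := by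
  have fin := fun f => tsum_enorm_sq_annihilate_ne_top α hy f h
  have hs := fun f g => summable_inner (fin f) (fin g)
  obtain ⟨R, hR⟩ := exists_operator_of_form
    (fun g f => ∑' c, ⟪annihilate α f (y c) (h c), annihilate α g (y c) (h c)⟫_ℂ)
    (fun g g' f => by
      simp only [annihilate_add, inner_add_right]
      exact (hs _ _).tsum_add (hs _ _))
    (fun c g f => by
      simp only [annihilate_smul, inner_smul_right, tsum_mul_left])
    (fun g f f' => by
      simp only [annihilate_add, inner_add_left]
      exact (hs _ _).tsum_add (hs _ _))
    (fun c g f => by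
      simp only [annihilate_smul, inner_smul_left, tsum_mul_left, Complex.conj_conj])
    (∑' c, α⁻¹ ^ 2 * (numberForm (y c)).toReal) (fun g f => by
      have hn : ∀ f c, ‖annihilate α f (y c) (h c)‖ ^ 2 ≤
          α⁻¹ ^ 2 * ‖f‖ ^ 2 * (numberForm (y c)).toReal := fun f c => by
        have h1 := ENNReal.toReal_mono (annihilation_bound_ne_top α (h c))
          (enorm_sq_annihilate_le α f (y c) (h c))
        rwa [ENNReal.toReal_mul, ENNReal.toReal_mul, ENNReal.toReal_ofReal (sq_nonneg _),
          ENNReal.toReal_pow, ENNReal.toReal_pow, toReal_enorm, toReal_enorm] at h1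
      have hsum : Summable fun c => α⁻¹ ^ 2 * (numberForm (y c)).toReal :=
        (ENNReal.summable_toReal hy).mul_left _
      have hb : ∀ c, ‖⟪annihilate α f (y c) (h c), annihilate α g (y c) (h c)⟫_ℂ‖ ≤
          α⁻¹ ^ 2 * (numberForm (y c)).toReal * (‖g‖ * ‖f‖) := fun c => by
        refine (norm_inner_le_norm _ _).trans ?_
        refine (sq_le_sq₀ (by positivity) (by positivity)).mp ?_
        rw [mul_pow]
        refine (mul_le_mul (hn f c) (hn g c) (sq_nonneg _) (by positivity)).trans (le_of_eq ?_)
        ring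
      refine (tsum_of_norm_bounded (hsum.mul_right (‖g‖ * ‖f‖)).hasSum hb).trans (le_of_eq ?_)
      rw [tsum_mul_right]
      ring)
  exact ⟨R, fun f g => hR g f⟩

theorem mapsFamily_annihilate {y : κ → Fock E} (hy : ∑' c, numberForm (y c) ≠ ⊤)
    (hy' : ∑' c, ‖y c‖ₑ ^ 2 ≠ ⊤) (f : E) (h : ∀ c, numberForm (y c) ≠ ⊤) :
    MapsFamily (annihilation α f) y fun c => annihilate α f (y c) (h c) :=
  mapsFamily_of_isClosed (isClosed_annihilation α f) hy'
    (tsum_enorm_sq_annihilate_ne_top α hy f h) fun c => annihilate_mem α f _ (h c)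

/-- The annihilation operators on the field part of a localized ensemble. -/
theorem mapsFamily_kraus_annihilate {y : κ → Fock E} (hy : ∑' c, numberForm (y c) ≠ ⊤)
    (hy' : ∑' c, ‖y c‖ₑ ^ 2 ≠ ⊤) (f : E) (h : ∀ c, numberForm (y c) ≠ ⊤) :
    MapsFamily (annihilation α f)
      (fun c : κ × KrausIndex E => kraus hqp (stdBasis E) c.2 (y c.1))
      (fun c => kraus hqp (stdBasis E) c.2 (annihilate α (q f) (y c.1) (h c.1))) := by
  have h1 := tsum_enorm_sq_kraus_prod_ne_top hqp hy'
  have h2 := tsum_enorm_sq_kraus_prod_ne_top hqp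
    (tsum_enorm_sq_annihilate_ne_top α hy (q f) h)
  have h3 : ∀ c : κ × KrausIndex E, (kraus hqp (stdBasis E) c.2 (y c.1),
      kraus hqp (stdBasis E) c.2 (annihilate α (q f) (y c.1) (h c.1))) ∈
      (annihilation α f).graph := fun c =>
    kraus_mem_annihilation α hqp (stdBasis E) c.2 (annihilate_mem α (q f) (y c.1) (h c.1))
  exact mapsFamily_of_isClosed (isClosed_annihilation α f) h1 h2 h3

theorem exists_lower {Ψ : HTensor E (Fock E)} (h : numberForm₂ Ψ ≠ ⊤) (f : E) :
    ∃ Φ, (Ψ, Φ) ∈ (idTensor (annihilation α f) : HTensor E (Fock E) →ₗ.[ℂ] _).graph ∧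
      ‖Φ‖ₑ ^ 2 ≤ ENNReal.ofReal (α⁻¹ ^ 2) * ‖f‖ₑ ^ 2 * numberForm₂ Ψ := by
  have h1 : ∀ j, numberForm (particleCoeff Ψ j) ≠ ⊤ := ENNReal.ne_top_of_tsum_ne_top h
  obtain ⟨Φ, hΦ, hn⟩ := exists_mem_idTensor_graph (isClosed_annihilation α f) (stdBasis E) Ψ
    (fun j => annihilate α f _ (h1 j)) (tsum_enorm_sq_annihilate_ne_top α h f h1)
    (fun j => annihilate_mem α f _ (h1 j))
  refine ⟨Φ, hΦ, ?_⟩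
  rw [hn, numberForm₂, ← ENNReal.tsum_mul_left]
  exact ENNReal.tsum_le_tsum fun j => enorm_sq_annihilate_le α f _ (h1 j)

theorem exists_raise {Ψ : HTensor E (Fock E)} (h : numberForm₂ Ψ ≠ ⊤) (f : E) :
    ∃ Φ, (Ψ, Φ) ∈ (idTensor (creation α f) : HTensor E (Fock E) →ₗ.[ℂ] _).graph ∧
      ‖Φ‖ₑ ^ 2 ≤ ENNReal.ofReal (α⁻¹ ^ 2) * ‖f‖ₑ ^ 2 * (numberForm₂ Ψ + ‖Ψ‖ₑ ^ 2) := by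
  have h1 : ∀ j, numberForm (particleCoeff Ψ j) ≠ ⊤ := ENNReal.ne_top_of_tsum_ne_top h
  have h2 := isTensorPair_tmul.tsum_enorm_sq_adjoint (stdBasis E) Ψ
  obtain ⟨Φ, hΦ, hn⟩ := exists_mem_idTensor_graph (isClosed_creation α f) (stdBasis E) Ψ
    (fun j => create α f _ (h1 j))
    (tsum_enorm_sq_create_ne_top α h (by rw [h2]; simp) f h1)
    (fun j => create_mem α f _ (h1 j))
  refine ⟨Φ, hΦ, ?_⟩
  rw [hn, numberForm₂, ← h2, ← ENNReal.tsum_add, ← ENNReal.tsum_mul_left]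
  exact ENNReal.tsum_le_tsum fun j => enorm_sq_create_le α f _ (h1 j)

theorem inner_creation_annihilation {f : E} {w z y y' : Fock E}
    (h : (w, z) ∈ (annihilation α f).graph) (h' : (y, y') ∈ (creation α f).graph) :
    ⟪w, y'⟫_ℂ = ⟪z, y⟫_ℂ := by
  rw [creation, LinearPMap.adjoint_graph_eq_graph_adjoint (dense_annihilation_domain α f),
    Submodule.mem_adjoint_iff] at h'
  exact (sub_eq_zero.mp (h' w z h)).symm

end Localization

/-! ### Localized states of the particle-field system -/

section LocalizedStates

theorem isQuadraticPartition_opSqrt {H : Type*} [NormedAddCommGroup H] [InnerProductSpace ℂ H]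
    [CompleteSpace H] {S : H →L[ℂ] H} (hS : IsSelfAdjoint S) (h : 0 ≤ 1 - S ∘L S) :
    IsQuadraticPartition S (opSqrt (1 - S ∘L S)) :=
  ⟨hS, isSelfAdjoint_opSqrt _, by rw [opSqrt_comp_self h]; abel⟩

theorem one_sub_comp_self_nonneg {H : Type*} [NormedAddCommGroup H] [InnerProductSpace ℂ H]
    [CompleteSpace H] {q : H →L[ℂ] H} (h0 : 0 ≤ q) (h1 : q ≤ 1) : 0 ≤ 1 - q ∘L q := by
  have hn : ‖q‖ ≤ 1 := (CStarAlgebra.norm_le_one_iff_of_nonneg q h0).mpr h1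
  have hsa : q.adjoint = q := h0.isSelfAdjoint.adjoint_eq
  rw [ContinuousLinearMap.nonneg_iff_isPositive, ContinuousLinearMap.isPositive_iff_complex]
  intro x
  have e : ⟪(1 - q ∘L q) x, x⟫_ℂ = ((‖x‖ ^ 2 - ‖q x‖ ^ 2 : ℝ) : ℂ) := by
    have e1 : (1 - q ∘L q) x = x - q (q x) := rfl
    have e2 : ⟪q (q x), x⟫_ℂ = ⟪q x, q x⟫_ℂ := by
      rw [← ContinuousLinearMap.adjoint_inner_right, hsa]
    rw [e1, inner_sub_left, e2, inner_self_eq_norm_sq_to_K, inner_self_eq_norm_sq_to_K]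
    push_cast
    rfl
  have h2 : ‖q x‖ ≤ ‖x‖ := (q.le_opNorm x).trans (mul_le_of_le_one_left (norm_nonneg _) hn)
  have h3 : 0 ≤ ‖x‖ ^ 2 - ‖q x‖ ^ 2 := sub_nonneg.mpr (by gcongr)
  rw [e, RCLike.re_eq_complex_re, Complex.ofReal_re]
  exact ⟨rfl, h3⟩

variable {ι κ : Type*} (α : ℝ)
variable {E : Type*} [NormedAddCommGroup E] [InnerProductSpace ℂ E] [CompleteSpace E]

/-- Each sector trace is a finite nonnegative double sum, so the real-valued definition can be read
in `ℝ≥0∞`, where the sums over sectors, ensemble and particle basis interchange freely. -/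
theorem IsEnsemble.tsum_trace_sectorProj {x : ι → HTensor E (Fock E)}
    {Γ : HTensor E (Fock E) →L[ℂ] HTensor E (Fock E)} (h : IsEnsemble x Γ) :
    ∑' n : ℕ, ENNReal.ofReal ((n : ℝ) / α ^ 2 * (trace (opTensor 1 (sectorProj n) ∘L Γ)).re) =
      ENNReal.ofReal (α ^ 2)⁻¹ * ∑' i, numberForm₂ (x i) := by
  have e : ∀ n : ℕ, ENNReal.ofReal ((n : ℝ) / α ^ 2 *
      (trace (opTensor 1 (sectorProj n) ∘L Γ)).re) = ENNReal.ofReal (α ^ 2)⁻¹ *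
      ∑' i, ∑' j, (n : ℝ≥0∞) * ‖particleCoeff (x i) j n‖ₑ ^ 2 := fun n => by
    have hfin : ∑' i, ∑' j, ‖particleCoeff (x i) j n‖ₑ ^ 2 ≠ ⊤ :=
      ne_top_of_le_ne_top h.ne_top (ENNReal.tsum_le_tsum fun i => tsum_enorm_sq_coeff_le (x i) n)
    rw [h.trace_sectorProj, Complex.ofReal_re, ENNReal.ofReal_mul (by positivity),
      ENNReal.ofReal_toReal hfin, div_eq_inv_mul, ENNReal.ofReal_mul (by positivity),
      ENNReal.ofReal_natCast, mul_assoc]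
    simp only [ENNReal.tsum_mul_left]
  simp only [e]
  rw [ENNReal.tsum_mul_left, ENNReal.tsum_comm]
  congr 1
  refine tsum_congr fun i => ?_
  rw [ENNReal.tsum_comm]
  rfl

theorem IsEnsemble.tsum_trace_sectorProj_lt_top (hα : 0 < α) {x : ι → HTensor E (Fock E)}
    {Γ : HTensor E (Fock E) →L[ℂ] HTensor E (Fock E)} (h : IsEnsemble x Γ) :
    ∑' n : ℕ, ENNReal.ofReal ((n : ℝ) / α ^ 2 * (trace (opTensor 1 (sectorProj n) ∘L Γ)).re) < ⊤ ↔
      ∑' i, numberForm₂ (x i) ≠ ⊤ := by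
  have h0 : ENNReal.ofReal (α ^ 2)⁻¹ ≠ 0 := by
    rw [Ne, ENNReal.ofReal_eq_zero, not_le]
    positivity
  rw [h.tsum_trace_sectorProj, lt_top_iff_ne_top]
  constructor
  · intro h1 h2
    rw [h2, ENNReal.mul_top h0] at h1
    exact h1 rfl
  · exact ENNReal.mul_ne_top ENNReal.ofReal_ne_top

theorem mem_of_mem_idTensor {A : Fock E →ₗ.[ℂ] Fock E} {Ψ Φ : HTensor E (Fock E)}
    (h : (Ψ, Φ) ∈ (idTensor A : HTensor E (Fock E) →ₗ.[ℂ] HTensor E (Fock E)).graph) (u : E) :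
    ((tmulLeft u).adjoint Ψ, (tmulLeft u).adjoint Φ) ∈ A.graph := by
  rw [idTensor_graph] at h
  exact h u

/-- The operator `|v⟩⟨u| ⊗ (a†(f) + a(f))`. -/
def couplingOp (f u v : E) : HTensor E (Fock E) →ₗ.[ℂ] HTensor E (Fock E) :=
  (opTensor (InnerProductSpace.rankOne ℂ v u) 1).toLinearMap.compPMap
    (idTensor (creation α f) + idTensor (annihilation α f))

/-- The field-particle density of an ensemble, in terms of the vectors `(1 ⊗ a(f)) xᵢ`. -/
theorem IsEnsemble.hasFormTrace_couplingOp {x : ι → HTensor E (Fock E)}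
    {Γ : HTensor E (Fock E) →L[ℂ] HTensor E (Fock E)} (h : IsEnsemble x Γ)
    (hN : ∑' i, numberForm₂ (x i) ≠ ⊤) (f : E) {Φ : ι → HTensor E (Fock E)}
    (hΦ : ∀ i, (x i, Φ i) ∈ (idTensor (annihilation α f) : HTensor E (Fock E) →ₗ.[ℂ] _).graph)
    (hΦ' : ∑' i, ‖Φ i‖ₑ ^ 2 ≠ ⊤) (u v : E) :
    HasFormTrace Γ (LinearMap.id.toPMap ⊤) (couplingOp α f u v)
      (∑' i, (⟪(tmulLeft v).adjoint (Φ i), (tmulLeft u).adjoint (x i)⟫_ℂ +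
        ⟪(tmulLeft v).adjoint (x i), (tmulLeft u).adjoint (Φ i)⟫_ℂ)) := by
  have hN1 := ENNReal.ne_top_of_tsum_ne_top hN
  choose Φc hΦc hn using fun i => exists_raise α (hN1 i) f
  have hfin : ∑' i, ‖Φc i‖ₑ ^ 2 ≠ ⊤ := by
    refine ne_top_of_le_ne_top ?_ (ENNReal.tsum_le_tsum hn)
    rw [ENNReal.tsum_mul_left, ENNReal.tsum_add]
    exact ENNReal.mul_ne_top (ENNReal.mul_ne_top ENNReal.ofReal_ne_top (by simp))
      (ENNReal.add_ne_top.mpr ⟨hN, h.ne_top⟩)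
  have h1 := mapsFamily_of_isClosed (isClosed_idTensor_graph (isClosed_creation α f))
    h.ne_top hfin hΦc
  have h2 := mapsFamily_of_isClosed (isClosed_idTensor_graph (isClosed_annihilation α f))
    h.ne_top hΦ' hΦ
  have h3 := h.hasFormTrace (mapsFamily_id h.ne_top)
    ((h1.add h2).compPMap (opTensor (InnerProductSpace.rankOne ℂ v u) 1))
  -- The creation term is moved to the left argument as an annihilation operator. The creation
  -- vectors `Φc` thereby disappear from the value, so only the intertwining relation for `a(f)` is
  -- needed after localization.
  have e : ∀ i, ⟪x i, opTensor (InnerProductSpace.rankOne ℂ v u) 1 (Φc i + Φ i)⟫_ℂ =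
      ⟪(tmulLeft v).adjoint (Φ i), (tmulLeft u).adjoint (x i)⟫_ℂ +
        ⟪(tmulLeft v).adjoint (x i), (tmulLeft u).adjoint (Φ i)⟫_ℂ := fun i => by
    have e1 := inner_creation_annihilation α (mem_of_mem_idTensor (hΦ i) v)
      (mem_of_mem_idTensor (hΦc i) u)
    rw [inner_opTensor_rankOne, map_add, inner_add_right, e1]
  simp only [e] at h3
  exact h3

variable {q p : E →L[ℂ] E} (hqp : IsQuadraticPartition q p)

theorem locFamily_mem_annihilation {f : E} {x Φ : ι → HTensor E (Fock E)}
    (hΦ : ∀ i, (x i, Φ i) ∈ (idTensor (annihilation α (q f)) : HTensor E (Fock E) →ₗ.[ℂ] _).graph)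
    (c : ι × KrausIndex E) :
    (locFamily hqp x c, locFamily hqp Φ c) ∈
      (idTensor (annihilation α f) : HTensor E (Fock E) →ₗ.[ℂ] _).graph := by
  rw [idTensor_graph]
  intro u
  simp only [locFamily, tmulLeft_adjoint_kraus₂]
  exact kraus_mem_annihilation α hqp (stdBasis E) c.2 (mem_of_mem_idTensor (hΦ c.1) (q u))

/-- If `Φᵢ = (1 ⊗ a(q f)) xᵢ`, then `(q ⊗ K_k) Φᵢ` is `1 ⊗ a(f)` applied to `(q ⊗ K_k) xᵢ`.
Contracting with `u`, `v` moves `q` onto these vectors, and summing over `k` leaves the old pairing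
at `q u`, `q v`, `q f`. -/
theorem exists_coupling_locFamily {x : ι → HTensor E (Fock E)}
    {Γ Γ' : HTensor E (Fock E) →L[ℂ] HTensor E (Fock E)} (h : IsEnsemble x Γ)
    (h' : IsEnsemble (locFamily hqp x) Γ') (hN : ∑' i, numberForm₂ (x i) ≠ ⊤) :
    ∃ σ : E → (E →L[ℂ] E), (∀ f u v, HasFormTrace Γ (LinearMap.id.toPMap ⊤)
        (couplingOp α f u v) ⟪u, σ f v⟫_ℂ) ∧
      ∀ f u v, HasFormTrace Γ' (LinearMap.id.toPMap ⊤) (couplingOp α f u v)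
        ⟪u, (q ∘L σ (q f) ∘L q) v⟫_ℂ := by
  have hN1 := ENNReal.ne_top_of_tsum_ne_top hN
  choose Φ hΦ hn using fun f i => exists_lower α (hN1 i) f
  have hfin : ∀ f, ∑' i, ‖Φ f i‖ₑ ^ 2 ≠ ⊤ := fun f => by
    refine ne_top_of_le_ne_top ?_ (ENNReal.tsum_le_tsum (hn f))
    rw [ENNReal.tsum_mul_left]
    exact ENNReal.mul_ne_top (ENNReal.mul_ne_top ENNReal.ofReal_ne_top (by simp)) hN
  choose σ hσ using fun f => exists_operator_of_pairing h.ne_top (hfin f)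
  refine ⟨σ, fun f u v => ?_, fun f u v => ?_⟩
  · rw [hσ]
    exact h.hasFormTrace_couplingOp α hN f (hΦ f) (hfin f) u v
  · have h1 := h'.hasFormTrace_couplingOp α
      (tsum_numberForm₂_locFamily_ne_top hqp hN) f
      (locFamily_mem_annihilation α hqp (hΦ (q f)))
      (tsum_enorm_sq_locFamily_ne_top hqp (hfin (q f))) u v
    have e : ⟪u, (q ∘L σ (q f) ∘L q) v⟫_ℂ = ⟪q u, σ (q f) (q v)⟫_ℂ := by
      simp only [ContinuousLinearMap.comp_apply]
      rw [← ContinuousLinearMap.adjoint_inner_left, hqp.left.adjoint_eq]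
    rw [e, hσ]
    convert h1 using 1
    have fx : ∀ w : E, ∑' i, ‖(tmulLeft w).adjoint (x i)‖ₑ ^ 2 ≠ ⊤ := fun w =>
      tsum_enorm_sq_map_ne_top _ h.ne_top
    have fΦ : ∀ w : E, ∑' i, ‖(tmulLeft w).adjoint (Φ (q f) i)‖ₑ ^ 2 ≠ ⊤ := fun w =>
      tsum_enorm_sq_map_ne_top _ (hfin (q f))
    have h2 := hasSum_inner_kraus_prod hqp (fΦ (q v)) (fx (q u))
    have h3 := hasSum_inner_kraus_prod hqp (fx (q v)) (fΦ (q u))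
    simp only [locFamily, tmulLeft_adjoint_kraus₂]
    rw [(h2.add h3).tsum_eq]
    exact (summable_inner (fΦ (q v)) (fx (q u))).tsum_add (summable_inner (fx (q v)) (fΦ (q u)))

/-- Tracing out the particle gives the field state of `q Γ q`, transformed by the Kraus operators
alone. Intertwining then evaluates its one-body form at `q f` and `q g`. -/
theorem exists_oneBody_locFamily {x : ι → HTensor E (Fock E)}
    {Γ Γ' : HTensor E (Fock E) →L[ℂ] HTensor E (Fock E)} (h : IsEnsemble x Γ)
    (h' : IsEnsemble (locFamily hqp x) Γ') (hN : ∑' i, numberForm₂ (x i) ≠ ⊤) :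
    ∃ R : E →L[ℂ] E,
      (∀ f g, HasFormTrace (partialTraceLeft (opTensor q 1 ∘L Γ ∘L opTensor q 1))
        (annihilation α f) (annihilation α g) ⟪g, R f⟫_ℂ) ∧
      ∀ f g, HasFormTrace (partialTraceLeft Γ') (annihilation α f) (annihilation α g)
        ⟪g, (q ∘L R ∘L q) f⟫_ℂ := by
  have hadj : (opTensor q (1 : Fock E →L[ℂ] Fock E)).adjoint = opTensor q 1 := by
    rw [opTensor_adjoint, hqp.left.adjoint_eq]
    exact congrArg _ ContinuousLinearMap.adjoint_id
  have hq := h.compress (opTensor q 1)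
  rw [hadj] at hq
  -- Contractions of `(q ⊗ 1) xᵢ` with the particle basis: a decomposition of the partial trace of
  -- `q Γ q`, from which applying all `K_k` yields one of the localized field state.
  let y : stdIndex E × ι → Fock E := fun c =>
    (tmulLeft (q (stdBasis E c.1))).adjoint (x c.2)
  have hy : IsEnsemble y (partialTraceLeft (opTensor q 1 ∘L Γ ∘L opTensor q 1)) := by
    simpa only [particleCoeff_opTensor hqp, one_apply_eq_self] using hq.partialTraceLeft
  have hy' : IsEnsemble (fun c : (stdIndex E × ι) × KrausIndex E =>
      kraus hqp (stdBasis E) c.2 (y c.1)) (partialTraceLeft Γ') := by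
    have h1 := h'.partialTraceLeft.reindex
      (Equiv.prodAssoc (stdIndex E) ι (KrausIndex E))
    simp only [locFamily, tmulLeft_adjoint_kraus₂] at h1
    exact h1
  have hNy : ∑' c, numberForm (y c) ≠ ⊤ := by
    refine ne_top_of_le_ne_top hN ?_
    rw [ENNReal.tsum_prod', ENNReal.tsum_comm]
    refine ENNReal.tsum_le_tsum fun i => (le_of_eq ?_).trans
      (numberForm₂_opTensor_one_le hqp (x i))
    simp only [numberForm₂, particleCoeff, particleCoeff_opTensor hqp, one_apply_eq_self, y]
  have hNy1 := ENNReal.ne_top_of_tsum_ne_top hNy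
  obtain ⟨R, hR⟩ := exists_oneBody α hNy hNy1
  refine ⟨R, fun f g => ?_, fun f g => ?_⟩
  · rw [hR]
    exact hy.hasFormTrace (mapsFamily_annihilate α hNy hy.ne_top f hNy1)
      (mapsFamily_annihilate α hNy hy.ne_top g hNy1)
  · have e : ⟪g, (q ∘L R ∘L q) f⟫_ℂ = ⟪q g, R (q f)⟫_ℂ := by
      simp only [ContinuousLinearMap.comp_apply]
      rw [← ContinuousLinearMap.adjoint_inner_left, hqp.left.adjoint_eq]
    have h1 := hy'.hasFormTrace (mapsFamily_kraus_annihilate hqp α hNy hy.ne_top f hNy1)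
      (mapsFamily_kraus_annihilate hqp α hNy hy.ne_top g hNy1)
    have h2 := hasSum_inner_kraus_prod hqp
      (tsum_enorm_sq_annihilate_ne_top α hNy (q f) hNy1)
      (tsum_enorm_sq_annihilate_ne_top α hNy (q g) hNy1)
    rw [h2.tsum_eq] at h1
    rw [e, hR]
    exact h1

open Classical in
/-- The localization `∑ₖ Kₖ Γ Kₖ†` of the state `Γ` by `q`. -/
def localize (Γ : HTensor E (Fock E) →L[ℂ] HTensor E (Fock E)) (q : E →L[ℂ] E) :
    HTensor E (Fock E) →L[ℂ] HTensor E (Fock E) :=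
  if h : IsQuadraticPartition q (opSqrt (1 - q ∘L q)) then
    ensemble (locFamily h fun i => opSqrt Γ (stdBasis (HTensor E (Fock E)) i))
  else 0

theorem isEnsemble_localize {Γ : HTensor E (Fock E) →L[ℂ] HTensor E (Fock E)} (hΓ : IsPosTraceClass Γ)
    (h : IsQuadraticPartition q (opSqrt (1 - q ∘L q))) :
    IsEnsemble (locFamily h fun i => opSqrt Γ (stdBasis (HTensor E (Fock E)) i)) (localize Γ q) := by
  rw [localize, dif_pos h]
  exact isEnsemble_ensemble (tsum_enorm_sq_locFamily_ne_top h hΓ.isEnsemble.ne_top)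

/-- The trace of a localized state depends only on the operator acting on the particle. So only `q²
+ p² = 1` enters, and the operator `r` complementary to `p` need not be identified with `q`. -/
theorem trace_localize_add {Γ : HTensor E (Fock E) →L[ℂ] HTensor E (Fock E)} (hΓ : IsPosTraceClass Γ)
    {p r : E →L[ℂ] E} (hqp : IsQuadraticPartition q p) (hpr : IsQuadraticPartition p r)
    {Γq Γp : HTensor E (Fock E) →L[ℂ] HTensor E (Fock E)}
    (hq : IsEnsemble (locFamily hqp fun i => opSqrt Γ (stdBasis (HTensor E (Fock E)) i)) Γq)
    (hp : IsEnsemble (locFamily hpr fun i => opSqrt Γ (stdBasis (HTensor E (Fock E)) i)) Γp) :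
    trace Γ = trace Γq + trace Γp := by
  rw [hΓ.isEnsemble.trace_eq, hq.trace_eq, hp.trace_eq, ← Complex.ofReal_add,
    ← ENNReal.toReal_add hq.ne_top hp.ne_top, tsum_enorm_sq_locFamily, tsum_enorm_sq_locFamily,
    ← ENNReal.tsum_add]
  simp only [enorm_sq_opTensor_add hqp]

/-- All assertions for an abstract one-body Hilbert space `E`: nothing in the construction uses that
it is an `L²` space. -/
theorem localize_spec (hα : 0 < α) {Γ : HTensor E (Fock E) →L[ℂ] HTensor E (Fock E)}
    (hΓ : IsPosTraceClass Γ) {q : E →L[ℂ] E} (h0 : 0 ≤ q) (h1 : q ≤ 1) :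
    IsPosTraceClass (localize Γ q) ∧
      partialTraceRight (localize Γ q) = q ∘L partialTraceRight Γ ∘L q ∧
      trace Γ = trace (localize Γ q) + trace (localize Γ (opSqrt (1 - q ∘L q))) ∧
      (∑' n : ℕ, ENNReal.ofReal
          ((n : ℝ) / α ^ 2 * (trace (opTensor 1 (sectorProj n) ∘L Γ)).re) < ⊤ →
        ∑' n : ℕ, ENNReal.ofReal
          ((n : ℝ) / α ^ 2 * (trace (opTensor 1 (sectorProj n) ∘L localize Γ q)).re) < ⊤ ∧
        (∃ R : E →L[ℂ] E,
          (∀ f g, HasFormTrace (partialTraceLeft (opTensor q 1 ∘L Γ ∘L opTensor q 1))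
            (annihilation α f) (annihilation α g) ⟪g, R f⟫_ℂ) ∧
          ∀ f g, HasFormTrace (partialTraceLeft (localize Γ q)) (annihilation α f)
            (annihilation α g) ⟪g, (q ∘L R ∘L q) f⟫_ℂ) ∧
        ∃ σ : E → (E →L[ℂ] E),
          (∀ f u v, HasFormTrace Γ (LinearMap.id.toPMap ⊤) (couplingOp α f u v) ⟪u, σ f v⟫_ℂ) ∧
          ∀ f u v, HasFormTrace (localize Γ q) (LinearMap.id.toPMap ⊤) (couplingOp α f u v)
            ⟪u, (q ∘L σ (q f) ∘L q) v⟫_ℂ) := by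
  have hqp := isQuadraticPartition_opSqrt h0.isSelfAdjoint (one_sub_comp_self_nonneg h0 h1)
  have hpr : IsQuadraticPartition (opSqrt (1 - q ∘L q))
      (opSqrt (1 - opSqrt (1 - q ∘L q) ∘L opSqrt (1 - q ∘L q))) := by
    refine isQuadraticPartition_opSqrt (isSelfAdjoint_opSqrt _) ?_
    rw [opSqrt_comp_self (one_sub_comp_self_nonneg h0 h1), sub_sub_cancel]
    exact h0.isSelfAdjoint.mul_self_nonneg
  have hΓ' := hΓ.isEnsemble
  have hq := isEnsemble_localize hΓ hqp
  refine ⟨hq.isPosTraceClass, partialTraceRight_locFamily hqp hΓ' hq,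
    trace_localize_add hΓ hqp hpr hq (isEnsemble_localize hΓ hpr), fun hN => ?_⟩
  have hN' := (hΓ'.tsum_trace_sectorProj_lt_top α hα).mp hN
  exact ⟨(hq.tsum_trace_sectorProj_lt_top α hα).mpr (tsum_numberForm₂_locFamily_ne_top hqp hN'),
    exists_oneBody_locFamily α hqp hΓ' hq hN',
    exists_coupling_locFamily α hqp hΓ' hq hN'⟩

end LocalizedStates

end Polaron

end

set_option maxHeartbeats 400000 in
theorem proposition3p2 (d : ℕ) (α : ℝ) (hα : 0 < α)
    (Γ : Polaron.StateSpace d →L[ℂ] Polaron.StateSpace d) (hΓ : Polaron.IsPosTraceClass Γ) :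
    ∃ loc : (Polaron.L2 d →L[ℂ] Polaron.L2 d) →
        (Polaron.StateSpace d →L[ℂ] Polaron.StateSpace d),
      ∀ q : Polaron.L2 d →L[ℂ] Polaron.L2 d, 0 ≤ q → q ≤ 1 →
        Polaron.IsPosTraceClass (loc q) ∧
        Polaron.particleDensity (loc q) = q ∘L Polaron.particleDensity Γ ∘L q ∧
        Polaron.trace Γ = Polaron.trace (loc q) + Polaron.trace (loc (Polaron.opSqrt (1 - q ∘L q))) ∧
        (Polaron.numberExpectation α Γ < ⊤ →
          Polaron.numberExpectation α (loc q) < ⊤ ∧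
          (∃ R : Polaron.L2 d →L[ℂ] Polaron.L2 d,
            Polaron.IsOneBodyDensity α
              (Polaron.partialTraceLeft
                (Polaron.opTensor q 1 ∘L Γ ∘L Polaron.opTensor q 1)) R ∧
            Polaron.IsOneBodyDensity α (Polaron.partialTraceLeft (loc q)) (q ∘L R ∘L q)) ∧
          (∃ σ : Polaron.L2 d → (Polaron.L2 d →L[ℂ] Polaron.L2 d),
            Polaron.IsFieldParticleDensity α Γ σ ∧
            Polaron.IsFieldParticleDensity α (loc q) (fun f => q ∘L σ (q f) ∘L q))) := by
  refine ⟨Polaron.localize Γ, fun q h0 h1 => ?_⟩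
  obtain ⟨a1, a2, a3, a4⟩ := Polaron.localize_spec (E := Polaron.L2 d) α hα hΓ h0 h1
  refine ⟨a1, ?_, ?_, ?_⟩
  · exact a2
  · exact a3
  · intro hN
    -- The number expectation and the field-particle operator over `L²` are the abstract expressions
    -- after unfolding.
    have hc := a4 (by
      unfold Polaron.numberExpectation at hN
      convert hN using 5)
    clear a4 hN a1 a2 a3
    refine ⟨?_, ?_, ?_⟩
    · have hc1 := hc.1
      clear hc
      unfold Polaron.numberExpectation
      convert hc1 using 5
    · exact hc.2.1
    · have hc2 := hc.2.2
      clear hc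
      unfold Polaron.IsFieldParticleDensity Polaron.fieldParticleOp
      unfold Polaron.couplingOp at hc2
      convert hc2 using 5
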